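/- Let $A$ be a non-elementary algebraically simple $C^*$-algebra (i.e. $A$ is not isomorphic to the algebra of compact operators on any Hilbert space, $A\neq 0$, and $A$ has no two-sided ideals, closed or not, other than $0$ and $A$; $A$ need not be unital or separable). Let $\mathcal K$ be the compact operators on $\ell^2(\mathbb N)$, let $\mathrm{Ped}(A\otimes\mathcal K)$ be the Pedersen ideal (the smallest dense two-sided ideal) of $A\otimes\mathcal K$, and let $\widetilde{QT}(A)$ be the set of all (finite-valued) 2-quasitraces $\tau$ defined on $\mathrm{Ped}(A\otimes\mathcal K)$, with the topology of pointwise convergence on $\mathrm{Ped}(A\otimes\mathcal K)$. Identify $A$ with $A\otimes e_{1,1}\subset \mathrm{Ped}(A\otimes\mathcal K)$, put $\|\tau\|=\sup\{\tau(a): a\in A_+,\ \|a\|\le 1\}$ and $$QT(A)=\{\tau\in\widetilde{QT}(A):\|\tau\|=1\},$$ and let $\overline{QT(A)}^w$ be the closure of $QT(A)$ in $\widetilde{QT}(A)$. Assume that $QT(A)\neq\emptyset$ and that $A$ has strict comparison: for all $a,b\in(A\otimes\mathcal K)_+$, if $d_\tau(a)<d_\tau(b)$ for every $\tau\in\widetilde{QT}(A)\setminus\{0\}$,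 then $a\lesssim b$, that is, there are $x_n\in A\otimes\mathcal K$ with $\|a-x_n^*bx_n\|\to 0$. Here $d_\tau(a)=\lim_{\varepsilon\to0^+}\tau(f_\varepsilon(a))\in[0,\infty]$, where $f_\varepsilon$ is $0$ on $[0,\varepsilon/2]$, $1$ on $[\varepsilon,\infty)$ and linear in between. Let $l^\infty(A)$ be the $C^*$-algebra of bounded sequences in $A$ and let $$I_{\overline{QT(A)}^w}=\Big\{\{x_n\}\in l^\infty(A):\ \lim_{n\to\infty}\sup\{\tau(x_n^*x_n):\tau\in\overline{QT(A)}^w\}=0\Big\},$$ a closed two-sided ideal of $l^\infty(A)$. Then $l^\infty(A)/I_{\overline{QT(A)}^w}$ has cancellation of projections: for all projections $p,q,r\in l^\infty(A)/I_{\overline{QT(A)}^w}$, if $p,q\le r$ and $p\sim q$, then $r-p\sim r-q$, where $\sim$ is Murray–von Neumann equivalence ($p\sim q$ iff $p=v^*v$ and $q=vv^*$ for some $v$ in the quotient). -/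

import Mathlib

open Filter Topology Set
open scoped ENNReal ComplexOrder

noncomputable section

namespace QTrace

universe u

/-! ### The stabilization `A ⊗ 𝒦` -/

section Stabilization

variable (A : Type u) [NonUnitalCStarAlgebra A] [PartialOrder A] [StarOrderedRing A]

/-- The space of the universal representation of `A`: the Hilbert sum of the GNS spaces of all
positive linear functionals on `A`. -/
abbrev UnivSpace : Type u := lp (fun f : A →ₚ[ℂ] ℂ => f.GNS) 2

variable {A}

/-- The universal representation of `A`: the direct sum of all GNS representations
(a faithful representation, by the Gelfand–Naimark theorem). -/
def univRep (a : A) : UnivSpace A →L[ℂ] UnivSpace A :=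
  have key (x : UnivSpace A) (f : A →ₚ[ℂ] ℂ) :
      ‖f.gnsNonUnitalStarAlgHom a (x f)‖ ≤ ‖(((‖a‖ : ℂ) • x : UnivSpace A)) f‖ := by
    rw [lp.coeFn_smul, Pi.smul_apply, norm_smul, Complex.norm_real, norm_norm]
    exact (ContinuousLinearMap.le_opNorm _ _).trans (mul_le_mul_of_nonneg_right
      (NonUnitalStarAlgHom.norm_apply_le _ a) (norm_nonneg _))
  LinearMap.mkContinuous
    { toFun := fun x => (⟨fun f => f.gnsNonUnitalStarAlgHom a (x f),
        (lp.memℓp ((‖a‖ : ℂ) • x : UnivSpace A)).mono' (key x)⟩ : UnivSpace A)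
      map_add' := fun x y => by
        apply lp.ext; funext f
        exact map_add (f.gnsNonUnitalStarAlgHom a) (x f) (y f)
      map_smul' := fun c x => by
        apply lp.ext; funext f
        exact map_smul (f.gnsNonUnitalStarAlgHom a) c (x f) }
    ‖a‖ (fun x => by
      refine (lp.norm_mono two_ne_zero (y := ((‖a‖ : ℂ) • x : UnivSpace A)) (key x)).trans ?_
      rw [norm_smul, Complex.norm_real, norm_norm])

@[simp]
lemma univRep_apply (a : A) (x : UnivSpace A) (f : A →ₚ[ℂ] ℂ) :
    univRep a x f = f.gnsNonUnitalStarAlgHom a (x f) := rfl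

variable (A)

/-- The Hilbert space `H ⊗ ℓ²(ℕ) = ⨁_{n ∈ ℕ} H`, with `H` the space of the universal
representation of `A`. -/
abbrev StabSpace : Type u := lp (fun _ : ℕ => UnivSpace A) 2

variable {A}

/-- The operator `a ⊗ e_{i,j}` on `H ⊗ ℓ²(ℕ)`. -/
def elemTensor (a : A) (i j : ℕ) : StabSpace A →L[ℂ] StabSpace A :=
  (lp.singleContinuousLinearMap ℂ (fun _ : ℕ => UnivSpace A) 2 i).comp
    ((univRep a).comp (lp.evalCLM ℂ (fun _ : ℕ => UnivSpace A) 2 j))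

lemma elemTensor_apply (a : A) (i j : ℕ) (x : StabSpace A) :
    elemTensor a i j x = lp.single 2 i (univRep a (x j)) := rfl

lemma elemTensor_mul (a b : A) (i j k : ℕ) :
    elemTensor a i j * elemTensor b j k = elemTensor (a * b) i k := by
  ext1 x
  rw [mul_apply_eq_comp, elemTensor_apply, elemTensor_apply, elemTensor_apply,
    lp.single_apply_self]
  congr 1
  apply lp.ext; funext f
  simp [map_mul]

lemma inner_univRep_left (a : A) (x y : UnivSpace A) :
    inner ℂ (univRep a x) y = inner ℂ x (univRep (star a) y) := by
  rw [lp.inner_eq_tsum, lp.inner_eq_tsum]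
  congr 1; funext f
  rw [univRep_apply, univRep_apply, map_star, ContinuousLinearMap.star_eq_adjoint,
    ContinuousLinearMap.adjoint_inner_right]

lemma star_elemTensor (a : A) (i j : ℕ) :
    star (elemTensor a i j) = elemTensor (star a) j i := by
  rw [ContinuousLinearMap.star_eq_adjoint, eq_comm, ContinuousLinearMap.eq_adjoint_iff]
  intro x y
  rw [elemTensor_apply, elemTensor_apply, lp.inner_single_left, lp.inner_single_right,
    inner_univRep_left, star_star]

variable (A)

/-- `A ⊗ 𝒦` as a concrete C⋆-algebra: the norm closure in `B(H ⊗ ℓ²(ℕ))` of the ⋆-algebra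
generated by the elementary tensors `a ⊗ e_{i,j}`. -/
def stabSubalgebra : NonUnitalStarSubalgebra ℂ (StabSpace A →L[ℂ] StabSpace A) :=
  (NonUnitalStarAlgebra.adjoin ℂ
    {T | ∃ (a : A) (i j : ℕ), T = elemTensor a i j}).topologicalClosure

/-- The stabilization `A ⊗ 𝒦`. -/
def Stab : Type u := stabSubalgebra A

instance : NonUnitalCStarAlgebra (Stab A) :=
  NonUnitalStarSubalgebra.nonUnitalCStarAlgebra (stabSubalgebra A)
    (h_closed := NonUnitalStarSubalgebra.isClosed_topologicalClosure _)

instance : PartialOrder (Stab A) := CStarAlgebra.spectralOrder (Stab A)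

instance : StarOrderedRing (Stab A) := CStarAlgebra.spectralOrderedRing (Stab A)

variable {A}

/-- The canonical embedding `a ↦ a ⊗ e_{0,0}` of `A` into `A ⊗ 𝒦`. -/
def corner (a : A) : Stab A :=
  ⟨elemTensor a 0 0, NonUnitalStarSubalgebra.le_topologicalClosure _
    (NonUnitalStarAlgebra.subset_adjoin ℂ _ ⟨a, 0, 0, rfl⟩)⟩

lemma corner_mul (a b : A) : corner (a * b) = corner a * corner b :=
  Subtype.ext (elemTensor_mul a b 0 0 0).symm

lemma corner_star (a : A) : corner (star a) = star (corner a) :=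
  Subtype.ext (star_elemTensor a 0 0).symm

end Stabilization

/-! ### The Pedersen ideal and 2-quasitraces -/

section Quasitraces

/-- The Pedersen ideal: the smallest norm-dense two-sided ideal. -/
def pedersenIdeal (B : Type u) [NonUnitalCStarAlgebra B] : TwoSidedIdeal B :=
  sInf {J : TwoSidedIdeal B | Dense (J : Set B)}

/-- `τ` is a (1-)quasitrace defined on `Ped(B)`. A function on `Ped(B)` is encoded as a function
on `B` vanishing outside `Ped(B)`. The conditions `nonneg` and `tracial` say nothing about
`x ∉ Ped(B)`: for such `x` neither `x^* x` nor `x x^*` belongs to `Ped(B)`, and both values of `τ`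
are zero. -/
structure IsQuasitrace {B : Type u} [NonUnitalCStarAlgebra B] (τ : B → ℂ) : Prop where
  eq_zero_of_notMem : ∀ x, x ∉ pedersenIdeal B → τ x = 0
  nonneg : ∀ x, 0 ≤ (τ (star x * x)).re ∧ (τ (star x * x)).im = 0
  tracial : ∀ x, τ (star x * x) = τ (x * star x)
  add_I_smul : ∀ a ∈ pedersenIdeal B, ∀ b ∈ pedersenIdeal B, IsSelfAdjoint a → IsSelfAdjoint b →
    τ (a + Complex.I • b) = τ a + Complex.I * τ b
  /-- `τ` is linear on each abelian C⋆-subalgebra `C` of `Ped(B)`. -/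
  linear_on_abelian : ∀ C : NonUnitalStarSubalgebra ℂ B, IsClosed (C : Set B) →
    (∀ x ∈ C, ∀ y ∈ C, x * y = y * x) → (∀ x ∈ C, x ∈ pedersenIdeal B) →
    (∀ x ∈ C, ∀ y ∈ C, τ (x + y) = τ x + τ y) ∧ (∀ (c : ℂ), ∀ x ∈ C, τ (c • x) = c * τ x)

/-- `τ` is a 2-quasitrace defined on `Ped(B)`: a quasitrace that extends, through
`x ↦ x ⊗ e_{1,1}`, to a quasitrace on `Ped(M₂(B)) = M₂(Ped(B))`. -/
def Is2Quasitrace {B : Type u} [NonUnitalCStarAlgebra B] [PartialOrder B] [StarOrderedRing B]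
    (τ : B → ℂ) : Prop :=
  IsQuasitrace τ ∧ ∃ τ₂ : CStarMatrix (Fin 2) (Fin 2) B → ℂ, IsQuasitrace τ₂ ∧
    ∀ x ∈ pedersenIdeal B, τ₂ (CStarMatrix.ofMatrix !![x, 0; 0, 0]) = τ x

variable (A : Type u) [NonUnitalCStarAlgebra A] [PartialOrder A] [StarOrderedRing A]

/-- The set of densely defined 2-quasitraces on `A ⊗ 𝒦`, that is, of 2-quasitraces defined (with
finite values) on `Ped(A ⊗ 𝒦)`; the zero quasitrace is included. -/
def DQT : Type u := {τ : Stab A → ℂ // Is2Quasitrace τ}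

instance : CoeFun (DQT A) (fun _ => Stab A → ℂ) := ⟨Subtype.val⟩

/-- The topology of pointwise convergence on `Ped(A ⊗ 𝒦)`. All `τ` vanish identically outside
`Ped(A ⊗ 𝒦)`, so this is the topology of pointwise convergence on `A ⊗ 𝒦`. -/
instance : TopologicalSpace (DQT A) :=
  TopologicalSpace.induced (fun τ => (τ : Stab A → ℂ)) inferInstance

/-- `QT(A)`: the set of 2-quasitraces `τ` with `‖τ‖ = 1`, where
`‖τ‖ = ‖τ|_A‖ = sup {τ(a) : a ∈ A₊, ‖a‖ ≤ 1}` (used when `A = Ped(A)`; then `A` lies in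
`Ped(A ⊗ 𝒦)`). -/
def QT : Set (DQT A) :=
  {τ | IsLUB {t : ℝ | ∃ a : A, 0 ≤ a ∧ ‖a‖ ≤ 1 ∧ t = (τ (corner a)).re} 1}

end Quasitraces

/-! ### Strict comparison -/

section Comparison

/-- The function `f_ε`, equal to `0` on `(-∞, ε/2]`, to `1` on `[ε, ∞)` and linear in between. -/
def cutoff (ε t : ℝ) : ℝ := max 0 (min 1 ((2 * t - ε) / ε))

/-- Cuntz subequivalence of positive elements of `B`. -/
def CuntzLE {B : Type u} [NonUnitalCStarAlgebra B] (a b : B) : Prop :=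
  ∃ x : ℕ → B, Tendsto (fun n => ‖a - star (x n) * b * x n‖) atTop (𝓝 0)

variable {A : Type u} [NonUnitalCStarAlgebra A] [PartialOrder A] [StarOrderedRing A]

/-- The dimension function `d_τ(a) = lim_{ε → 0+} τ(f_ε(a)) ∈ [0, ∞]`, for `a ∈ (A ⊗ 𝒦)₊`. The
limit exists, since `τ(f_ε(a)) ≥ 0` increases as `ε` decreases. -/
def dimFun (τ : DQT A) (a : Stab A) : ℝ≥0∞ :=
  limUnder (𝓝[>] (0 : ℝ)) (fun ε => ENNReal.ofReal (τ (cfcₙ (cutoff ε) a)).re)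

variable (A)

/-- Blackadar's strict comparison of positive elements of `A ⊗ 𝒦`, for a simple C⋆-algebra. -/
def StrictComparison : Prop :=
  ∀ a b : Stab A, 0 ≤ a → 0 ≤ b →
    (∀ τ : DQT A, (∃ x, τ x ≠ 0) → dimFun τ a < dimFun τ b) → CuntzLE a b

/-- `A` is elementary: isomorphic to the algebra of compact operators on some Hilbert space. -/
def IsElementary : Prop :=
  ∃ (H : Type u) (_ : NormedAddCommGroup H) (_ : InnerProductSpace ℂ H) (_ : CompleteSpace H)
    (φ : A →⋆ₙₐ[ℂ] (H →L[ℂ] H)),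
    Function.Injective φ ∧ Set.range φ = {T : H →L[ℂ] H | IsCompactOperator T}

end Comparison

/-! ### The quotient `l^∞(A)/I_T` -/

section SequenceAlgebra

variable {A : Type u} [NonUnitalCStarAlgebra A] [PartialOrder A] [StarOrderedRing A]

/-- `I_T`: the bounded sequences `(x_n)` with `lim_n sup {τ(x_n^* x_n) : τ ∈ T} = 0`. -/
def nullSeq (T : Set (DQT A)) : Set (lp (fun _ : ℕ => A) ∞) :=
  {x | Tendsto (fun n => ⨆ τ ∈ T, ENNReal.ofReal (τ (corner (star (x n) * x n))).re)
    atTop (𝓝 0)}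

/-- `I_T` as a two-sided ideal of `l^∞(A)`. For `A = Ped(A)` the set `nullSeq T` is itself a
(closed) two-sided ideal, so that passing to the generated ideal adds nothing. -/
def nullIdeal (T : Set (DQT A)) : TwoSidedIdeal (lp (fun _ : ℕ => A) ∞) :=
  TwoSidedIdeal.span (nullSeq T)

/-- The quotient `l^∞(A)/I_T`. -/
def SeqQuotient (T : Set (DQT A)) : Type u := (nullIdeal T).ringCon.Quotient

instance (T : Set (DQT A)) : NonUnitalRing (SeqQuotient T) :=
  inferInstanceAs (NonUnitalRing (nullIdeal T).ringCon.Quotient)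

/-- `I_T` is closed under the adjoint, since `τ(x x^*) = τ(x^* x)`. -/
lemma star_mem_nullSeq {T : Set (DQT A)} {x : lp (fun _ : ℕ => A) ∞} (hx : x ∈ nullSeq T) :
    star x ∈ nullSeq T := by
  have h (τ : DQT A) (n : ℕ) : τ (corner (star ((star x : lp (fun _ : ℕ => A) ∞) n) *
      (star x : lp (fun _ : ℕ => A) ∞) n)) = τ (corner (star (x n) * x n)) := by
    rw [lp.star_apply, star_star, corner_mul, corner_mul, corner_star]
    exact (τ.2.1.tracial (corner (x n))).symm
  simpa only [nullSeq, mem_ofPred_eq, h] using hx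

lemma star_mem_nullIdeal {T : Set (DQT A)} {x : lp (fun _ : ℕ => A) ∞} (hx : x ∈ nullIdeal T) :
    star x ∈ nullIdeal T := by
  unfold nullIdeal at hx ⊢
  induction hx using TwoSidedIdeal.span_induction with
  | mem x h => exact TwoSidedIdeal.subset_span (star_mem_nullSeq h)
  | zero => rw [star_zero]; exact TwoSidedIdeal.zero_mem _
  | add x y hx hy h₁ h₂ => rw [star_add]; exact TwoSidedIdeal.add_mem _ h₁ h₂
  | neg x hx h => rw [star_neg]; exact TwoSidedIdeal.neg_mem _ h
  | left_absorb a x hx h => rw [star_mul]; exact TwoSidedIdeal.mul_mem_right _ _ _ h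
  | right_absorb b x hx h => rw [star_mul]; exact TwoSidedIdeal.mul_mem_left _ _ _ h

/-- The quotient map `Π : l^∞(A) → l^∞(A)/I_T`. -/
def quotientMap (T : Set (DQT A)) (x : lp (fun _ : ℕ => A) ∞) : SeqQuotient T :=
  RingCon.toQuotient (c := (nullIdeal T).ringCon) x

/-- The involution of `l^∞(A)/I_T`, given by `Π(x)^* = Π(x^*)`. -/
instance (T : Set (DQT A)) : StarRing (SeqQuotient T) where
  star := Quotient.map' star fun x y h => by
    have h' : x - y ∈ nullIdeal T := (TwoSidedIdeal.rel_iff _ x y).1 h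
    refine (TwoSidedIdeal.rel_iff _ _ _).2 ?_
    rw [← star_sub]
    exact star_mem_nullIdeal h'
  star_involutive := by
    rintro ⟨x⟩
    exact congrArg (quotientMap T) (star_star x)
  star_mul := by
    rintro ⟨x⟩ ⟨y⟩
    exact congrArg (quotientMap T) (star_mul x y)
  star_add := by
    rintro ⟨x⟩ ⟨y⟩
    exact congrArg (quotientMap T) (star_add x y)

end SequenceAlgebra

/-! ### Cancellation of projections -/

section Projections

variable {B : Type u} [NonUnitalRing B] [StarRing B]

/-- Murray–von Neumann equivalence of projections. -/
def MvNEquiv (p q : B) : Prop := ∃ v : B, star v * v = p ∧ v * star v = q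

variable (B)

/-- Cancellation of projections: if `p, q ≤ r` and `p ∼ q`, then `r - p ∼ r - q`. The order
`p ≤ r` of projections is expressed as `p r = p`. -/
def HasProjectionCancellation : Prop :=
  ∀ p q r : B, IsStarProjection p → IsStarProjection q → IsStarProjection r →
    p * r = p → q * r = q → MvNEquiv p q → MvNEquiv (r - p) (r - q)

end Projections

end QTrace

/-! The rank of a positive element `a` at a quasitrace `τ` is `d_τ(a)`, here `rk`. A projection `P`
of the quotient has an asymptotic rank, well defined up to errors tending to zero uniformly on
`QT(A)`: lift `P` to positive elements `a_n` and take the ranks of `(a_n - s)₊`, for any `s`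
strictly between 0 and 1 (`evLE_rkSeq_of_mkQ_eq`). This rank is additive on orthogonal projections
(`qrank_add_evLE`, `qrank_add_le`), invariant under equivalence (`qrank_evLE_of_star_mul_self`) and
bounded by 1. Hence `p ∼ q` below `r` forces `r - p` and `r - q` to have the same asymptotic rank,
by subtracting the common finite rank of `p` and `q`. It remains to see that projections of equal
rank are equivalent.

This rests on `exists_star_mul_self_eq_of_qrank_evLE`: if the rank of `P` is asymptotically at most
that of `R`, then `P` is equivalent to a projection below `R`. Let `u_n` and `β_n` be positive lifts
of `P` and `R`. Since `A` is simple and nonelementary, it contains elements `e` whose rank is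
uniformly small on `QT(A)` and yet bounded away from zero (`exists_rk_corner_mem_Icc`). For large
`n` the rank of `u_n` is then strictly below that of `β_n² ⊕ e`, so strict comparison applies in `A
⊗ 𝒦` and gives `u_n³ ≈ y*y + z*z`, with `y` in the range of `β_n` and `z*z` of rank at most that of
`e` (`exists_approx_star_mul_self`). Letting `e` shrink slowly along the sequence puts `(z_n)` in
the ideal, and `P = P³ = Y*Y` with `RY = Y`. When the ranks agree, the defect `R - YY*` has rank
zero, hence is zero.

Quasitraces are additive only on commuting elements, so all estimates are made with ranks.
Superadditivity on orthogonal elements comes from linearity on abelian subalgebras, subadditivity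
from the extension to 2×2 matrices. The ideal is described by ranks as well (`mem_nullIdeal_iff`),
through Markov-type inequalities between `τ(a)` and the ranks of `(a - t)₊`.

Strict comparison concerns all nonzero densely defined 2-quasitraces. Algebraic simplicity makes
each of them bounded and nonzero on `A`, so it is a multiple of a normalized one
(`exists_mem_QT_eq_mul`). -/

namespace QTrace

universe u

/-! ### Functional calculus and Cuntz subequivalence -/

section Toolbox

/-- The positive part `(x - t)₊`. -/
def ramp (t x : ℝ) : ℝ := max (x - t) 0

/-- An approximate unit: `chi n x = min ((n + 1) x) 1` for `x ≥ 0`. -/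
def chi (n : ℕ) (x : ℝ) : ℝ := x / max x (1 / ((n : ℝ) + 1))

/-- The function `psi n x = √x / max x (1 / (n + 1))`, so that `√x * psi n x = chi n x`. -/
def psi (n : ℕ) (x : ℝ) : ℝ := √x / max x (1 / ((n : ℝ) + 1))

lemma chi_den_pos (n : ℕ) (x : ℝ) : 0 < max x (1 / ((n : ℝ) + 1)) :=
  lt_max_of_lt_right (by positivity)

@[fun_prop] lemma continuous_ramp (t : ℝ) : Continuous (ramp t) := by unfold ramp; fun_prop

@[fun_prop] lemma continuous_chi (n : ℕ) : Continuous (chi n) := by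
  unfold chi
  exact continuous_id.div (by fun_prop) fun x => (chi_den_pos n x).ne'

@[fun_prop] lemma continuous_psi (n : ℕ) : Continuous (psi n) := by
  unfold psi
  exact Real.continuous_sqrt.div (by fun_prop) fun x => (chi_den_pos n x).ne'

@[fun_prop] lemma continuous_cutoff (ε : ℝ) : Continuous (cutoff ε) := by unfold cutoff; fun_prop

lemma ramp_zero {t : ℝ} (ht : 0 ≤ t) : ramp t 0 = 0 := by simp [ramp, ht]
@[simp] lemma chi_zero (n : ℕ) : chi n 0 = 0 := by simp [chi]
@[simp] lemma psi_zero (n : ℕ) : psi n 0 = 0 := by simp [psi]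
@[simp] lemma cutoff_zero (ε : ℝ) : cutoff ε 0 = 0 := by
  rcases eq_or_ne ε 0 with rfl | h <;> simp [cutoff, *]

lemma ramp_nonneg (t x : ℝ) : 0 ≤ ramp t x := le_max_right _ _
lemma cutoff_nonneg (ε x : ℝ) : 0 ≤ cutoff ε x := le_max_left _ _
lemma cutoff_le_one (ε x : ℝ) : cutoff ε x ≤ 1 := max_le zero_le_one (min_le_left _ _)

lemma cutoff_eq_one {ε x : ℝ} (hε : 0 < ε) (hx : ε ≤ x) : cutoff ε x = 1 := by
  have : 1 ≤ (2 * x - ε) / ε := by rw [le_div_iff₀ hε]; linarith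
  simp [cutoff, this]

lemma cutoff_eq_zero {ε x : ℝ} (hε : 0 < ε) (hx : x ≤ ε / 2) : cutoff ε x = 0 := by
  have : (2 * x - ε) / ε ≤ 0 := div_nonpos_of_nonpos_of_nonneg (by linarith) hε.le
  simp [cutoff, this]

lemma cutoff_antitone {ε δ x : ℝ} (hδ : 0 < δ) (h : δ ≤ ε) (hx : 0 ≤ x) :
    cutoff ε x ≤ cutoff δ x := by
  have hε := hδ.trans_le h
  refine max_le_max le_rfl (min_le_min le_rfl ?_)
  rw [sub_div, sub_div, div_self hε.ne', div_self hδ.ne']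
  gcongr

lemma chi_nonneg (n : ℕ) {x : ℝ} (hx : 0 ≤ x) : 0 ≤ chi n x := div_nonneg hx (chi_den_pos n x).le

lemma chi_le_one (n : ℕ) (x : ℝ) : chi n x ≤ 1 :=
  (div_le_one (chi_den_pos n x)).2 (le_max_left _ _)

lemma sqrt_mul_psi (n : ℕ) {x : ℝ} (hx : 0 ≤ x) : √x * psi n x = chi n x := by
  rw [psi, chi, ← mul_div_assoc, Real.mul_self_sqrt hx]

lemma mul_one_sub_chi_le (n : ℕ) {x : ℝ} (hx : 0 ≤ x) : x * (1 - chi n x) ≤ 1 / ((n : ℝ) + 1) := by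
  rcases le_total x (1 / ((n : ℝ) + 1)) with h | h
  · calc x * (1 - chi n x) ≤ x * 1 := by gcongr; linarith [chi_nonneg n hx]
      _ ≤ _ := by linarith
  · have h0 : 0 < x := lt_of_lt_of_le (by positivity) h
    rw [chi, max_eq_left h, div_self h0.ne']
    simp; positivity

variable {B : Type u} [NonUnitalCStarAlgebra B]

lemma cfcₙ_conj (f : ℝ → ℝ) (hf : Continuous f) (hf0 : f 0 = 0) (c : B) (hc : IsSelfAdjoint c) :
    cfcₙ f c * c * cfcₙ f c = cfcₙ (fun x => f x * x * f x) c := by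
  rw [cfcₙ_mul (fun x => f x * x) f c (by fun_prop) (by simp) (by fun_prop) hf0,
    cfcₙ_mul f (fun x => x) c (by fun_prop) hf0 (by fun_prop) rfl, cfcₙ_id' ℝ c]

/-- `v` lies in the closed right ideal generated by `c`. -/
def InRightIdeal (c v : B) : Prop := Tendsto (fun n => cfcₙ (chi n) c * v) atTop (𝓝 v)

lemma InRightIdeal.mul {c v : B} (h : InRightIdeal c v) (w : B) : InRightIdeal c (v * w) := by
  have := Tendsto.mul_const w h
  simpa only [InRightIdeal, mul_assoc] using this

lemma InRightIdeal.add {c v w : B} (h : InRightIdeal c v) (h' : InRightIdeal c w) :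
    InRightIdeal c (v + w) := by
  have := Tendsto.add h h'
  simpa only [InRightIdeal, mul_add] using this

lemma InRightIdeal.smul {c v : B} (h : InRightIdeal c v) (r : ℂ) : InRightIdeal c (r • v) := by
  have := Tendsto.const_smul h r
  simpa only [InRightIdeal, mul_smul_comm] using this

lemma cuntzLE_iff {a b : B} : CuntzLE a b ↔ ∀ ε > 0, ∃ x, ‖a - star x * b * x‖ < ε := by
  constructor
  · rintro ⟨x, hx⟩ ε hε
    obtain ⟨n, hn⟩ := (hx.eventually (gt_mem_nhds hε)).exists
    exact ⟨x n, hn⟩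
  · intro h
    choose x hx using fun n : ℕ => h (1 / ((n : ℝ) + 1)) (by positivity)
    exact ⟨x, squeeze_zero (fun _ => norm_nonneg _) (fun n => (hx n).le)
      tendsto_one_div_add_atTop_nhds_zero_nat⟩

lemma CuntzLE.conj (b x : B) : CuntzLE (star x * b * x) b := ⟨fun _ => x, by simp⟩

lemma CuntzLE.smul_left {a b : B} (h : CuntzLE a b) {r : ℝ} (hr : 0 ≤ r) : CuntzLE (r • a) b := by
  obtain ⟨x, hx⟩ := h
  refine ⟨fun n => √r • x n, ?_⟩
  have := hx.const_mul r
  rw [mul_zero] at this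
  refine this.congr fun n => ?_
  have h2 : star (√r • x n) * b * (√r • x n) = r • (star (x n) * b * x n) := by
    rw [star_smul, smul_mul_assoc, smul_mul_assoc, mul_smul_comm, smul_smul]
    simp [Real.mul_self_sqrt hr]
  rw [h2, ← smul_sub, norm_smul, Real.norm_of_nonneg hr]

variable [PartialOrder B] [StarOrderedRing B]

lemma norm_cfcₙ_chi_le (n : ℕ) {c : B} (hc : 0 ≤ c) : ‖cfcₙ (chi n) c‖ ≤ 1 := by
  refine norm_cfcₙ_le fun x hx => ?_
  have := quasispectrum_nonneg_of_nonneg c hc x hx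
  rw [Real.norm_eq_abs, abs_of_nonneg (chi_nonneg n this)]
  exact chi_le_one n x

lemma exists_star_mul_self {a : B} (ha : 0 ≤ a) : ∃ s : B, IsSelfAdjoint s ∧ 0 ≤ s ∧ s * s = a :=
  ⟨CFC.sqrt a, (CFC.sqrt_nonneg a).isSelfAdjoint, CFC.sqrt_nonneg a, CFC.sqrt_mul_sqrt_self a⟩

/-- This is conjugation of `x ≤ y` by `1 - k`, expanded because `B` need not have a unit. -/
lemma conj_one_sub_mono (k : B) {x y : B} (h : x ≤ y) :
    x - star k * x - x * k + star k * x * k ≤ y - star k * y - y * k + star k * y * k := by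
  obtain ⟨s, hs, -, hs2⟩ := exists_star_mul_self (sub_nonneg.2 h)
  have key : y - star k * y - y * k + star k * y * k
      - (x - star k * x - x * k + star k * x * k) = star (s - s * k) * (s - s * k) := by
    have : y = x + s * s := by rw [hs2]; abel
    rw [this, star_sub, star_mul, hs.star_eq]
    noncomm_ring
  rw [← sub_nonneg, key]
  exact star_mul_self_nonneg _

/-- Conjugating the hypothesis by `1 - χ_n(c)` bounds `‖(1 - χ_n(c)) v‖²` by the norm of `c (1 -
χ_n(c))²`, which is at most `1/(n+1)`. -/
lemma inRightIdeal_of_sq_le {c v : B} (h : v * star v ≤ c) : InRightIdeal c v := by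
  have hc : 0 ≤ c := (mul_star_self_nonneg v).trans h
  rw [InRightIdeal, tendsto_iff_norm_sub_tendsto_zero]
  have hb (n : ℕ) : ‖cfcₙ (chi n) c * v - v‖ ≤ √(1 / ((n : ℝ) + 1)) := by
    set k := cfcₙ (chi n) c with hk
    have hks : star k = k := (cfcₙ_predicate (chi n) c : IsSelfAdjoint _)
    have h1 := conj_one_sub_mono k h
    have e1 : v * star v - star k * (v * star v) - v * star v * k + star k * (v * star v) * k
        = (k * v - v) * star (k * v - v) := by
      rw [star_sub, star_mul, hks]; noncomm_ring
    have e2 : c - star k * c - c * k + star k * c * k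
        = cfcₙ (fun x => x * (1 - chi n x) * (1 - chi n x)) c := by
      have : (fun x : ℝ => x * (1 - chi n x) * (1 - chi n x))
          = fun x => x - chi n x * x - x * chi n x + chi n x * x * chi n x := by ext x; ring
      rw [this, cfcₙ_add .., cfcₙ_sub .., cfcₙ_sub .., cfcₙ_mul .., cfcₙ_mul .., cfcₙ_mul ..,
        cfcₙ_mul .., cfcₙ_id' ℝ c, hks]
    rw [e1, e2] at h1
    have h2 := CStarAlgebra.norm_le_norm_of_nonneg_of_le (mul_star_self_nonneg (k * v - v)) h1
    rw [CStarRing.norm_self_mul_star] at h2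
    refine Real.le_sqrt_of_sq_le ?_
    rw [sq]
    refine h2.trans (norm_cfcₙ_le fun x hx => ?_)
    have hx0 := quasispectrum_nonneg_of_nonneg c hc x hx
    have h3 := chi_nonneg n hx0
    have h4 := chi_le_one n x
    have h5 : 0 ≤ 1 - chi n x := by linarith
    rw [Real.norm_eq_abs, abs_of_nonneg (by positivity)]
    calc x * (1 - chi n x) * (1 - chi n x) ≤ x * (1 - chi n x) * 1 := by gcongr; linarith
      _ ≤ _ := by rw [mul_one]; exact mul_one_sub_chi_le n hx0
  refine squeeze_zero (fun _ => norm_nonneg _) hb ?_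
  have := (Real.continuous_sqrt.tendsto 0).comp (tendsto_one_div_add_atTop_nhds_zero_nat (𝕜 := ℝ))
  rwa [Real.sqrt_zero] at this

lemma isClosed_inRightIdeal {c : B} (hc : 0 ≤ c) : IsClosed {v | InRightIdeal c v} := by
  refine isClosed_of_closure_subset fun v hv => ?_
  rw [mem_ofPred_eq, InRightIdeal, Metric.tendsto_atTop]
  intro ε hε
  obtain ⟨w, hw, hvw⟩ := Metric.mem_closure_iff.1 hv (ε / 3) (by positivity)
  obtain ⟨N, hN⟩ := Metric.tendsto_atTop.1 hw (ε / 3) (by positivity)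
  refine ⟨N, fun n hn => ?_⟩
  have h1 := hN n hn
  rw [dist_eq_norm] at *
  have : cfcₙ (chi n) c * v - v = cfcₙ (chi n) c * (v - w) + (cfcₙ (chi n) c * w - w) - (v - w) := by
    noncomm_ring
  rw [this]
  have h2 : ‖cfcₙ (chi n) c * (v - w)‖ ≤ ‖v - w‖ :=
    (norm_mul_le _ _).trans (mul_le_of_le_one_left (norm_nonneg _) (norm_cfcₙ_chi_le n hc))
  have h3 := norm_sub_le (cfcₙ (chi n) c * (v - w) + (cfcₙ (chi n) c * w - w)) (v - w)
  have h4 := norm_add_le (cfcₙ (chi n) c * (v - w)) (cfcₙ (chi n) c * w - w)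
  linarith

/-- Formally `z_i = y_i c^{-1/2} v`, so that `∑ z_i* z_i = v c^{-1/2} c c^{-1/2} v = v²`. The
functions `ψ_m` regularize the inverse square root, and the limit exists because `v` lies in the
closed right ideal of `c`. -/
lemma exists_sum_star_mul_self {n : ℕ} (y : Fin n → B) {c v : B} (hc : ∑ i, star (y i) * y i = c)
    (hv : IsSelfAdjoint v) (hR : InRightIdeal c v) :
    ∃ z : Fin n → B, (∀ i, z i ∈ closure (range (y i * ·))) ∧ ∑ i, star (z i) * z i = v * v := by
  have hc0 : 0 ≤ c := hc ▸ Finset.sum_nonneg fun i _ => star_mul_self_nonneg _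
  have hpsi (f : ℝ → ℝ) : star (cfcₙ f c) = cfcₙ f c := (cfcₙ_predicate f c : IsSelfAdjoint _)
  have hconj (m : ℕ) : star (cfcₙ (psi m) c * v) * c * (cfcₙ (psi m) c * v)
      = star (cfcₙ (chi m) c * v) * (cfcₙ (chi m) c * v) := by
    have : cfcₙ (psi m) c * c * cfcₙ (psi m) c = cfcₙ (chi m) c * cfcₙ (chi m) c := by
      rw [cfcₙ_conj (psi m) (by fun_prop) (psi_zero m) c hc0.isSelfAdjoint,
        ← cfcₙ_mul (chi m) (chi m) c (by fun_prop) (chi_zero m) (by fun_prop) (chi_zero m)]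
      refine cfcₙ_congr fun x hx => ?_
      have hx0 := quasispectrum_nonneg_of_nonneg c hc0 x hx
      simp only [← sqrt_mul_psi m hx0]
      nth_rw 2 [← Real.mul_self_sqrt hx0]
      ring
    rw [star_mul, star_mul, hpsi, hpsi, hv.star_eq]
    calc _ = v * (cfcₙ (psi m) c * c * cfcₙ (psi m) c) * v := by simp only [mul_assoc]
      _ = _ := by rw [this]; simp only [mul_assoc]
  have hconj2 (m k : ℕ) : star (cfcₙ (psi m) c * v - cfcₙ (psi k) c * v) * c *
      (cfcₙ (psi m) c * v - cfcₙ (psi k) c * v)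
      = star (cfcₙ (chi m) c * v - cfcₙ (chi k) c * v) *
        (cfcₙ (chi m) c * v - cfcₙ (chi k) c * v) := by
    have : (cfcₙ (psi m) c - cfcₙ (psi k) c) * c * (cfcₙ (psi m) c - cfcₙ (psi k) c)
        = (cfcₙ (chi m) c - cfcₙ (chi k) c) * (cfcₙ (chi m) c - cfcₙ (chi k) c) := by
      rw [← cfcₙ_sub (psi m) (psi k) c (by fun_prop) (psi_zero m) (by fun_prop) (psi_zero k),
        ← cfcₙ_sub (chi m) (chi k) c (by fun_prop) (chi_zero m) (by fun_prop) (chi_zero k),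
        cfcₙ_conj (fun x => psi m x - psi k x) (by fun_prop) (by simp) c hc0.isSelfAdjoint,
        ← cfcₙ_mul (fun x => chi m x - chi k x) (fun x => chi m x - chi k x) c (by fun_prop)
          (by simp) (by fun_prop) (by simp)]
      refine cfcₙ_congr fun x hx => ?_
      have hx0 := quasispectrum_nonneg_of_nonneg c hc0 x hx
      simp only [← sqrt_mul_psi m hx0, ← sqrt_mul_psi k hx0]
      nth_rw 3 [← Real.mul_self_sqrt hx0]
      ring
    rw [← sub_mul, ← sub_mul, star_mul, star_mul, star_sub, star_sub, hpsi, hpsi, hpsi, hpsi,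
      hv.star_eq]
    calc _ = v * ((cfcₙ (psi m) c - cfcₙ (psi k) c) * c * (cfcₙ (psi m) c - cfcₙ (psi k) c)) * v := by
          simp only [mul_assoc]
      _ = _ := by rw [this]; simp only [mul_assoc]
  have hle (i : Fin n) (w : B) : star (y i * w) * (y i * w) ≤ star w * c * w := by
    have : star (y i) * y i ≤ c := hc ▸ Finset.single_le_sum
      (f := fun i => star (y i) * y i) (fun j _ => star_mul_self_nonneg _) (Finset.mem_univ i)
    have := star_left_conjugate_le_conjugate this w
    rw [star_mul]
    simpa only [mul_assoc] using this
  -- Since `y_i* y_i ≤ c`, differences are controlled by those of `χ_m(c) v`, which converges by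
  -- hypothesis.
  have hcau (i : Fin n) : CauchySeq fun m => y i * (cfcₙ (psi m) c * v) := by
    have h := hR.cauchySeq
    rw [Metric.cauchySeq_iff] at h ⊢
    intro ε hε
    obtain ⟨N, hN⟩ := h ε hε
    refine ⟨N, fun m hm k hk => lt_of_le_of_lt ?_ (hN m hm k hk)⟩
    rw [dist_eq_norm, dist_eq_norm, ← mul_sub]
    refine le_of_sq_le_sq ?_ (norm_nonneg _)
    rw [sq, sq, ← CStarRing.norm_star_mul_self, ← CStarRing.norm_star_mul_self, ← hconj2]
    exact CStarAlgebra.norm_le_norm_of_nonneg_of_le (star_mul_self_nonneg _) (hle i _)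
  choose z hz using fun i => cauchySeq_tendsto_of_complete (hcau i)
  refine ⟨z, fun i => mem_closure_of_tendsto (hz i) (.of_forall fun m => mem_range_self _), ?_⟩
  have h1 : Tendsto (fun m => ∑ i, star (y i * (cfcₙ (psi m) c * v)) * (y i * (cfcₙ (psi m) c * v)))
      atTop (𝓝 (∑ i, star (z i) * z i)) :=
    tendsto_finsetSum _ fun i _ => (hz i).star.mul (hz i)
  have h2 : Tendsto (fun m => star (cfcₙ (chi m) c * v) * (cfcₙ (chi m) c * v))
      atTop (𝓝 (star v * v)) := Tendsto.mul (Tendsto.star hR) hR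
  rw [hv.star_eq] at h2
  refine tendsto_nhds_unique h1 (h2.congr fun m => ?_)
  rw [← hconj]
  generalize cfcₙ (psi m) c * v = w
  rw [← hc, Finset.mul_sum, Finset.sum_mul]
  refine Finset.sum_congr rfl fun i _ => ?_
  simp only [star_mul, mul_assoc]

/-- The case of one `y`. Having `z` in the closure of `yB` matters as much as the factorization: a
left unit for `y` is then one for `z`. -/
lemma exists_star_mul_self_eq_of_le {u y : B} (hu : 0 ≤ u) (h : u ≤ star y * y) :
    ∃ z ∈ closure (range (y * ·)), star z * z = u := by
  obtain ⟨v, hv, -, hv2⟩ := exists_star_mul_self hu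
  obtain ⟨z, hz, hz2⟩ := exists_sum_star_mul_self (fun _ : Fin 1 => y) (c := star y * y) (by simp) hv
    (inRightIdeal_of_sq_le (by rwa [hv.star_eq, hv2]))
  exact ⟨z 0, hz 0, by simpa [hv2] using hz2⟩

/-! Cuntz subequivalence -/

/-- Factor `a = z*z` with `z` a limit of elements `b^{1/2} w`; then `w* b w` tends to `a`. -/
lemma CuntzLE.of_le {a b : B} (ha : 0 ≤ a) (h : a ≤ b) : CuntzLE a b := by
  obtain ⟨s, hs, -, hs2⟩ := exists_star_mul_self (ha.trans h)
  obtain ⟨z, hz, rfl⟩ := exists_star_mul_self_eq_of_le (y := s) ha (by rwa [hs.star_eq, hs2])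
  obtain ⟨x, hx, hlim⟩ := mem_closure_iff_seq_limit.1 hz
  choose w hw using hx
  refine ⟨w, ?_⟩
  have h1 : Tendsto (fun n => star (x n) * x n) atTop (𝓝 (star z * z)) := hlim.star.mul hlim
  have h2 := (tendsto_const_nhds (x := star z * z)).sub h1
  rw [sub_self] at h2
  refine (tendsto_norm_zero.comp h2).congr fun n => ?_
  simp only [Function.comp, ← hw n, ← hs2, star_mul, hs.star_eq, mul_assoc]

lemma CuntzLE.of_le_smul {a b : B} (ha : 0 ≤ a) {r : ℝ} (hr : 0 < r) (h : a ≤ r • b) :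
    CuntzLE a b := by
  have h1 : r⁻¹ • a ≤ b := by
    have := smul_le_smul_of_nonneg_left h (inv_nonneg.2 hr.le)
    rwa [smul_smul, inv_mul_cancel₀ hr.ne', one_smul] at this
  have := (CuntzLE.of_le (smul_nonneg (inv_nonneg.2 hr.le) ha) h1).smul_left hr.le
  rwa [smul_smul, mul_inv_cancel₀ hr.ne', one_smul] at this

/-- With `c = z*z`, conjugating `zz*` by `z ψ_n(c)` gives `c χ_n(c)²`, which is within `2/(n+1)` of
`c`. -/
lemma CuntzLE.star_mul_self (z : B) : CuntzLE (star z * z) (z * star z) := by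
  have hc : 0 ≤ star z * z := star_mul_self_nonneg z
  refine ⟨fun n => z * cfcₙ (psi n) (star z * z), ?_⟩
  refine squeeze_zero (fun _ => norm_nonneg _) (fun n => ?_)
    (tendsto_const_nhds.mul tendsto_one_div_add_atTop_nhds_zero_nat |>.trans
      (by rw [mul_zero]) : Tendsto (fun n : ℕ => (2:ℝ) * (1 / ((n : ℝ) + 1))) atTop (𝓝 0))
  set c := star z * z with hcdef
  have hs : star (cfcₙ (psi n) c) = cfcₙ (psi n) c := (cfcₙ_predicate (psi n) c : IsSelfAdjoint _)
  have e : c - star (z * cfcₙ (psi n) c) * (z * star z) * (z * cfcₙ (psi n) c)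
      = cfcₙ (fun x => x - psi n x * x * x * psi n x) c := by
    rw [cfcₙ_sub .., cfcₙ_mul .., cfcₙ_mul .., cfcₙ_mul .., cfcₙ_id' ℝ c, star_mul, hs]
    congr 1
    rw [hcdef]; noncomm_ring
  rw [e]
  refine norm_cfcₙ_le fun x hx => ?_
  have hx0 := quasispectrum_nonneg_of_nonneg c hc x hx
  have h1 : psi n x * x * x * psi n x = x * (chi n x * chi n x) := by
    rw [← sqrt_mul_psi n hx0]
    nth_rw 2 [← Real.mul_self_sqrt hx0]
    ring
  have h2 := mul_one_sub_chi_le n hx0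
  have h3 := chi_nonneg n hx0
  have h4 := chi_le_one n x
  have h5 : x - x * (chi n x * chi n x) = x * (1 - chi n x) * (1 + chi n x) := by ring
  have h6 : 0 ≤ 1 - chi n x := by linarith
  rw [h1, h5, Real.norm_of_nonneg (by positivity)]
  calc x * (1 - chi n x) * (1 + chi n x) ≤ (1 / ((n : ℝ) + 1)) * 2 := by
        gcongr; linarith
    _ = _ := by ring

lemma CuntzLE.cfcₙ {a : B} {f g : ℝ → ℝ} (hf : Continuous f) (hg : Continuous g)
    (hf0 : f 0 = 0) (hg0 : g 0 = 0) {r : ℝ} (hr : 0 < r)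
    (h0 : ∀ x ∈ quasispectrum ℝ a, 0 ≤ f x) (h : ∀ x ∈ quasispectrum ℝ a, f x ≤ r * g x) :
    CuntzLE (_root_.cfcₙ f a) (_root_.cfcₙ g a) := by
  refine CuntzLE.of_le_smul (cfcₙ_nonneg h0) hr ?_
  rw [← cfcₙ_smul r g a hg.continuousOn]
  exact cfcₙ_mono h (by fun_prop) (by fun_prop) hf0 (by simp [hg0])

end Toolbox

/-! ### Ranks of positive elements with respect to a quasitrace -/

section Pedersen

variable {B : Type u} [NonUnitalCStarAlgebra B]

/-- A dense ideal contains some `j` with `‖e - j‖ < 1`. Then `(1 - (e - j)) g = j g` with an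
invertible factor in the unitization, so `g` is in the ideal once the scalar part of the inverse is
treated separately. Elements with a local unit are therefore in the domain of every quasitrace. -/
lemma mem_pedersenIdeal_of_mul_eq {e g : B} (h : e * g = g) : g ∈ pedersenIdeal B := by
  refine (TwoSidedIdeal.mem_sInf _).2 fun J hJ => ?_
  obtain ⟨j, hj, hej⟩ := Metric.mem_closure_iff.1 (hJ e) 1 one_pos
  rw [dist_eq_norm] at hej
  have hu : ‖((e - j : B) : Unitization ℂ B)‖ < 1 := by rwa [Unitization.norm_inr]
  set w : (Unitization ℂ B)ˣ := Units.oneSub _ hu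
  have h1 : (w : Unitization ℂ B) * (g : Unitization ℂ B) = ((j * g : B) : Unitization ℂ B) := by
    rw [Units.val_oneSub, sub_mul, one_mul, ← Unitization.inr_mul, sub_mul, h]
    rw [← Unitization.inr_sub, sub_sub_cancel]
  have h2 : (g : Unitization ℂ B) = ((w⁻¹ : (Unitization ℂ B)ˣ) : Unitization ℂ B) * ((j * g : B) : Unitization ℂ B) := by
    rw [← h1, ← mul_assoc, Units.inv_mul, one_mul]
  set t := ((w⁻¹ : (Unitization ℂ B)ˣ) : Unitization ℂ B)
  have h3 : g = j * (t.fst • g) + t.snd * (j * g) := by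
    have := congrArg (fun x : Unitization ℂ B => x.snd) h2
    simpa [Unitization.snd_mul, mul_smul_comm] using this
  rw [h3]
  exact J.add_mem (J.mul_mem_right _ _ hj) (J.mul_mem_left _ _ (J.mul_mem_right _ _ hj))

/-- The C⋆-subalgebra generated by a set. -/
def genAlg (S : Set B) : NonUnitalStarSubalgebra ℂ B :=
  (NonUnitalStarAlgebra.adjoin ℂ S).topologicalClosure

lemma isClosed_genAlg (S : Set B) : IsClosed (genAlg S : Set B) :=
  NonUnitalStarSubalgebra.isClosed_topologicalClosure _

lemma subset_genAlg {S : Set B} {x : B} (hx : x ∈ S) : x ∈ genAlg S :=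
  NonUnitalStarSubalgebra.le_topologicalClosure _ (NonUnitalStarAlgebra.subset_adjoin ℂ S hx)

lemma genAlg_commute {S : Set B} (hS : ∀ x ∈ S, IsSelfAdjoint x) (hc : ∀ x ∈ S, ∀ y ∈ S, x * y = y * x)
    {x y : B} (hx : x ∈ genAlg S) (hy : y ∈ genAlg S) : x * y = y * x := by
  have h1 : genAlg S ≤ NonUnitalStarSubalgebra.centralizer ℂ S := by
    refine NonUnitalStarSubalgebra.topologicalClosure_minimal _ (NonUnitalStarAlgebra.adjoin_le ?_) ?_
    · intro y hy
      refine (NonUnitalStarSubalgebra.mem_centralizer_iff ℂ).2 fun g hg => ?_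
      rw [(hS g hg).star_eq]
      exact ⟨hc g hg y hy, hc g hg y hy⟩
    · rw [NonUnitalStarSubalgebra.coe_centralizer]
      exact Set.isClosed_centralizer _
  have h2 : genAlg S ≤ NonUnitalStarSubalgebra.centralizer ℂ
      (NonUnitalStarSubalgebra.centralizer ℂ S : Set B) :=
    NonUnitalStarSubalgebra.topologicalClosure_adjoin_le_centralizer_centralizer ℂ S
  exact ((NonUnitalStarSubalgebra.mem_centralizer_iff ℂ).1 (h2 hx) y (h1 hy)).1.symm

/-- Suited to closed right ideals: only multiplication on the right is required to preserve `P`. No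
stability under adjoints is needed, because `P x ∧ P (star x)` is carried through the induction. -/
lemma genAlg_induction {S : Set B} (hS : ∀ x ∈ S, IsSelfAdjoint x) {P : B → Prop}
    (hcl : IsClosed {x | P x}) (h0 : P 0) (hadd : ∀ x y, P x → P y → P (x + y))
    (hsmul : ∀ (r : ℂ) x, P x → P (r • x)) (hmul : ∀ x y, P x → P (x * y)) (hmem : ∀ x ∈ S, P x)
    {x : B} (hx : x ∈ genAlg S) : P x := by
  have hx' : x ∈ closure ((NonUnitalStarAlgebra.adjoin ℂ S : NonUnitalStarSubalgebra ℂ B) : Set B) :=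
    hx
  refine hcl.closure_subset_iff.2 (fun x hx => ?_) hx'
  suffices P x ∧ P (star x) from this.1
  have hx' : x ∈ NonUnitalStarAlgebra.adjoin ℂ S := hx
  clear hx
  induction hx' using NonUnitalStarAlgebra.adjoin_induction with
  | mem x hx => rw [(hS x hx).star_eq]; exact ⟨hmem x hx, hmem x hx⟩
  | zero => rw [star_zero]; exact ⟨h0, h0⟩
  | add x y hx hy h1 h2 => rw [star_add]; exact ⟨hadd _ _ h1.1 h2.1, hadd _ _ h1.2 h2.2⟩
  | mul x y hx hy h1 h2 => rw [star_mul]; exact ⟨hmul _ _ h1.1, hmul _ _ h2.2⟩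
  | smul r x hx h1 => rw [star_smul]; exact ⟨hsmul _ _ h1.1, hsmul _ _ h1.2⟩
  | star x hx h1 => rw [star_star]; exact h1.symm

lemma mul_eq_of_mem_genAlg {S : Set B} (hS : ∀ x ∈ S, IsSelfAdjoint x) {e : B}
    (he : ∀ x ∈ S, e * x = x) {g : B} (hg : g ∈ genAlg S) : e * g = g := by
  refine genAlg_induction hS (P := fun g => e * g = g)
    (isClosed_eq (continuous_const.mul continuous_id) continuous_id) (mul_zero e) ?_ ?_ ?_ he hg
  · intro x y h1 h2; rw [mul_add, h1, h2]
  · intro r x h; rw [mul_smul_comm, h]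
  · intro x y h; rw [← mul_assoc, h]

lemma cfcₙ_mem_genAlg (f : ℝ → ℝ) (a : B) : cfcₙ f a ∈ genAlg {a} := by
  by_cases ha : IsSelfAdjoint a
  · rw [cfcₙ_real_eq_complex f ha]
    exact _root_.cfcₙ_mem_elemental _ a
  · rw [cfcₙ_apply_of_not_predicate a ha]; exact zero_mem _

lemma genAlg_le {S T : Set B} (h : S ⊆ genAlg T) : genAlg S ≤ genAlg T :=
  NonUnitalStarSubalgebra.topologicalClosure_minimal _ (NonUnitalStarAlgebra.adjoin_le h)
    (isClosed_genAlg T)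

lemma InRightIdeal.of_mem_genAlg [PartialOrder B] [StarOrderedRing B] {c h k : B} (hc : 0 ≤ c)
    (hs : IsSelfAdjoint h) (hh : InRightIdeal c h) (hk : k ∈ genAlg {h}) : InRightIdeal c k := by
  refine genAlg_induction (S := {h}) (by simpa) (P := InRightIdeal c) (isClosed_inRightIdeal hc)
    (by simp [InRightIdeal]) (fun _ _ => .add) (fun r x h => h.smul r) (fun x y h => h.mul y)
    (by simpa) hk

namespace IsQuasitrace

variable {τ : B → ℂ} (hτ : IsQuasitrace τ)

include hτ

lemma add_of_mem {S : Set B} (hS : ∀ x ∈ S, IsSelfAdjoint x) (hc : ∀ x ∈ S, ∀ y ∈ S, x * y = y * x)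
    (hP : ∀ g ∈ genAlg S, g ∈ pedersenIdeal B) {x y : B} (hx : x ∈ genAlg S) (hy : y ∈ genAlg S) :
    τ (x + y) = τ x + τ y :=
  (hτ.linear_on_abelian (genAlg S) (isClosed_genAlg S)
    (fun _ hx _ hy => genAlg_commute hS hc hx hy) hP).1 x hx y hy

lemma smul_of_mem {S : Set B} (hS : ∀ x ∈ S, IsSelfAdjoint x) (hc : ∀ x ∈ S, ∀ y ∈ S, x * y = y * x)
    (hP : ∀ g ∈ genAlg S, g ∈ pedersenIdeal B) {x : B} (hx : x ∈ genAlg S) (r : ℂ) :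
    τ (r • x) = r * τ x :=
  (hτ.linear_on_abelian (genAlg S) (isClosed_genAlg S)
    (fun _ hx _ hy => genAlg_commute hS hc hx hy) hP).2 r x hx

lemma map_zero : τ 0 = 0 := by
  have := hτ.smul_of_mem (S := ∅) (by simp) (by simp) ?_ (zero_mem _) 0
  · simpa using this
  · intro g hg
    refine mem_pedersenIdeal_of_mul_eq (e := 0) (mul_eq_of_mem_genAlg (S := ∅) (by simp) (by simp) hg)

variable [PartialOrder B] [StarOrderedRing B]

lemma re_nonneg {x : B} (hx : 0 ≤ x) : 0 ≤ (τ x).re := by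
  obtain ⟨s, hs, -, rfl⟩ := exists_star_mul_self hx
  have := (hτ.nonneg s).1
  rwa [hs.star_eq] at this

lemma im_eq_zero {x : B} (hx : 0 ≤ x) : (τ x).im = 0 := by
  obtain ⟨s, hs, -, rfl⟩ := exists_star_mul_self hx
  have := (hτ.nonneg s).2
  rwa [hs.star_eq] at this

/-- Additivity applies to `y = x + (y - x)` only inside a commutative subalgebra, which is why
monotonicity is stated there. -/
lemma mono_of_mem {S : Set B} (hS : ∀ x ∈ S, IsSelfAdjoint x) (hc : ∀ x ∈ S, ∀ y ∈ S, x * y = y * x)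
    (hP : ∀ g ∈ genAlg S, g ∈ pedersenIdeal B) {x y : B} (hx : x ∈ genAlg S) (hy : y ∈ genAlg S)
    (h : x ≤ y) : (τ x).re ≤ (τ y).re := by
  have h1 := hτ.add_of_mem hS hc hP hx (sub_mem hy hx)
  rw [add_sub_cancel] at h1
  have h2 := hτ.re_nonneg (sub_nonneg.2 h)
  rw [h1, Complex.add_re]
  linarith

/-- Monotonicity on functions of a positive element that vanish near zero. -/
lemma mono_cfcₙ {a : B} (ha : 0 ≤ a) {f g : ℝ → ℝ} (hf : Continuous f) (hg : Continuous g)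
    {δ : ℝ} (hδ : 0 < δ) (hf0 : ∀ x ≤ δ, f x = 0) (hg0 : ∀ x ≤ δ, g x = 0)
    (h : ∀ x, 0 ≤ x → f x ≤ g x) : (τ (cfcₙ f a)).re ≤ (τ (cfcₙ g a)).re := by
  have he (k : ℝ → ℝ) (hk : Continuous k) (hk0 : ∀ x ≤ δ, k x = 0) :
      cfcₙ (cutoff δ) a * cfcₙ k a = cfcₙ k a := by
    rw [← cfcₙ_mul (cutoff δ) k a (by fun_prop) (by simp) (by fun_prop) (hk0 0 hδ.le)]
    refine cfcₙ_congr fun x _ => ?_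
    rcases le_total x δ with h | h
    · simp [hk0 x h]
    · simp [cutoff_eq_one hδ h]
  have hS : ∀ x ∈ ({cfcₙ f a, cfcₙ g a} : Set B), IsSelfAdjoint x := by
    rintro x (rfl | rfl) <;> exact cfcₙ_predicate _ a
  refine hτ.mono_of_mem (S := {cfcₙ f a, cfcₙ g a}) hS ?_ ?_ (subset_genAlg (by simp))
    (subset_genAlg (by simp)) ?_
  · rintro x (rfl | rfl) y (rfl | rfl) <;> exact cfcₙ_commute_cfcₙ _ _ a
  · intro x hx
    refine mem_pedersenIdeal_of_mul_eq (e := cfcₙ (cutoff δ) a) (mul_eq_of_mem_genAlg hS ?_ hx)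
    rintro x (rfl | rfl)
    exacts [he f hf hf0, he g hg hg0]
  · exact cfcₙ_mono (fun x hx => h x (quasispectrum_nonneg_of_nonneg a ha x hx)) (by fun_prop)
      (by fun_prop) (hf0 0 hδ.le) (hg0 0 hδ.le)

end IsQuasitrace

end Pedersen

section Rank

variable {B : Type u} [NonUnitalCStarAlgebra B]

/-- The rank of a positive element with respect to a quasitrace: `sup_ε τ(f_ε(a))`. -/
def rk (τ : B → ℂ) (a : B) : ℝ≥0∞ :=
  ⨆ (ε : ℝ) (_ : 0 < ε), ENNReal.ofReal (τ (cfcₙ (cutoff ε) a)).re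

lemma norm_sub_ramp_le [PartialOrder B] [StarOrderedRing B] {b : B} (hb : 0 ≤ b) {δ : ℝ}
    (hδ : 0 ≤ δ) : ‖b - cfcₙ (ramp δ) b‖ ≤ δ := by
  have : b - cfcₙ (ramp δ) b = cfcₙ (fun x => x - ramp δ x) b := by
    rw [cfcₙ_sub (fun x => x) (ramp δ) b (by fun_prop) rfl (by fun_prop) (ramp_zero hδ),
      cfcₙ_id' ℝ b]
  rw [this]
  refine norm_cfcₙ_le fun x hx => ?_
  have hx0 := quasispectrum_nonneg_of_nonneg b hb x hx
  rw [ramp, Real.norm_eq_abs, abs_le]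
  rcases le_total (x - δ) 0 with h | h <;> simp only [h, max_eq_left, max_eq_right] <;>
    constructor <;> linarith

variable {τ : B → ℂ}

lemma le_rk (a : B) {ε : ℝ} (hε : 0 < ε) : ENNReal.ofReal (τ (cfcₙ (cutoff ε) a)).re ≤ rk τ a :=
  le_iSup₂ (f := fun (ε : ℝ) (_ : 0 < ε) => ENNReal.ofReal (τ (cfcₙ (cutoff ε) a)).re) ε hε

variable [PartialOrder B] [StarOrderedRing B] (hτ : IsQuasitrace τ)

include hτ

lemma re_cutoff_antitone {a : B} (ha : 0 ≤ a) {ε δ : ℝ} (hδ : 0 < δ) (h : δ ≤ ε) :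
    (τ (cfcₙ (cutoff ε) a)).re ≤ (τ (cfcₙ (cutoff δ) a)).re := by
  refine hτ.mono_cfcₙ ha (by fun_prop) (by fun_prop) (δ := δ / 2) (by positivity) ?_ ?_ ?_
  · exact fun x hx => cutoff_eq_zero (hδ.trans_le h) (by linarith)
  · exact fun x hx => cutoff_eq_zero hδ hx
  · exact fun x hx => cutoff_antitone hδ h hx

lemma tendsto_rk {a : B} (ha : 0 ≤ a) :
    Tendsto (fun ε => ENNReal.ofReal (τ (cfcₙ (cutoff ε) a)).re) (𝓝[>] (0 : ℝ)) (𝓝 (rk τ a)) := by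
  refine tendsto_order.2 ⟨fun r hr => ?_, fun r hr => ?_⟩
  · obtain ⟨ε, hε, h⟩ := by simpa only [rk, lt_iSup_iff] using hr
    filter_upwards [Ioc_mem_nhdsGT hε] with δ hδ
    exact h.trans_le (ENNReal.ofReal_le_ofReal (re_cutoff_antitone hτ ha hδ.1 hδ.2))
  · filter_upwards [self_mem_nhdsWithin] with δ hδ
    exact (le_rk a hδ).trans_lt hr

/-- The rank is monotone with respect to Cuntz subequivalence. -/
lemma rk_le_of_cuntzLE {a b : B} (ha : 0 ≤ a) (hb : 0 ≤ b) (h : CuntzLE a b) :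
    rk τ a ≤ rk τ b := by
  refine iSup₂_le fun η hη => ?_
  -- Two errors of `η/8`, from the approximation and from cutting `b` down, add up to `η/4`. This
  -- stays below `η/2`, where `f_η` starts to be nonzero.
  obtain ⟨x, hx⟩ := cuntzLE_iff.1 h (η / 8) (by positivity)
  obtain ⟨δ, hδ, hδx⟩ : ∃ δ > 0, ‖x‖ * ‖x‖ * δ < η / 8 := by
    refine ⟨η / 8 / (‖x‖ * ‖x‖ + 1), by positivity, ?_⟩
    rw [← mul_div_assoc, div_lt_iff₀ (by positivity)]
    nlinarith [norm_nonneg x]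
  -- cut `b` down
  set b' := cfcₙ (ramp δ) b with hb'
  have hb'0 : 0 ≤ b' := cfcₙ_nonneg fun x _ => ramp_nonneg δ x
  have hbb : ‖b - b'‖ ≤ δ := norm_sub_ramp_le hb hδ.le
  have hab : ‖a - star x * b' * x‖ ≤ η / 4 := by
    have : a - star x * b' * x = (a - star x * b * x) + star x * (b - b') * x := by noncomm_ring
    rw [this]
    refine (norm_add_le _ _).trans ?_
    have h1 : ‖star x * (b - b') * x‖ ≤ ‖x‖ * δ * ‖x‖ := by
      refine (norm_mul_le _ _).trans ?_
      gcongr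
      refine (norm_mul_le _ _).trans ?_
      rw [norm_star]
      gcongr
    nlinarith
  obtain ⟨s, hs, -, hs2⟩ := exists_star_mul_self hb'0
  -- cut `a` down
  set g : ℝ → ℝ := fun t => √(cutoff η t / max (t - η / 4) (η / 4)) with hg
  have hgc : Continuous g := by
    refine Real.continuous_sqrt.comp ((continuous_cutoff η).div (by fun_prop) fun t => ?_)
    exact (lt_max_of_lt_right (by positivity)).ne'
  have hg0 : g 0 = 0 := by simp [hg]
  have hgs : star (cfcₙ g a) = cfcₙ g a := (cfcₙ_predicate g a : IsSelfAdjoint _)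
  have hgg (t : ℝ) : g t * t * g t - (η / 4) * (g t * g t) = cutoff η t := by
    have : g t * g t = cutoff η t / max (t - η / 4) (η / 4) :=
      Real.mul_self_sqrt (div_nonneg (cutoff_nonneg _ _) (lt_max_of_lt_right (by positivity)).le)
    have e : g t * t * g t - (η / 4) * (g t * g t) = (t - η / 4) * (g t * g t) := by ring
    rw [e, this]
    rcases le_total t (η / 2) with h | h
    · simp [cutoff_eq_zero hη h]
    · rw [max_eq_left (by linarith)]
      exact mul_div_cancel₀ _ (by linarith)
  set u := cfcₙ (cutoff η) a with hu
  have hu0 : 0 ≤ u := cfcₙ_nonneg fun x _ => cutoff_nonneg η x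
  have hueq : u = cfcₙ g a * a * cfcₙ g a - (η / 4) • (cfcₙ g a * cfcₙ g a) := by
    rw [cfcₙ_conj g hgc hg0 a ha.isSelfAdjoint,
      ← cfcₙ_mul g g a hgc.continuousOn hg0 hgc.continuousOn hg0,
      ← cfcₙ_smul (η / 4) (fun t => g t * g t) a (by fun_prop) (by simp [hg0]),
      ← cfcₙ_sub (fun t => g t * t * g t) (fun t => (η / 4) • (g t * g t)) a (by fun_prop) (by simp)
        (by fun_prop) (by simp [hg0]), hu]
    exact cfcₙ_congr fun t _ => by simp [← hgg t]
  set y := s * (x * cfcₙ g a) with hy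
  have huy : u ≤ star y * y := by
    have h1 : cfcₙ g a * (a - star x * b' * x) * cfcₙ g a ≤ (η / 4) • (cfcₙ g a * cfcₙ g a) := by
      have hsa : IsSelfAdjoint (a - star x * b' * x) :=
        ha.isSelfAdjoint.sub (hb'0.isSelfAdjoint.conjugate' x)
      have := CStarAlgebra.star_left_conjugate_le_norm_smul (a := cfcₙ g a) hsa
      rw [hgs] at this
      refine this.trans (smul_le_smul_of_nonneg_right hab ?_)
      nth_rw 1 [← hgs]
      exact star_mul_self_nonneg _
    have h2 : star y * y = cfcₙ g a * (star x * b' * x) * cfcₙ g a := by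
      rw [hy, ← hs2]
      simp only [star_mul, hgs, hs.star_eq, mul_assoc]
    rw [h2, hueq, ← sub_nonneg]
    rw [← sub_nonneg] at h1
    convert h1 using 1
    noncomm_ring
  -- Traciality replaces `f_η(a) = z*z` by `zz*`, which has a local unit among the functions of `b`.
  obtain ⟨z, hz, hzu⟩ := exists_star_mul_self_eq_of_le hu0 huy
  -- a local unit for `z`
  set e := cfcₙ (fun t => √(cutoff δ t)) b with he
  have hes : star e = e := (cfcₙ_predicate _ b : IsSelfAdjoint _)
  have hee : e * e = cfcₙ (cutoff δ) b := by
    rw [he, ← cfcₙ_mul _ _ b (by fun_prop) (by simp) (by fun_prop) (by simp)]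
    exact cfcₙ_congr fun t _ => Real.mul_self_sqrt (cutoff_nonneg δ t)
  have heb : e * b' = b' := by
    rw [he, hb', ← cfcₙ_mul _ _ b (by fun_prop) (by simp) (by fun_prop) (ramp_zero hδ.le)]
    refine cfcₙ_congr fun t _ => ?_
    rcases le_total t δ with h | h
    · simp [ramp, h]
    · simp [cutoff_eq_one hδ h]
  have hesq : e * s = s := by
    have : (e * s - s) * star (e * s - s) = 0 := by
      rw [star_sub, star_mul, hes, hs.star_eq]
      have e1 : (e * s - s) * (s * e - s) = e * (s * s) * e - e * (s * s) - (s * s * e - s * s) := by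
        noncomm_ring
      have e2 : b' * e = b' := by
        have := congrArg star heb
        rwa [star_mul, hes, hb'0.isSelfAdjoint.star_eq] at this
      rw [e1, hs2, heb, e2]; simp only [sub_self]
    exact sub_eq_zero.1 (CStarRing.mul_star_self_eq_zero_iff _ |>.1 this)
  have hez : e * z = z := by
    have hcl : IsClosed {z : B | e * z = z} :=
      isClosed_eq (continuous_const.mul continuous_id) continuous_id
    refine hcl.closure_subset_iff.2 ?_ hz
    rintro _ ⟨w, rfl⟩
    simp only [mem_ofPred_eq, hy, ← mul_assoc, hesq]
  set w := z * star z with hw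
  have hw0 : 0 ≤ w := mul_star_self_nonneg z
  have hew : e * w = w := by rw [hw, ← mul_assoc, hez]
  have hwe : w * e = w := by
    have := congrArg star hew
    rwa [star_mul, hes, hw0.isSelfAdjoint.star_eq] at this
  have hwle : w ≤ e * e := by
    have h1 := CStarAlgebra.star_left_conjugate_le_norm_smul (a := e) hw0.isSelfAdjoint
    rw [hes, hew, hwe] at h1
    have h2 : ‖w‖ ≤ 1 := by
      rw [hw, CStarRing.norm_self_mul_star, ← CStarRing.norm_star_mul_self, hzu]
      refine norm_cfcₙ_le fun t _ => ?_
      rw [Real.norm_of_nonneg (cutoff_nonneg η t)]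
      exact cutoff_le_one η t
    have h3 : ‖w‖ • (e * e) ≤ (1 : ℝ) • (e * e) := by
      refine smul_le_smul_of_nonneg_right h2 ?_
      nth_rw 1 [← hes]
      exact star_mul_self_nonneg _
    rw [one_smul] at h3
    exact h1.trans h3
  -- Since `e` is a two-sided unit for `w`, the elements `w` and `e²` commute, so monotonicity on an
  -- abelian subalgebra is enough.
  have key : (τ w).re ≤ (τ (e * e)).re := by
    have hS : ∀ x ∈ ({w, e * e} : Set B), IsSelfAdjoint x := by
      rintro x (rfl | rfl)
      · exact hw0.isSelfAdjoint
      · rw [hee]; exact cfcₙ_predicate _ b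
    have hc : w * (e * e) = e * e * w := by
      rw [← mul_assoc, hwe, hwe, mul_assoc, hew, hew]
    have hunit : cfcₙ (cutoff (δ / 2)) b * (e * e) = e * e := by
      rw [hee, ← cfcₙ_mul _ _ b (by fun_prop) (by simp) (by fun_prop) (by simp)]
      refine cfcₙ_congr fun t _ => ?_
      rcases le_total t (δ / 2) with h | h
      · simp [cutoff_eq_zero hδ h]
      · simp [cutoff_eq_one (half_pos hδ) h]
    refine hτ.mono_of_mem (S := {w, e * e}) hS ?_ ?_ (subset_genAlg (by simp))
      (subset_genAlg (by simp)) hwle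
    · rintro x (rfl | rfl) y (rfl | rfl)
      exacts [rfl, hc, hc.symm, rfl]
    · intro g hg
      refine mem_pedersenIdeal_of_mul_eq (e := cfcₙ (cutoff (δ / 2)) b)
        (mul_eq_of_mem_genAlg hS ?_ hg)
      rintro x (rfl | rfl)
      · calc _ = cfcₙ (cutoff (δ / 2)) b * (e * e) * w := by rw [mul_assoc, mul_assoc e, hew, hew]
          _ = _ := by rw [hunit, mul_assoc, hew, hew]
      · exact hunit
  calc ENNReal.ofReal (τ u).re = ENNReal.ofReal (τ w).re := by rw [← hzu, hτ.tracial z]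
    _ ≤ ENNReal.ofReal (τ (cfcₙ (cutoff δ) b)).re := by
      rw [← hee]; exact ENNReal.ofReal_le_ofReal key
    _ ≤ rk τ b := le_rk b hδ

end Rank

/-! ### Markov inequalities, orthogonal sums and cut-downs -/

section RankProperties

variable {B : Type u} [NonUnitalCStarAlgebra B]

lemma mul_eq_zero_of_mem_genAlg {x y g : B} (hx : IsSelfAdjoint x) (h : y * x = 0)
    (hg : g ∈ genAlg {x}) : y * g = 0 := by
  refine genAlg_induction (S := {x}) (by simpa) (P := fun g => y * g = 0)
    (isClosed_eq (continuous_const.mul continuous_id) continuous_const) (mul_zero y) ?_ ?_ ?_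
    (by simpa) hg
  · intro a b h1 h2; rw [mul_add, h1, h2, add_zero]
  · intro r a h; rw [mul_smul_comm, h, smul_zero]
  · intro a b h; rw [← mul_assoc, h, zero_mul]

lemma mul_comm_eq_zero {x y : B} (hx : IsSelfAdjoint x) (hy : IsSelfAdjoint y) (h : x * y = 0) :
    y * x = 0 := by
  have := congrArg star h
  rwa [star_mul, hx.star_eq, hy.star_eq, star_zero] at this

lemma mul_cfcₙ_eq_zero {x y : B} (hx : IsSelfAdjoint x) (h : y * x = 0) (f : ℝ → ℝ) :
    y * cfcₙ f x = 0 :=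
  mul_eq_zero_of_mem_genAlg hx h (cfcₙ_mem_genAlg f x)

lemma cfcₙ_mul_cfcₙ_eq_zero {x y : B} (hx : IsSelfAdjoint x) (hy : IsSelfAdjoint y)
    (h : x * y = 0) (f g : ℝ → ℝ) : cfcₙ f x * cfcₙ g y = 0 := by
  refine mul_cfcₙ_eq_zero hy ?_ g
  exact mul_comm_eq_zero hy (cfcₙ_predicate f x) (mul_cfcₙ_eq_zero hx (mul_comm_eq_zero hx hy h) f)

lemma cutoff_half_mul_cutoff (a : B) {ε : ℝ} (hε : 0 < ε) :
    cfcₙ (cutoff (ε / 2)) a * cfcₙ (cutoff ε) a = cfcₙ (cutoff ε) a := by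
  by_cases ha : IsSelfAdjoint a
  · rw [← cfcₙ_mul _ _ a (by fun_prop) (by simp) (by fun_prop) (by simp)]
    refine cfcₙ_congr fun t _ => ?_
    rcases le_total t (ε / 2) with h | h
    · simp [cutoff_eq_zero hε h]
    · simp [cutoff_eq_one (half_pos hε) h]
  · simp [cfcₙ_apply_of_not_predicate a ha]

lemma norm_cfcₙ_cutoff_le (ε : ℝ) (a : B) : ‖cfcₙ (cutoff ε) a‖ ≤ 1 := by
  refine norm_cfcₙ_le fun t _ => ?_
  rw [Real.norm_of_nonneg (cutoff_nonneg ε t)]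
  exact cutoff_le_one ε t

variable {τ : B → ℂ}

lemma rk_zero (hτ : IsQuasitrace τ) : rk τ 0 = 0 := by
  simp [rk, hτ.map_zero]

variable [PartialOrder B] [StarOrderedRing B] (hτ : IsQuasitrace τ)

lemma cutoff_le_mul {ε x : ℝ} (hε : 0 < ε) (hx : 0 ≤ x) : cutoff ε x ≤ 2 / ε * x := by
  refine max_le (by positivity) ((min_le_right _ _).trans ?_)
  rw [div_mul_eq_mul_div]
  gcongr
  linarith

lemma cfcₙ_cutoff_le (a : B) (ha : 0 ≤ a) {ε : ℝ} (hε : 0 < ε) :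
    cfcₙ (cutoff ε) a ≤ (2 / ε) • a := by
  nth_rw 2 [← cfcₙ_id' ℝ a]
  rw [← cfcₙ_smul (2 / ε) (fun x => x) a (by fun_prop) rfl]
  exact cfcₙ_mono (fun x hx => cutoff_le_mul hε (quasispectrum_nonneg_of_nonneg a ha x hx))
    (by fun_prop) (by fun_prop) (by simp) (by simp)

lemma cfcₙ_cutoff_nonneg (ε : ℝ) (a : B) : 0 ≤ cfcₙ (cutoff ε) a :=
  cfcₙ_nonneg fun x _ => cutoff_nonneg ε x

lemma cfcₙ_ramp_nonneg (t : ℝ) (a : B) : 0 ≤ cfcₙ (ramp t) a :=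
  cfcₙ_nonneg fun x _ => ramp_nonneg t x

include hτ

lemma rk_mono {a b : B} (ha : 0 ≤ a) (h : a ≤ b) : rk τ a ≤ rk τ b :=
  rk_le_of_cuntzLE hτ ha (ha.trans h) (.of_le ha h)

lemma rk_le_of_le_smul {a b : B} (ha : 0 ≤ a) (hb : 0 ≤ b) {r : ℝ} (hr : 0 < r) (h : a ≤ r • b) :
    rk τ a ≤ rk τ b :=
  rk_le_of_cuntzLE hτ ha hb (.of_le_smul ha hr h)

lemma rk_star_mul_self_le (z : B) : rk τ (star z * z) ≤ rk τ (z * star z) :=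
  rk_le_of_cuntzLE hτ (star_mul_self_nonneg z) (mul_star_self_nonneg z) (.star_mul_self z)

lemma rk_star_mul_self (z : B) : rk τ (star z * z) = rk τ (z * star z) := by
  refine le_antisymm (rk_star_mul_self_le hτ z) ?_
  have := rk_star_mul_self_le hτ (star z)
  rwa [star_star] at this

lemma rk_conj_le {b : B} (hb : 0 ≤ b) (x : B) : rk τ (star x * b * x) ≤ rk τ b :=
  rk_le_of_cuntzLE hτ (star_left_conjugate_nonneg hb x) hb (.conj b x)

lemma rk_cfcₙ_le {a : B} (ha : 0 ≤ a) {f g : ℝ → ℝ} (hf : Continuous f) (hg : Continuous g)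
    (hf0 : f 0 = 0) (hg0 : g 0 = 0) (hfn : ∀ x, 0 ≤ x → 0 ≤ f x) (hgn : ∀ x, 0 ≤ x → 0 ≤ g x)
    {r : ℝ} (hr : 0 < r) (h : ∀ x, 0 ≤ x → x ≤ ‖a‖ → f x ≤ r * g x) :
    rk τ (cfcₙ f a) ≤ rk τ (cfcₙ g a) := by
  have hq := quasispectrum_nonneg_of_nonneg (𝕜 := ℝ) a ha
  refine rk_le_of_cuntzLE hτ (cfcₙ_nonneg fun x hx => hfn x (hq x hx))
    (cfcₙ_nonneg fun x hx => hgn x (hq x hx)) (.cfcₙ hf hg hf0 hg0 hr (fun x hx => hfn x (hq x hx))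
      fun x hx => h x (hq x hx) ?_)
  have := NonUnitalIsometricContinuousFunctionalCalculus.norm_quasispectrum_le (𝕜 := ℝ) a hx
    ha.isSelfAdjoint
  rwa [Real.norm_of_nonneg (hq x hx)] at this

/-- On the spectrum `x ≤ ‖a‖ f_ε(x) + √ε √x`. All functions of `a` are in the domain of `τ`, so the
last term has a finite value multiplied by `√ε` and disappears as `ε → 0`. -/
lemma re_le_norm_mul_rk {a : B} (ha : 0 ≤ a) (hP : ∀ g ∈ genAlg {a}, g ∈ pedersenIdeal B) :
    ENNReal.ofReal (τ a).re ≤ ENNReal.ofReal ‖a‖ * rk τ a := by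
  have hq := quasispectrum_nonneg_of_nonneg (𝕜 := ℝ) a ha
  have hS : ∀ x ∈ ({a} : Set B), IsSelfAdjoint x := by simpa using ha.isSelfAdjoint
  have hc : ∀ x ∈ ({a} : Set B), ∀ y ∈ ({a} : Set B), x * y = y * x := by simp
  have key (ε : ℝ) (hε : 0 < ε) : (τ a).re ≤
      ‖a‖ * (τ (cfcₙ (cutoff ε) a)).re + √ε * (τ (cfcₙ Real.sqrt a)).re := by
    have h1 : cfcₙ (fun x => ‖a‖ * cutoff ε x + √ε * √x) a
        = (‖a‖ : ℂ) • cfcₙ (cutoff ε) a + ((√ε : ℝ) : ℂ) • cfcₙ Real.sqrt a := by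
      rw [cfcₙ_add (fun x => ‖a‖ * cutoff ε x) (fun x => √ε * √x) a (by fun_prop) (by simp)
        (by fun_prop) (by simp), cfcₙ_const_mul _ _ a (by fun_prop) (by simp),
        cfcₙ_const_mul _ _ a (by fun_prop) (by simp)]
      simp only [Complex.coe_smul]
    have h2 : (τ a).re ≤ (τ (cfcₙ (fun x => ‖a‖ * cutoff ε x + √ε * √x) a)).re := by
      refine hτ.mono_of_mem hS hc hP (subset_genAlg (mem_singleton a)) (cfcₙ_mem_genAlg _ a) ?_
      nth_rw 1 [← cfcₙ_id' ℝ a]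
      refine cfcₙ_mono (fun x hx => ?_) (by fun_prop) (by fun_prop) rfl (by simp)
      have hx0 := hq x hx
      have hxa := NonUnitalIsometricContinuousFunctionalCalculus.norm_quasispectrum_le (𝕜 := ℝ) a hx
        ha.isSelfAdjoint
      rw [Real.norm_of_nonneg hx0] at hxa
      rcases le_total x ε with h | h
      · have h3 : x ≤ √ε * √x := by
          nth_rw 1 [← Real.mul_self_sqrt hx0]
          gcongr
        have := mul_nonneg (norm_nonneg a) (cutoff_nonneg ε x)
        linarith
      · rw [cutoff_eq_one hε h]
        have : 0 ≤ √ε * √x := by positivity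
        linarith
    rw [h1, hτ.add_of_mem hS hc hP (SMulMemClass.smul_mem _ (cfcₙ_mem_genAlg _ a))
      (SMulMemClass.smul_mem _ (cfcₙ_mem_genAlg _ a)),
      hτ.smul_of_mem hS hc hP (cfcₙ_mem_genAlg _ a), hτ.smul_of_mem hS hc hP (cfcₙ_mem_genAlg _ a)]
      at h2
    simpa using h2
  have hlim : Tendsto (fun ε : ℝ => ENNReal.ofReal ‖a‖ * ENNReal.ofReal (τ (cfcₙ (cutoff ε) a)).re
      + ENNReal.ofReal (√ε * (τ (cfcₙ Real.sqrt a)).re)) (𝓝[>] 0)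
      (𝓝 (ENNReal.ofReal ‖a‖ * rk τ a + ENNReal.ofReal (√0 * (τ (cfcₙ Real.sqrt a)).re))) := by
    refine (ENNReal.Tendsto.const_mul (tendsto_rk hτ ha) (.inr ENNReal.ofReal_ne_top)).add ?_
    refine (ENNReal.continuous_ofReal.tendsto _).comp ?_
    exact ((Real.continuous_sqrt.tendsto 0).mul_const _).mono_left nhdsWithin_le_nhds
  rw [Real.sqrt_zero, zero_mul, ENNReal.ofReal_zero, add_zero] at hlim
  refine ge_of_tendsto hlim ?_
  filter_upwards [self_mem_nhdsWithin] with ε hε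
  rw [← ENNReal.ofReal_mul (norm_nonneg a)]
  exact (ENNReal.ofReal_le_ofReal (key ε hε)).trans ENNReal.ofReal_add_le

/-- Markov's inequality: `t f_ε((x - t)₊) ≤ x` for `x ≥ 0`. -/
lemma mul_rk_ramp_le {a : B} (ha : 0 ≤ a) (hP : ∀ g ∈ genAlg {a}, g ∈ pedersenIdeal B) {t : ℝ}
    (ht : 0 < t) : ENNReal.ofReal t * rk τ (cfcₙ (ramp t) a) ≤ ENNReal.ofReal (τ a).re := by
  have hq := quasispectrum_nonneg_of_nonneg (𝕜 := ℝ) a ha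
  have hS : ∀ x ∈ ({a} : Set B), IsSelfAdjoint x := by simpa using ha.isSelfAdjoint
  have hc : ∀ x ∈ ({a} : Set B), ∀ y ∈ ({a} : Set B), x * y = y * x := by simp
  rw [rk, ENNReal.mul_iSup]
  refine iSup_le fun ε => ?_
  rw [ENNReal.mul_iSup]
  refine iSup_le fun hε => ?_
  rw [← ENNReal.ofReal_mul ht.le,
    ← cfcₙ_comp' (cutoff ε) (ramp t) a (by fun_prop) (by simp) (by fun_prop) (ramp_zero ht.le)]
  refine ENNReal.ofReal_le_ofReal ?_
  have h1 := hτ.smul_of_mem hS hc hP (cfcₙ_mem_genAlg (fun x => cutoff ε (ramp t x)) a) (t : ℂ)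
  have h2 : (τ ((t : ℂ) • cfcₙ (fun x => cutoff ε (ramp t x)) a)).re ≤ (τ a).re := by
    refine hτ.mono_of_mem hS hc hP (SMulMemClass.smul_mem _ (cfcₙ_mem_genAlg _ a))
      (subset_genAlg (mem_singleton a)) ?_
    nth_rw 2 [← cfcₙ_id' ℝ a]
    rw [Complex.coe_smul, ← cfcₙ_const_mul _ _ a (by fun_prop) (by simp [ramp_zero ht.le])]
    refine cfcₙ_mono (fun x hx => ?_) (by fun_prop) (by fun_prop) (by simp [ramp_zero ht.le]) rfl
    rcases le_total x t with h | h
    · simp [ramp, h, hq x hx]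
    · have := cutoff_le_one ε (ramp t x)
      nlinarith
  rw [h1] at h2
  simpa using h2

/-- The rank is superadditive on orthogonal elements. -/
lemma rk_add_rk_le {a b : B} (ha : 0 ≤ a) (hb : 0 ≤ b) (hab : a * b = 0) :
    rk τ a + rk τ b ≤ rk τ (a + b) := by
  refine le_of_tendsto ((tendsto_rk hτ ha).add (tendsto_rk hτ hb)) ?_
  filter_upwards [self_mem_nhdsWithin] with ε hε
  have hε : 0 < ε := hε
  set p := cfcₙ (cutoff ε) a with hp
  set q := cfcₙ (cutoff ε) b with hq
  have hp0 : 0 ≤ p := cfcₙ_cutoff_nonneg ε a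
  have hq0 : 0 ≤ q := cfcₙ_cutoff_nonneg ε b
  have horth (f g : ℝ → ℝ) : cfcₙ f a * cfcₙ g b = 0 :=
    cfcₙ_mul_cfcₙ_eq_zero ha.isSelfAdjoint hb.isSelfAdjoint hab f g
  have horth' (f g : ℝ → ℝ) : cfcₙ f b * cfcₙ g a = 0 :=
    cfcₙ_mul_cfcₙ_eq_zero hb.isSelfAdjoint ha.isSelfAdjoint
      (mul_comm_eq_zero ha.isSelfAdjoint hb.isSelfAdjoint hab) f g
  set e := cfcₙ (cutoff (ε / 2)) a + cfcₙ (cutoff (ε / 2)) b with he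
  have hep : e * p = p := by
    rw [he, add_mul, hp, horth', add_zero, cutoff_half_mul_cutoff a hε]
  have heq : e * q = q := by
    rw [he, add_mul, hq, horth, zero_add, cutoff_half_mul_cutoff b hε]
  have hS : ∀ x ∈ ({p, q} : Set B), IsSelfAdjoint x := by
    rintro x (rfl | rfl)
    exacts [hp0.isSelfAdjoint, hq0.isSelfAdjoint]
  have hpq : p * q = 0 := horth _ _
  have hqp : q * p = 0 := horth' _ _
  have hadd : τ (p + q) = τ p + τ q := by
    refine hτ.add_of_mem (S := {p, q}) hS ?_ ?_ (subset_genAlg (by simp)) (subset_genAlg (by simp))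
    · rintro x (rfl | rfl) y (rfl | rfl)
      exacts [rfl, hpq.trans hqp.symm, hqp.trans hpq.symm, rfl]
    · intro g hg
      refine mem_pedersenIdeal_of_mul_eq (e := e) (mul_eq_of_mem_genAlg hS ?_ hg)
      rintro x (rfl | rfl)
      exacts [hep, heq]
  have hw0 : 0 ≤ p + q := add_nonneg hp0 hq0
  -- Orthogonality gives `(p + q)² = p² + q² ≤ p + q`, so the norm of the sum does not exceed 1 and
  -- no factor 2 is lost below.
  have hw1 : ‖p + q‖ ≤ 1 := by
    have hsq {x : B} (hx : 0 ≤ x) (hn : ‖x‖ ≤ 1) : x * x ≤ x := by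
      obtain ⟨s, hs, -, hs2⟩ := exists_star_mul_self hx
      have h1 := CStarAlgebra.star_left_conjugate_le_norm_smul (a := s) hx.isSelfAdjoint
      rw [hs.star_eq, hs2] at h1
      have h2 : s * x * s = x * x := by rw [← hs2]; noncomm_ring
      rw [h2] at h1
      refine h1.trans ?_
      have := smul_le_smul_of_nonneg_right hn hx
      rwa [one_smul] at this
    have h1 : (p + q) * (p + q) ≤ p + q := by
      have : (p + q) * (p + q) = p * p + q * q := by
        rw [add_mul, mul_add, mul_add, hpq, hqp, add_zero, zero_add]
      rw [this]
      exact add_le_add (hsq hp0 (norm_cfcₙ_cutoff_le ε a)) (hsq hq0 (norm_cfcₙ_cutoff_le ε b))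
    have h2 : ‖p + q‖ * ‖p + q‖ ≤ ‖p + q‖ := by
      rw [← CStarRing.norm_star_mul_self, hw0.isSelfAdjoint.star_eq]
      refine CStarAlgebra.norm_le_norm_of_nonneg_of_le ?_ h1
      nth_rw 1 [← hw0.isSelfAdjoint.star_eq]
      exact star_mul_self_nonneg _
    by_contra! h
    nlinarith
  have hP : ∀ g ∈ genAlg {p + q}, g ∈ pedersenIdeal B := by
    intro g hg
    refine mem_pedersenIdeal_of_mul_eq (e := e) (mul_eq_of_mem_genAlg (S := {p + q}) ?_ ?_ hg)
    · simpa using hw0.isSelfAdjoint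
    · rintro x rfl
      rw [mul_add, hep, heq]
  calc ENNReal.ofReal (τ p).re + ENNReal.ofReal (τ q).re = ENNReal.ofReal (τ (p + q)).re := by
        rw [hadd, Complex.add_re, ENNReal.ofReal_add (hτ.re_nonneg hp0) (hτ.re_nonneg hq0)]
    _ ≤ ENNReal.ofReal ‖p + q‖ * rk τ (p + q) := re_le_norm_mul_rk hτ hw0 hP
    _ ≤ 1 * rk τ (p + q) := by
      gcongr
      exact ENNReal.ofReal_le_one.2 hw1
    _ ≤ rk τ (a + b) := by
      rw [one_mul]
      refine rk_le_of_le_smul hτ hw0 (add_nonneg ha hb) (r := 2 / ε) (by positivity) ?_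
      rw [smul_add]
      exact add_le_add (cfcₙ_cutoff_le a ha hε) (cfcₙ_cutoff_le b hb hε)

/-- Orthogonal elements, with cut-downs. -/
lemma rk_ramp_add_rk_ramp_le {x y : B} (hx : 0 ≤ x) (hy : 0 ≤ y) (hxy : x * y = 0) {s t : ℝ}
    (hs : 0 ≤ s) (hst : s < t) :
    rk τ (cfcₙ (ramp t) x) + rk τ (cfcₙ (ramp t) y) ≤ rk τ (cfcₙ (ramp s) (x + y)) := by
  have ht : 0 ≤ t := hs.trans hst.le
  have hyx := mul_comm_eq_zero hx.isSelfAdjoint hy.isSelfAdjoint hxy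
  have horth (f g : ℝ → ℝ) : cfcₙ f x * cfcₙ g y = 0 :=
    cfcₙ_mul_cfcₙ_eq_zero hx.isSelfAdjoint hy.isSelfAdjoint hxy f g
  have horth' (f g : ℝ → ℝ) : cfcₙ f y * cfcₙ g x = 0 :=
    cfcₙ_mul_cfcₙ_eq_zero hy.isSelfAdjoint hx.isSelfAdjoint hyx f g
  refine (rk_add_rk_le hτ (cfcₙ_ramp_nonneg t x) (cfcₙ_ramp_nonneg t y) (horth _ _)).trans ?_
  set f : ℝ → ℝ := fun r => √(ramp t r) with hf
  have hf0 : f 0 = 0 := by simp [hf, ramp_zero ht]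
  have hfc : Continuous f := by fun_prop
  have hff (a : B) : cfcₙ f a * cfcₙ f a = cfcₙ (ramp t) a := by
    by_cases ha : IsSelfAdjoint a
    · rw [← cfcₙ_mul f f a hfc.continuousOn hf0 hfc.continuousOn hf0]
      exact cfcₙ_congr fun r _ => Real.mul_self_sqrt (ramp_nonneg t r)
    · simp [cfcₙ_apply_of_not_predicate a ha]
  have hfaf {a : B} (ha : 0 ≤ a) : t • cfcₙ (ramp t) a ≤ cfcₙ f a * a * cfcₙ f a := by
    rw [cfcₙ_conj f hfc hf0 a ha.isSelfAdjoint,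
      ← cfcₙ_smul t (ramp t) a (by fun_prop) (ramp_zero ht)]
    refine cfcₙ_mono (fun r _ => ?_) (by fun_prop) (by fun_prop) (by simp [ramp_zero ht])
      (by simp)
    have : f r * r * f r = r * ramp t r := by
      rw [mul_comm (f r), mul_assoc, hf, Real.mul_self_sqrt (ramp_nonneg t r)]
    rw [this, smul_eq_mul]
    rcases le_total r t with h | h
    · simp [ramp, h]
    · exact mul_le_mul_of_nonneg_right h (ramp_nonneg t r)
  set S := x + y with hS
  have hS0 : 0 ≤ S := add_nonneg hx hy
  set q := cfcₙ f x + cfcₙ f y with hq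
  have hqs : star q = q :=
    ((cfcₙ_predicate f x : IsSelfAdjoint _).add (cfcₙ_predicate f y : IsSelfAdjoint _))
  have hqq : q * q = cfcₙ (ramp t) x + cfcₙ (ramp t) y := by
    rw [hq, add_mul, mul_add, mul_add, horth, horth', hff, hff, add_zero, zero_add]
  have h1 : cfcₙ f x * y = 0 := mul_comm_eq_zero hy.isSelfAdjoint (cfcₙ_predicate f x)
    (mul_cfcₙ_eq_zero hx.isSelfAdjoint hyx f)
  have h2 : cfcₙ f y * x = 0 := mul_comm_eq_zero hx.isSelfAdjoint (cfcₙ_predicate f y)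
    (mul_cfcₙ_eq_zero hy.isSelfAdjoint hxy f)
  have hqS : t • (q * q) ≤ q * S * q := by
    have e : q * S * q = cfcₙ f x * x * cfcₙ f x + cfcₙ f y * y * cfcₙ f y := by
      rw [hq, hS]
      have : (cfcₙ f x + cfcₙ f y) * (x + y) = cfcₙ f x * x + cfcₙ f y * y := by
        rw [add_mul, mul_add, mul_add, h1, h2, add_zero, zero_add]
      rw [this, add_mul, mul_add, mul_add]
      have h3 : cfcₙ f x * x * cfcₙ f y = 0 := by
        rw [mul_assoc, mul_cfcₙ_eq_zero hy.isSelfAdjoint hxy f, mul_zero]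
      have h4 : cfcₙ f y * y * cfcₙ f x = 0 := by
        rw [mul_assoc, mul_cfcₙ_eq_zero hx.isSelfAdjoint hyx f, mul_zero]
      rw [h3, h4, add_zero, zero_add]
    rw [e, hqq, smul_add]
    exact add_le_add (hfaf hx) (hfaf hy)
  have hw0 : 0 ≤ q * q := by nth_rw 1 [← hqs]; exact star_mul_self_nonneg q
  -- `q` lives where `x` and `y` are at least `t`, hence `q S q ≥ t q²`; cutting `S` down by `s`
  -- loses at most `s q²`.
  have hcon : (t - s) • (q * q) ≤ q * cfcₙ (ramp s) S * q := by
    have h3 := CStarAlgebra.star_left_conjugate_le_norm_smul (a := q)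
      (b := S - cfcₙ (ramp s) S) (hS0.isSelfAdjoint.sub (cfcₙ_predicate _ _))
    rw [hqs] at h3
    have h4 := h3.trans (smul_le_smul_of_nonneg_right (norm_sub_ramp_le hS0 hs) hw0)
    have h5 : q * (S - cfcₙ (ramp s) S) * q = q * S * q - q * cfcₙ (ramp s) S * q := by
      noncomm_ring
    rw [h5, sub_le_iff_le_add] at h4
    rw [sub_smul, sub_le_iff_le_add, add_comm]
    exact hqS.trans h4
  rw [← hqq]
  have hts : 0 < t - s := by linarith
  have h6 : rk τ (q * q) ≤ rk τ (q * cfcₙ (ramp s) S * q) := by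
    refine rk_le_of_le_smul hτ hw0 ?_ (inv_pos.2 hts) ?_
    · nth_rw 1 [← hqs]; exact star_left_conjugate_nonneg (cfcₙ_ramp_nonneg s S) q
    · have := smul_le_smul_of_nonneg_left hcon (inv_nonneg.2 hts.le)
      rwa [smul_smul, inv_mul_cancel₀ hts.ne', one_smul] at this
  refine h6.trans ?_
  nth_rw 1 [← hqs]
  exact rk_conj_le hτ (cfcₙ_ramp_nonneg s S) q

/-- Comparison of cut-downs under an inequality `a ≤ b + c`. -/
lemma rk_ramp_le_of_le_add (hadd : ∀ a b : B, 0 ≤ a → 0 ≤ b → rk τ (a + b) ≤ rk τ a + rk τ b)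
    {a b c : B} (ha : 0 ≤ a) (hb : 0 ≤ b) (hc : 0 ≤ c) (h : a ≤ b + c) {r s t : ℝ} (hs : 0 ≤ s)
    (ht : 0 ≤ t) (hr : s + t < r) :
    rk τ (cfcₙ (ramp r) a) ≤ rk τ (cfcₙ (ramp s) b) + rk τ (cfcₙ (ramp t) c) := by
  have hr0 : 0 ≤ r := by linarith
  -- Here `g(x)² (x - (s + t)) = (x - r)₊`. Conjugating `a ≤ b + c` by `g(a)`, the subtracted term
  -- `(s + t) g(a)²` absorbs exactly the errors of cutting `b` by `s` and `c` by `t`.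
  set g : ℝ → ℝ := fun x => √(ramp r x / max (x - (s + t)) (r - (s + t))) with hg
  have hden (x : ℝ) : 0 < max (x - (s + t)) (r - (s + t)) := lt_max_of_lt_right (by linarith)
  have hgc : Continuous g :=
    Real.continuous_sqrt.comp ((continuous_ramp r).div (by fun_prop) fun x => (hden x).ne')
  have hg0 : g 0 = 0 := by simp [hg, ramp_zero hr0]
  have hgs : star (cfcₙ g a) = cfcₙ g a := (cfcₙ_predicate g a : IsSelfAdjoint _)
  have hgg (x : ℝ) : g x * x * g x - (s + t) * (g x * g x) = ramp r x := by
    have : g x * g x = ramp r x / max (x - (s + t)) (r - (s + t)) :=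
      Real.mul_self_sqrt (div_nonneg (ramp_nonneg r x) (hden x).le)
    have e : g x * x * g x - (s + t) * (g x * g x) = (x - (s + t)) * (g x * g x) := by ring
    rw [e, this]
    rcases le_total x r with h | h
    · simp [ramp, h]
    · rw [max_eq_left (by linarith)]
      exact mul_div_cancel₀ _ (by linarith)
  set k := cfcₙ g a with hk
  have hkk : 0 ≤ k * k := by nth_rw 1 [← hgs]; exact star_mul_self_nonneg k
  have e1 : cfcₙ (ramp r) a = k * a * k - (s + t) • (k * k) := by
    rw [hk, cfcₙ_conj g hgc hg0 a ha.isSelfAdjoint,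
      ← cfcₙ_mul g g a hgc.continuousOn hg0 hgc.continuousOn hg0,
      ← cfcₙ_smul (s + t) (fun t => g t * g t) a (by fun_prop) (by simp [hg0]),
      ← cfcₙ_sub (fun t => g t * t * g t) (fun x => (s + t) • (g x * g x)) a (by fun_prop) (by simp)
        (by fun_prop) (by simp [hg0])]
    exact cfcₙ_congr fun x _ => by simp [← hgg x]
  have hcut {d : B} (hd : 0 ≤ d) {δ : ℝ} (hδ : 0 ≤ δ) :
      k * d * k ≤ k * cfcₙ (ramp δ) d * k + δ • (k * k) := by
    have h3 := CStarAlgebra.star_left_conjugate_le_norm_smul (a := k)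
      (b := d - cfcₙ (ramp δ) d) (hd.isSelfAdjoint.sub (cfcₙ_predicate _ _))
    rw [hgs] at h3
    have h4 := h3.trans (smul_le_smul_of_nonneg_right (norm_sub_ramp_le hd hδ) hkk)
    have h5 : k * (d - cfcₙ (ramp δ) d) * k = k * d * k - k * cfcₙ (ramp δ) d * k := by
      noncomm_ring
    rw [h5, sub_le_iff_le_add'] at h4
    exact h4
  have h1 : k * a * k ≤ k * b * k + k * c * k := by
    have := star_left_conjugate_le_conjugate h k
    rwa [hgs, mul_add, add_mul] at this
  have h2 : cfcₙ (ramp r) a ≤ k * (cfcₙ (ramp s) b + cfcₙ (ramp t) c) * k := by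
    rw [e1, sub_le_iff_le_add, mul_add, add_mul, add_smul]
    refine (h1.trans (add_le_add (hcut hb hs) (hcut hc ht))).trans (le_of_eq ?_)
    abel
  refine (rk_mono hτ (cfcₙ_ramp_nonneg r a) h2).trans ?_
  have hsum : 0 ≤ cfcₙ (ramp s) b + cfcₙ (ramp t) c :=
    add_nonneg (cfcₙ_ramp_nonneg s b) (cfcₙ_ramp_nonneg t c)
  nth_rw 1 [← hgs]
  exact (rk_conj_le hτ hsum k).trans (hadd _ _ (cfcₙ_ramp_nonneg s b) (cfcₙ_ramp_nonneg t c))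

end RankProperties

/-! ### Subadditivity of the rank from the extension to 2×2 matrices -/

section TwoQuasitraces

variable {B M : Type u} [NonUnitalCStarAlgebra B] [NonUnitalCStarAlgebra M]

lemma cfcₙ_map_prodHom [PartialOrder B] [StarOrderedRing B] (φ : B × B →⋆ₙₐ[ℂ] M) (f : ℝ → ℝ)
    (hf : Continuous f) (hf0 : f 0 = 0) {a b : B} (ha : 0 ≤ a) (hb : 0 ≤ b) :
    cfcₙ f (φ (a, b)) = φ (cfcₙ f a, cfcₙ f b) := by
  have hab : IsSelfAdjoint (a, b) := Prod.ext ha.isSelfAdjoint hb.isSelfAdjoint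
  have := NonUnitalStarAlgHom.map_cfcₙ φ f (a, b) (by fun_prop) hf0
    (AddMonoidHomClass.continuous_of_bound φ 1 fun x => by
      simpa using NonUnitalStarAlgHom.norm_apply_le φ x) hab (hab.map φ)
  rw [← this, cfcₙ_map_prod (S := ℂ) f a b (by fun_prop) hab ha.isSelfAdjoint hb.isSelfAdjoint]

/-- Diagonal matrices, as a ⋆-homomorphism. -/
def diagHom : B × B →⋆ₙₐ[ℂ] CStarMatrix (Fin 2) (Fin 2) B where
  toFun x := CStarMatrix.ofMatrix !![x.1, 0; 0, x.2]
  map_smul' c x := by ext i j; fin_cases i <;> fin_cases j <;> simp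
  map_zero' := by ext i j; fin_cases i <;> fin_cases j <;> simp
  map_add' x y := by ext i j; fin_cases i <;> fin_cases j <;> simp
  map_mul' x y := by
    ext i j; fin_cases i <;> fin_cases j <;> simp [CStarMatrix.mul_apply]
  map_star' x := by
    ext i j; fin_cases i <;> fin_cases j <;> simp [CStarMatrix.star_apply]

lemma diagHom_apply (a b : B) : diagHom (a, b) = CStarMatrix.ofMatrix !![a, 0; 0, b] := rfl

variable [PartialOrder B] [StarOrderedRing B] [PartialOrder M] [StarOrderedRing M]

/-- The rank of `a + b` is at most that of `φ(a, b)`, via `z`. A function of `φ(a, b)` splits into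
orthogonal parts from `a` and from `b`, on which `τ₂` is additive, and `y` moves `b` from the second
place to the first. -/
lemma rk_add_le_of_prodHom {τ : B → ℂ} {τ₂ : M → ℂ} (hτ₂ : IsQuasitrace τ₂)
    (φ : B × B →⋆ₙₐ[ℂ] M) (hext : ∀ x ∈ pedersenIdeal B, τ₂ (φ (x, 0)) = τ x) {a b : B} (ha : 0 ≤ a)
    (hb : 0 ≤ b) {z y : M} (hz : star z * z = φ (a + b, 0)) (hz' : z * star z ≤ φ (a, b) + φ (a, b))
    (hy : y * star y = φ (b, 0)) (hy' : star y * y = φ (0, b)) :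
    rk τ (a + b) ≤ rk τ a + rk τ b := by
  have hrk (x : B) (hx : 0 ≤ x) : rk τ₂ (φ (x, 0)) = rk τ x := by
    unfold rk
    refine iSup_congr fun ε => iSup_congr fun hε => ?_
    rw [cfcₙ_map_prodHom φ _ (by fun_prop) (by simp) hx le_rfl, cfcₙ_apply_zero, hext]
    exact mem_pedersenIdeal_of_mul_eq (cutoff_half_mul_cutoff x hε)
  have hpos {x y : B} (hx : 0 ≤ x) (hy : 0 ≤ y) : 0 ≤ φ (x, y) := by
    obtain ⟨s, hs, -, rfl⟩ := exists_star_mul_self hx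
    obtain ⟨t, ht, -, rfl⟩ := exists_star_mul_self hy
    have : φ (s * s, t * t) = star (φ (s, t)) * φ (s, t) := by
      rw [← map_star, ← map_mul]
      congr 1
      exact Prod.ext (by simp [hs.star_eq]) (by simp [ht.star_eq])
    rw [this]
    exact star_mul_self_nonneg _
  have h1 : rk τ (a + b) ≤ rk τ₂ (φ (a, b)) := by
    rw [← hrk _ (add_nonneg ha hb), ← hz]
    refine (rk_star_mul_self_le hτ₂ z).trans ?_
    refine rk_le_of_le_smul hτ₂ (mul_star_self_nonneg z) (hpos ha hb) two_pos ?_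
    rwa [two_smul]
  have h2 : rk τ₂ (φ (0, b)) ≤ rk τ b := by
    rw [← hrk b hb, ← hy, ← hy']
    exact rk_star_mul_self_le hτ₂ y
  refine h1.trans (le_trans ?_ (add_le_add_right h2 _))
  rw [← hrk a ha]
  refine iSup₂_le fun ε hε => ?_
  set p := φ (cfcₙ (cutoff ε) a, 0) with hp
  set q := φ (0, cfcₙ (cutoff ε) b) with hq
  set e := φ (cfcₙ (cutoff (ε / 2)) a, cfcₙ (cutoff (ε / 2)) b) with he
  have hp0 : 0 ≤ p := hpos (cfcₙ_cutoff_nonneg ε a) le_rfl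
  have hq0 : 0 ≤ q := hpos le_rfl (cfcₙ_cutoff_nonneg ε b)
  have hep : e * p = p := by
    rw [he, hp, ← map_mul, Prod.mk_mul_mk, cutoff_half_mul_cutoff a hε, mul_zero]
  have heq : e * q = q := by
    rw [he, hq, ← map_mul, Prod.mk_mul_mk, cutoff_half_mul_cutoff b hε, mul_zero]
  have hpq : p * q = 0 := by
    rw [hp, hq, ← map_mul, Prod.mk_mul_mk, mul_zero, zero_mul, Prod.mk_zero_zero, map_zero]
  have hqp : q * p = 0 := by
    rw [hp, hq, ← map_mul, Prod.mk_mul_mk, mul_zero, zero_mul, Prod.mk_zero_zero, map_zero]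
  have hS : ∀ x ∈ ({p, q} : Set M), IsSelfAdjoint x := by
    rintro x (rfl | rfl)
    exacts [hp0.isSelfAdjoint, hq0.isSelfAdjoint]
  have hadd : τ₂ (p + q) = τ₂ p + τ₂ q := by
    refine hτ₂.add_of_mem (S := {p, q}) hS ?_ ?_ (subset_genAlg (by simp)) (subset_genAlg (by simp))
    · rintro x (rfl | rfl) y (rfl | rfl)
      exacts [rfl, hpq.trans hqp.symm, hqp.trans hpq.symm, rfl]
    · intro g hg
      refine mem_pedersenIdeal_of_mul_eq (e := e) (mul_eq_of_mem_genAlg hS ?_ hg)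
      rintro x (rfl | rfl)
      exacts [hep, heq]
  have h3 : cfcₙ (cutoff ε) (φ (a, b)) = p + q := by
    rw [cfcₙ_map_prodHom φ _ (by fun_prop) (by simp) ha hb, hp, hq, ← map_add, Prod.mk_add_mk,
      add_zero, zero_add]
  rw [h3, hadd, Complex.add_re, ENNReal.ofReal_add (hτ₂.re_nonneg hp0) (hτ₂.re_nonneg hq0)]
  have h4 : p = cfcₙ (cutoff ε) (φ (a, 0)) := by
    rw [cfcₙ_map_prodHom φ _ (by fun_prop) (by simp) ha le_rfl, cfcₙ_apply_zero]
  have h5 : q = cfcₙ (cutoff ε) (φ (0, b)) := by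
    rw [cfcₙ_map_prodHom φ _ (by fun_prop) (by simp) le_rfl hb, cfcₙ_apply_zero]
  rw [h4, h5]
  exact add_le_add (le_rk _ hε) (le_rk _ hε)

/-- The rank with respect to a 2-quasitrace is subadditive. -/
lemma Is2Quasitrace.rk_add_le {τ : B → ℂ} (h : Is2Quasitrace τ) {a b : B} (ha : 0 ≤ a)
    (hb : 0 ≤ b) : rk τ (a + b) ≤ rk τ a + rk τ b := by
  obtain ⟨hτ, τ₂, hτ₂, hext⟩ := h
  obtain ⟨s, hs, -, hs2⟩ := exists_star_mul_self ha
  obtain ⟨t, ht, -, ht2⟩ := exists_star_mul_self hb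
  refine rk_add_le_of_prodHom hτ₂ diagHom hext ha hb (z := CStarMatrix.ofMatrix !![s, 0; t, 0])
    (y := CStarMatrix.ofMatrix !![0, t; 0, 0]) ?_ ?_ ?_ ?_
  · rw [diagHom_apply, ← hs2, ← ht2]
    ext i j
    fin_cases i <;> fin_cases j <;>
      simp [CStarMatrix.mul_apply, CStarMatrix.star_apply, hs.star_eq, ht.star_eq]
  -- Changing the sign of `t` changes the sign of the off-diagonal entries of `zz*`, so the two
  -- versions add up to twice the diagonal matrix.
  · have key : diagHom (a, b) + diagHom (a, b) - CStarMatrix.ofMatrix !![s, 0; t, 0] *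
        star (CStarMatrix.ofMatrix !![s, 0; t, 0]) = CStarMatrix.ofMatrix !![s, 0; -t, 0] *
        star (CStarMatrix.ofMatrix !![s, 0; -t, 0]) := by
      rw [diagHom_apply, ← hs2, ← ht2]
      ext i j
      fin_cases i <;> fin_cases j <;>
        simp [CStarMatrix.mul_apply, CStarMatrix.star_apply, hs.star_eq, ht.star_eq]
    rw [← sub_nonneg, key]
    exact mul_star_self_nonneg _
  · rw [diagHom_apply, ← ht2]
    ext i j
    fin_cases i <;> fin_cases j <;>
      simp [CStarMatrix.mul_apply, CStarMatrix.star_apply, ht.star_eq]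
  · rw [diagHom_apply, ← ht2]
    ext i j
    fin_cases i <;> fin_cases j <;>
      simp [CStarMatrix.mul_apply, CStarMatrix.star_apply, ht.star_eq]

end TwoQuasitraces

/-! ### Orthogonal families in simple algebras -/

section OrthogonalFamilies

variable (A : Type u) [NonUnitalCStarAlgebra A] [PartialOrder A] [StarOrderedRing A]

/-- There are `n` mutually orthogonal nonzero positive elements. -/
def HasOrthFamily (n : ℕ) : Prop :=
  ∃ x : Fin n → A, (∀ i, 0 ≤ x i ∧ x i ≠ 0) ∧ ∀ i j, i ≠ j → x i * x j = 0

variable {A}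

/-- A self-adjoint element orthogonal to `N - 1` members of an orthogonal family of maximal size
has a one-point nonzero spectrum. -/
lemma exists_mul_self_eq_smul {N : ℕ} (hN : ¬ HasOrthFamily A (N + 1)) {x : Fin N → A}
    (hx : ∀ i, 0 ≤ x i ∧ x i ≠ 0) (horth : ∀ i j, i ≠ j → x i * x j = 0) (i₀ : Fin N) {h : A}
    (hs : IsSelfAdjoint h) (hh : ∀ j, j ≠ i₀ → x j * h = 0) : ∃ r : ℝ, h * h = r • h := by
  have huniq : ∀ μ ∈ quasispectrum ℝ h, ∀ ν ∈ quasispectrum ℝ h, μ ≠ 0 → ν ≠ 0 → μ = ν := by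
    intro μ hμ ν hν hμ0 hν0
    by_contra hne
    -- Bumps of radius `d` around `μ` and `ν` have disjoint supports, and both vanish at 0.
    set d := min (|μ - ν| / 2) (min |μ| |ν|) with hd
    have hdpos : 0 < d := by
      refine lt_min (half_pos (abs_pos.2 (sub_ne_zero.2 hne))) (lt_min ?_ ?_) <;>
        exact abs_pos.2 ‹_›
    let b (c t : ℝ) : ℝ := max 0 (d - |t - c|)
    have hbc (c : ℝ) : Continuous (b c) := by unfold b; fun_prop
    have hb0 {c : ℝ} (hc : d ≤ |c|) : b c 0 = 0 := by simp [b, hc]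
    have hbb (t : ℝ) : b μ t * b ν t = 0 := by
      by_contra h0
      have h1 : 0 < d - |t - μ| := by
        by_contra h; exact h0 (by simp [b, not_lt.1 h])
      have h2 : 0 < d - |t - ν| := by
        by_contra h; exact h0 (by simp [b, not_lt.1 h])
      have h3 : |μ - ν| ≤ |t - μ| + |t - ν| := by
        have := abs_sub_le μ t ν
        rwa [abs_sub_comm μ t] at this
      have h4 : d ≤ |μ - ν| / 2 := min_le_left _ _
      linarith
    have hdμ : d ≤ |μ| := (min_le_right _ _).trans (min_le_left _ _)
    have hdν : d ≤ |ν| := (min_le_right _ _).trans (min_le_right _ _)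
    have hpos (c : ℝ) : 0 ≤ cfcₙ (b c) h := cfcₙ_nonneg fun t _ => le_max_left _ _
    have hne0 {c : ℝ} (hc : c ∈ quasispectrum ℝ h) (hdc : d ≤ |c|) : cfcₙ (b c) h ≠ 0 := by
      intro h0
      have := norm_apply_le_norm_cfcₙ (b c) h hc (hbc c).continuousOn (hb0 hdc) hs
      rw [h0, norm_zero] at this
      have h1 : b c c = d := by simp [b, hdpos.le]
      rw [h1, Real.norm_of_nonneg hdpos.le] at this
      linarith
    have hmul : cfcₙ (b μ) h * cfcₙ (b ν) h = 0 := by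
      rw [← cfcₙ_mul (b μ) (b ν) h (hbc μ).continuousOn (hb0 hdμ) (hbc ν).continuousOn (hb0 hdν)]
      simp only [hbb]
      exact cfcₙ_const_zero ℝ h
    have hmul' := mul_comm_eq_zero (hpos μ).isSelfAdjoint (hpos ν).isSelfAdjoint hmul
    have hxb (c : ℝ) (j : Fin N) (hj : j ≠ i₀) : x j * cfcₙ (b c) h = 0 :=
      mul_cfcₙ_eq_zero hs (hh j hj) _
    have hxb' (c : ℝ) (j : Fin N) (hj : j ≠ i₀) : cfcₙ (b c) h * x j = 0 :=
      mul_comm_eq_zero (hx j).1.isSelfAdjoint (hpos c).isSelfAdjoint (hxb c j hj)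
    -- Putting the two bumps of `h` in the place of `x i₀` gives an orthogonal family that is too
    -- large.
    refine hN ⟨Fin.cons (cfcₙ (b μ) h) (Function.update x i₀ (cfcₙ (b ν) h)), ?_, ?_⟩
    · refine Fin.cases ⟨hpos μ, hne0 hμ hdμ⟩ fun i => ?_
      rw [Fin.cons_succ]
      rcases eq_or_ne i i₀ with rfl | hi
      · rw [Function.update_self]; exact ⟨hpos ν, hne0 hν hdν⟩
      · rw [Function.update_of_ne hi]; exact hx i
    · refine Fin.cases (Fin.cases (fun h => (h rfl).elim) fun j _ => ?_) fun i =>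
        Fin.cases (fun _ => ?_) fun j hij => ?_
      · rw [Fin.cons_zero, Fin.cons_succ]
        rcases eq_or_ne j i₀ with rfl | hi
        · rw [Function.update_self, hmul]
        · rw [Function.update_of_ne hi, hxb' μ j hi]
      · rw [Fin.cons_zero, Fin.cons_succ]
        rcases eq_or_ne i i₀ with rfl | hi
        · rw [Function.update_self, hmul']
        · rw [Function.update_of_ne hi, hxb μ i hi]
      · rw [Fin.cons_succ, Fin.cons_succ]
        have hij' : i ≠ j := fun h => hij (by rw [h])
        rcases eq_or_ne i i₀ with rfl | hi
        · rw [Function.update_self, Function.update_of_ne hij'.symm, hxb' ν j hij'.symm]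
        · rw [Function.update_of_ne hi]
          rcases eq_or_ne j i₀ with rfl | hj
          · rw [Function.update_self, hxb ν i hi]
          · rw [Function.update_of_ne hj, horth i j hij']
  obtain ⟨r, hr⟩ : ∃ r : ℝ, ∀ t ∈ quasispectrum ℝ h, t ≠ 0 → t = r := by
    by_cases hex : ∃ μ ∈ quasispectrum ℝ h, μ ≠ 0
    · obtain ⟨μ, hμ, hμ0⟩ := hex
      exact ⟨μ, fun t ht ht0 => huniq t ht μ hμ ht0 hμ0⟩
    · push Not at hex
      exact ⟨0, fun t ht ht0 => (ht0 (hex t ht)).elim⟩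
  refine ⟨r, ?_⟩
  nth_rw 1 2 3 [← cfcₙ_id' ℝ h]
  rw [← cfcₙ_mul (fun x => x) (fun x => x) h (by fun_prop) rfl (by fun_prop) rfl,
    ← cfcₙ_smul r (fun x => x) h (by fun_prop) rfl]
  refine cfcₙ_congr fun t ht => ?_
  rcases eq_or_ne t 0 with rfl | h0
  · simp
  · simp [hr t ht h0]

/-- A minimal projection: `p a p` is always a multiple of `p`. -/
def IsMinimalProj (p : A) : Prop :=
  IsSelfAdjoint p ∧ p * p = p ∧ p ≠ 0 ∧ ∀ a : A, ∃ c : ℂ, p * a * p = c • p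

/-- A member of an orthogonal family of maximal size is a multiple of a projection `p`. For
self-adjoint `a` and `h = pap`, every `h + sp` is still orthogonal to the other members and so
satisfies a quadratic equation; comparing several `s` makes `h` a multiple of `p`. -/
lemma exists_isMinimalProj {N : ℕ} (hN : ¬ HasOrthFamily A (N + 1)) (hN' : HasOrthFamily A N)
    (h0 : 0 < N) : ∃ p : A, IsMinimalProj p := by
  obtain ⟨x, hx, horth⟩ := hN'
  set i₀ : Fin N := ⟨0, h0⟩
  have key := fun {h : A} => exists_mul_self_eq_smul hN hx horth i₀ (h := h)
  obtain ⟨r, hr⟩ := key (hx i₀).1.isSelfAdjoint fun j hj => horth j i₀ hj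
  have hr0 : r ≠ 0 := by
    rintro rfl
    refine (hx i₀).2 (CStarRing.star_mul_self_eq_zero_iff _ |>.1 ?_)
    rw [(hx i₀).1.isSelfAdjoint.star_eq, hr, zero_smul]
  set p := r⁻¹ • x i₀ with hp
  have hps : IsSelfAdjoint p := IsSelfAdjoint.smul (IsSelfAdjoint.all r⁻¹) (hx i₀).1.isSelfAdjoint
  have hpp : p * p = p := by
    rw [hp, smul_mul_smul_comm, hr, smul_smul]
    congr 1
    field_simp
  have hp0 : p ≠ 0 := smul_ne_zero (inv_ne_zero hr0) (hx i₀).2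
  have hpx (j : Fin N) (hj : j ≠ i₀) : x j * p = 0 := by
    rw [hp, mul_smul_comm, horth j i₀ hj, smul_zero]
  have hsa (a : A) (ha : IsSelfAdjoint a) : ∃ t : ℝ, p * a * p = t • p := by
    set h := p * a * p with hh
    have hhs : IsSelfAdjoint h := by
      have := ha.conjugate p
      rwa [hps.star_eq] at this
    have hph : p * h = h := by rw [hh, ← mul_assoc, ← mul_assoc, hpp]
    have hhp : h * p = h := by rw [hh, mul_assoc, hpp]
    have hsq (s : ℝ) : ∃ r : ℝ, (h + s • p) * (h + s • p) = r • (h + s • p) := by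
      refine key (hhs.add (IsSelfAdjoint.smul (IsSelfAdjoint.all s) hps)) fun j hj => ?_
      rw [mul_add, mul_smul_comm, hpx j hj, smul_zero, add_zero, ← hph, ← mul_assoc, hpx j hj,
        zero_mul]
    have hexp (s : ℝ) : (h + s • p) * (h + s • p) = h * h + (2 * s) • h + (s * s) • p := by
      rw [add_mul, mul_add, mul_add, mul_smul_comm, smul_mul_assoc, smul_mul_smul_comm, hph, hhp,
        hpp]
      module
    obtain ⟨l, hl⟩ := hsq 0
    simp only [zero_smul, add_zero] at hl
    have hrel (s m : ℝ) (hm : (h + s • p) * (h + s • p) = m • (h + s • p)) :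
        (l + 2 * s - m) • h = (m * s - s * s) • p := by
      rw [hexp, hl] at hm
      have : (l + 2 * s - m) • h - (m * s - s * s) • p =
        (l • h + (2 * s) • h + (s * s) • p) - m • (h + s • p) := by module
      rw [← sub_eq_zero, this, hm, sub_self]
    have hdone (c d : ℝ) (hc : c ≠ 0) (hcd : c • h = d • p) : ∃ t : ℝ, h = t • p :=
      ⟨c⁻¹ * d, by rw [mul_smul, ← hcd, smul_smul, inv_mul_cancel₀ hc, one_smul]⟩
    -- Two shifts suffice: if the coefficient of `h` vanished for both, then `m = 1` and `n = 2`,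
    -- giving `l = -1` and `l = -2`.
    obtain ⟨m, hm⟩ := hsq 1
    obtain ⟨n, hn⟩ := hsq 2
    have h1 := hrel 1 m hm
    have h2 := hrel 2 n hn
    by_cases hc1 : l + 2 * 1 - m = 0
    · by_cases hc2 : l + 2 * 2 - n = 0
      · rw [hc1, zero_smul, eq_comm, smul_eq_zero, or_iff_left hp0] at h1
        rw [hc2, zero_smul, eq_comm, smul_eq_zero, or_iff_left hp0] at h2
        exfalso
        linarith
      · exact hdone _ _ hc2 h2
    · exact hdone _ _ hc1 h1
  refine ⟨p, hps, hpp, hp0, fun a => ?_⟩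
  clear_value p
  obtain ⟨s, hs⟩ := hsa (realPart a) (realPart a).2
  obtain ⟨t, ht⟩ := hsa (imaginaryPart a) (imaginaryPart a).2
  refine ⟨(s : ℂ) + Complex.I * t, ?_⟩
  nth_rw 1 [← realPart_add_I_smul_imaginaryPart a]
  rw [mul_add, add_mul, mul_smul_comm, smul_mul_assoc, hs, ht, add_smul, mul_smul, Complex.coe_smul,
    Complex.coe_smul]

end OrthogonalFamilies

/-! ### A minimal projection makes the algebra elementary -/

section MinimalProjection

variable {A : Type u} [NonUnitalCStarAlgebra A] [PartialOrder A] [StarOrderedRing A]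

/-- Because `pAp = ℂp`, the left ideal `Ap` is a Hilbert space with `x*y = ⟨x, y⟩ p`, on which `A`
acts by left multiplication, faithfully by simplicity. An orthonormal family `(v_i)` gives
orthogonal projections `v_i v_i*`, so the bound on orthogonal families makes `Ap` finite
dimensional. Every operator `T` is then compact and comes from `∑ T(e_i) e_i*`. -/
lemma isElementary_of_isMinimalProj (hsimple : IsSimpleRing A) {p : A} (hp : IsMinimalProj p) {N : ℕ}
    (hN : ¬ HasOrthFamily A N) : IsElementary A := by
  obtain ⟨hps, hpp, hp0, hmin⟩ := hp
  choose φ hφ using hmin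
  have hinj {c d : ℂ} (h : c • p = d • p) : c = d := smul_left_injective ℂ hp0 h
  have hφeq {a : A} {c : ℂ} (h : p * a * p = c • p) : φ a = c := hinj ((hφ a).symm.trans h)
  have hφadd (a b : A) : φ (a + b) = φ a + φ b :=
    hφeq (by rw [mul_add, add_mul, hφ, hφ, add_smul])
  have hφsmul (c : ℂ) (a : A) : φ (c • a) = c * φ a :=
    hφeq (by rw [mul_smul_comm, smul_mul_assoc, hφ, mul_smul])
  have hφstar (a : A) : φ (star a) = starRingEnd ℂ (φ a) := by
    refine hφeq ?_
    have := congrArg star (hφ a)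
    rw [star_mul, star_mul, hps.star_eq, star_smul, hps.star_eq, ← mul_assoc] at this
    exact this
  have hpn : ‖p‖ = 1 := by
    have h1 : ‖p‖ * ‖p‖ = ‖p‖ := by
      rw [← CStarRing.norm_star_mul_self, hps.star_eq, hpp]
    exact mul_left_cancel₀ (norm_ne_zero_iff.2 hp0) (by rw [h1, mul_one])
  have hppos : 0 ≤ p := by
    have := star_mul_self_nonneg p
    rwa [hps.star_eq, hpp] at this
  let H : Submodule ℂ A :=
    { carrier := {x | x * p = x}
      add_mem' := fun {x y} hx hy => by
        rw [mem_ofPred_eq] at *; rw [add_mul, hx, hy]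
      zero_mem' := zero_mul p
      smul_mem' := fun c x hx => by rw [mem_ofPred_eq] at *; rw [smul_mul_assoc, hx] }
  have hH (x : H) : (x : A) * p = x := x.2
  have hH' (x : H) : p * star (x : A) = star (x : A) := by
    have := congrArg star (hH x)
    rwa [star_mul, hps.star_eq] at this
  have hsp (x y : H) : star (x : A) * y = φ (star (x : A) * y) • p := by
    rw [← hφ, ← mul_assoc, hH', mul_assoc, hH]
  have hclosed : IsClosed (H : Set A) :=
    isClosed_eq (continuous_id.mul continuous_const) continuous_id
  let : InnerProductSpace ℂ H :=
    { inner := fun x y => φ (star (x : A) * y)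
      norm_sq_eq_re_inner := fun x => by
        change ‖(x : A)‖ ^ 2 = (φ (star (x : A) * x)).re
        have h1 : (φ (star (x : A) * x)).im = 0 := by
          have := hφstar (star (x : A) * x)
          rw [star_mul, star_star] at this
          exact Complex.conj_eq_iff_im.1 this.symm
        have h2 : φ (star (x : A) * x) = ((φ (star (x : A) * x)).re : ℂ) :=
          Complex.ext rfl (by simpa using h1)
        have h3 : ‖(x : A)‖ ^ 2 = |(φ (star (x : A) * x)).re| := by
          rw [sq, ← CStarRing.norm_star_mul_self]
          nth_rw 1 [hsp, h2]
          rw [norm_smul, hpn, mul_one, Complex.norm_real, Real.norm_eq_abs]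
        rw [h3]
        refine abs_of_nonneg ?_
        by_contra! hneg
        have h4 := star_mul_self_nonneg (x : A)
        rw [hsp, h2, Complex.coe_smul] at h4
        have h5 : 0 ≤ (-(φ (star (x : A) * x)).re) • p := smul_nonneg (by linarith) hppos
        rw [neg_smul, neg_nonneg] at h5
        have h6 := le_antisymm h5 h4
        rw [smul_eq_zero, or_iff_left hp0] at h6
        linarith
      conj_inner_symm := fun x y => by
        change starRingEnd ℂ (φ _) = φ _
        rw [← hφstar, star_mul, star_star]
      add_left := fun x y z => by
        change φ _ = φ _ + φ _
        rw [← hφadd, ← add_mul, ← star_add]; rfl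
      smul_left := fun x y r => by
        change φ _ = _ * φ _
        rw [← hφsmul, ← smul_mul_assoc]
        congr 2
        exact star_smul r (x : A) }
  have : CompleteSpace H := hclosed.completeSpace_coe
  have hinner (x y : H) : inner ℂ x y = φ (star (x : A) * y) := rfl
  -- the representation by left multiplication
  let L (a : A) : H →L[ℂ] H := LinearMap.mkContinuous
    { toFun := fun x => ⟨a * x, by change a * x * p = a * x; rw [mul_assoc, hH]⟩
      map_add' := fun x y => Subtype.ext (mul_add a (x : A) y)
      map_smul' := fun c x => Subtype.ext (mul_smul_comm c a (x : A)) } ‖a‖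
    fun x => norm_mul_le a (x : A)
  have hL (a : A) (x : H) : ((L a x : H) : A) = a * x := rfl
  let π : A →⋆ₙₐ[ℂ] (H →L[ℂ] H) :=
    { toFun := L
      map_smul' := fun c a => by ext x; exact smul_mul_assoc c a (x : A)
      map_zero' := by ext x; exact zero_mul (x : A)
      map_add' := fun a b => by ext x; exact add_mul a b (x : A)
      map_mul' := fun a b => by ext x; exact mul_assoc a b (x : A)
      map_star' := fun a => by
        rw [ContinuousLinearMap.star_eq_adjoint, ContinuousLinearMap.eq_adjoint_iff]
        intro x y
        rw [hinner, hinner, hL, hL, star_mul, star_star, mul_assoc] }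
  have hπ (a : A) (x : H) : ((π a x : H) : A) = a * x := rfl
  have hπinj : Function.Injective π := by
    rcases eq_bot_or_eq_top (TwoSidedIdeal.ker π) with h | h
    · exact (TwoSidedIdeal.ker_eq_bot π).1 h
    · exfalso
      have h1 : p ∈ TwoSidedIdeal.ker π := h ▸ trivial
      rw [TwoSidedIdeal.mem_ker] at h1
      have h2 : ((π p ⟨p, hpp⟩ : H) : A) = 0 := by rw [h1]; rfl
      rw [hπ] at h2
      exact hp0 (hpp ▸ h2)
  -- orthonormal families give orthogonal families of projections
  have hfam {ι : Type u} (v : ι → H) (hv : Orthonormal ℂ v) : Finite ι := by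
    by_contra hinf
    rw [not_finite_iff_infinite] at hinf
    obtain ⟨f⟩ : Nonempty (Fin N ↪ ι) := ⟨(Fin.valEmbedding).trans (Infinite.natEmbedding ι)⟩
    have hsp1 (i : ι) : star (v i : A) * v i = p := by
      have : inner ℂ (v i) (v i) = (1 : ℂ) := by
        rw [inner_self_eq_norm_sq_to_K, hv.1]; simp
      rw [hsp, ← hinner, this, one_smul]
    refine hN ⟨fun i => (v (f i) : A) * star (v (f i) : A), fun i => ⟨mul_star_self_nonneg _, ?_⟩, ?_⟩
    · intro h0
      rw [CStarRing.mul_star_self_eq_zero_iff] at h0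
      have := hsp1 (f i)
      rw [h0, mul_zero] at this
      exact hp0 this.symm
    · intro i j hij
      have : inner ℂ (v (f i)) (v (f j)) = (0 : ℂ) := hv.2 fun h => hij (f.injective h)
      calc _ = (v (f i) : A) * (star (v (f i) : A) * v (f j)) * star (v (f j) : A) := by
            simp only [mul_assoc]
        _ = 0 := by rw [hsp, ← hinner, this, zero_smul, mul_zero, zero_mul]
  obtain ⟨w, b, hb⟩ := exists_hilbertBasis ℂ H
  have := hfam b b.orthonormal
  have := Fintype.ofFinite w
  let e := b.toOrthonormalBasis
  have : FiniteDimensional ℂ H := e.toBasis.finiteDimensional_of_finite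
  have hprop : ProperSpace H := FiniteDimensional.proper ℂ H
  have hlc : LocallyCompactSpace H := @locallyCompact_of_proper H _ hprop
  refine ⟨H, inferInstance, inferInstance, inferInstance, π, hπinj, ?_⟩
  refine Subset.antisymm ?_ fun T _ => ?_
  · rintro _ ⟨a, rfl⟩
    exact isCompactOperator_of_locallyCompactSpace_dom (π a)
  · refine ⟨∑ i, (T (e i) : A) * star (e i : A), ?_⟩
    ext x
    rw [hπ, Finset.sum_mul]
    have h1 : T x = ∑ i, (e.repr x i) • T (e i) := by
      nth_rw 1 [← e.sum_repr x]
      simp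
    rw [h1, Submodule.coe_sum]
    refine Finset.sum_congr rfl fun i _ => ?_
    rw [mul_assoc, hsp, ← hinner, mul_smul_comm, hH, ← e.repr_apply_apply]
    rfl

/-- A simple nonelementary algebra has orthogonal families of every finite size. -/
lemma hasOrthFamily (hsimple : IsSimpleRing A) (helem : ¬ IsElementary A) (n : ℕ) :
    HasOrthFamily A n := by
  classical
  by_contra hn
  have hex : ∃ n, ¬ HasOrthFamily A n := ⟨n, hn⟩
  have h0 : HasOrthFamily A 0 := ⟨Fin.elim0, fun i => i.elim0, fun i => i.elim0⟩
  have h1 : HasOrthFamily A 1 := by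
    obtain ⟨x, hx⟩ : ∃ x : A, x ≠ 0 := by
      by_contra! h
      refine bot_ne_top (α := TwoSidedIdeal A) (le_antisymm bot_le fun x _ => ?_)
      rw [h x]; exact zero_mem _
    refine ⟨fun _ => star x * x, fun _ => ⟨star_mul_self_nonneg x, ?_⟩, fun i j hij => ?_⟩
    · rwa [Ne, CStarRing.star_mul_self_eq_zero_iff]
    · exact (hij (Subsingleton.elim i j)).elim
  obtain ⟨m, hm⟩ : ∃ m, Nat.find hex = m + 1 :=
    Nat.exists_eq_succ_of_ne_zero fun h => Nat.find_spec hex (h ▸ h0)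
  have hm1 : ¬ HasOrthFamily A (m + 1) := hm ▸ Nat.find_spec hex
  have hm2 : HasOrthFamily A m := not_not.1 (Nat.find_min hex (by omega))
  have hm0 : 0 < m := Nat.pos_of_ne_zero fun h => hm1 (by rwa [h])
  obtain ⟨p, hp⟩ := exists_isMinimalProj hm1 hm2 hm0
  exact helem (isElementary_of_isMinimalProj hsimple hp hm1)

end MinimalProjection

/-! ### Uniform bounds for ranks in simple algebras -/

section SimpleAlgebra

variable {A : Type u} [NonUnitalCStarAlgebra A]

lemma exists_nonneg_ne_zero [PartialOrder A] [StarOrderedRing A] (hsimple : IsSimpleRing A) :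
    ∃ a : A, 0 ≤ a ∧ a ≠ 0 := by
  obtain ⟨x, hx⟩ : ∃ x : A, x ≠ 0 := by
    by_contra! h
    refine bot_ne_top (α := TwoSidedIdeal A) (le_antisymm bot_le fun x _ => ?_)
    rw [h x]; exact zero_mem _
  exact ⟨star x * x, star_mul_self_nonneg x, by rwa [Ne, CStarRing.star_mul_self_eq_zero_iff]⟩

lemma eq_top_of_mem_of_ne_zero (hsimple : IsSimpleRing A) {J : TwoSidedIdeal A} {x : A} (hx : x ∈ J)
    (h0 : x ≠ 0) : J = ⊤ :=
  (eq_bot_or_eq_top J).resolve_left fun h => h0 ((TwoSidedIdeal.mem_bot A).1 (h ▸ hx))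

lemma mul_self_ne_zero_of_isSelfAdjoint {x : A} (hx : IsSelfAdjoint x) (h0 : x ≠ 0) :
    x * x ≠ 0 := by
  nth_rw 1 [← hx.star_eq]
  rwa [Ne, CStarRing.star_mul_self_eq_zero_iff]

lemma mul_mul_self_ne_zero {x : A} (hx : IsSelfAdjoint x) (h0 : x ≠ 0) : x * x * x ≠ 0 := by
  intro h
  refine mul_self_ne_zero_of_isSelfAdjoint (x := x * x) ?_
    (mul_self_ne_zero_of_isSelfAdjoint hx h0) ?_
  · nth_rw 1 [← hx.star_eq]; exact IsSelfAdjoint.star_mul_self x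
  · rw [← mul_assoc, h, zero_mul]

lemma pedersenIdeal_eq_top (hsimple : IsSimpleRing A) : pedersenIdeal A = ⊤ := by
  refine le_antisymm le_top fun x _ => (TwoSidedIdeal.mem_sInf _).2 fun J hJ => ?_
  rcases eq_bot_or_eq_top J with rfl | rfl
  · have : closure ({0} : Set A) = univ := by
      have := hJ.closure_eq
      rwa [TwoSidedIdeal.coe_bot] at this
    rw [closure_singleton] at this
    have : x ∈ ({0} : Set A) := this ▸ mem_univ x
    exact this
  · trivial

/-- A simple C⋆-algebra is prime. -/
lemma exists_mul_mul_ne_zero (hsimple : IsSimpleRing A) {f x : A} (hf : IsSelfAdjoint f)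
    (hf0 : f ≠ 0) (hx : x ≠ 0) : ∃ a, f * a * x ≠ 0 := by
  by_contra! h
  let J : TwoSidedIdeal A := TwoSidedIdeal.mk' {y | ∀ a, f * a * y = 0} (fun a => mul_zero _)
    (fun hx hy a => by rw [mul_add, hx, hy, add_zero]) (fun hx a => by rw [mul_neg, hx, neg_zero])
    (fun {b y} hy a => by rw [← mul_assoc, mul_assoc f a b]; exact hy _)
    (fun {y b} hy a => by rw [← mul_assoc, hy, zero_mul])
  have hJ : x ∈ J := (TwoSidedIdeal.mem_mk' ..).2 h
  have : f ∈ J := eq_top_of_mem_of_ne_zero hsimple hJ hx ▸ trivial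
  exact mul_mul_self_ne_zero hf hf0 ((TwoSidedIdeal.mem_mk' ..).1 this f)

variable [PartialOrder A] [StarOrderedRing A]

/-- A quasitrace whose rank function is subadditive. -/
def IsSubadditive (τ : A → ℂ) : Prop :=
  IsQuasitrace τ ∧ ∀ a b : A, 0 ≤ a → 0 ≤ b → rk τ (a + b) ≤ rk τ a + rk τ b

/-- The parallelogram inequality `(x + y)⋆(x + y) ≤ 2 (x⋆x + y⋆y)`. -/
lemma star_add_mul_add_le (x y : A) :
    star (x + y) * (x + y) ≤ (2 : ℝ) • (star x * x + star y * y) := by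
  rw [← sub_nonneg]
  convert star_mul_self_nonneg (x - y) using 1
  rw [star_add, star_sub, two_smul]
  noncomm_ring

lemma star_mul_mul_le (b x : A) :
    star (b * x) * (b * x) ≤ (‖b‖ ^ 2 + 1) • (star x * x) := by
  have h := CStarAlgebra.star_left_conjugate_le_norm_smul (a := x) (b := star b * b)
    (IsSelfAdjoint.star_mul_self b)
  rw [CStarRing.norm_star_mul_self, ← sq] at h
  rw [star_mul, add_smul, one_smul, mul_assoc, ← mul_assoc (star b), ← mul_assoc]
  refine h.trans ?_
  exact le_add_of_nonneg_right (star_mul_self_nonneg x)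

/-- In a simple C⋆-algebra, every rank is at most a multiple of the rank of a given nonzero
element, uniformly in the quasitrace. -/
lemma exists_rk_star_mul_self_le (hsimple : IsSimpleRing A) {e : A} (he : 0 ≤ e) (he0 : e ≠ 0)
    (x : A) : ∃ K : ℕ, ∀ τ : A → ℂ, IsSubadditive τ → rk τ (star x * x) ≤ K * rk τ e := by
  -- Algebraic simplicity puts `x` in the ideal generated by `e` without taking a closure, so
  -- finitely many operations build it and the constant does not depend on `τ`.
  have hx : x ∈ TwoSidedIdeal.span {e} :=
    eq_top_of_mem_of_ne_zero hsimple (TwoSidedIdeal.subset_span (mem_singleton e)) he0 ▸ trivial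
  induction hx using TwoSidedIdeal.span_induction with
  | mem x h =>
    obtain rfl : x = e := h
    refine ⟨1, fun τ hτ => ?_⟩
    rw [Nat.cast_one, one_mul]
    obtain ⟨s, hs, hs0, rfl⟩ := exists_star_mul_self he
    refine le_trans (le_of_eq ?_) (rk_conj_le hτ.1 (b := s * s) he s)
    rw [hs.star_eq, (he.isSelfAdjoint).star_eq]
    simp only [mul_assoc]
  | zero => exact ⟨0, fun τ hτ => by rw [mul_zero, rk_zero hτ.1]; simp⟩
  | add x y hx hy h1 h2 =>
    obtain ⟨K, hK⟩ := h1
    obtain ⟨L, hL⟩ := h2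
    refine ⟨K + L, fun τ hτ => ?_⟩
    calc _ ≤ rk τ (star x * x + star y * y) :=
          rk_le_of_le_smul hτ.1 (star_mul_self_nonneg _)
            (add_nonneg (star_mul_self_nonneg x) (star_mul_self_nonneg y)) two_pos
            (star_add_mul_add_le x y)
      _ ≤ _ := hτ.2 _ _ (star_mul_self_nonneg x) (star_mul_self_nonneg y)
      _ ≤ _ := by
        rw [Nat.cast_add, add_mul]
        exact add_le_add (hK τ hτ) (hL τ hτ)
  | neg x hx h => simpa using h
  | left_absorb b x hx h =>
    obtain ⟨K, hK⟩ := h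
    refine ⟨K, fun τ hτ => le_trans ?_ (hK τ hτ)⟩
    exact rk_le_of_le_smul hτ.1 (star_mul_self_nonneg _) (star_mul_self_nonneg x) (by positivity)
      (star_mul_mul_le b x)
  | right_absorb b x hx h =>
    obtain ⟨K, hK⟩ := h
    refine ⟨K, fun τ hτ => le_trans (le_of_eq ?_) ((rk_conj_le hτ.1 (star_mul_self_nonneg x) b).trans
      (hK τ hτ))⟩
    rw [star_mul]; simp only [mul_assoc]

lemma rk_smul {τ : A → ℂ} (hτ : IsQuasitrace τ) {a : A} (ha : 0 ≤ a) {r : ℝ} (hr : 0 < r) :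
    rk τ (r • a) = rk τ a := by
  refine le_antisymm (rk_le_of_le_smul hτ (smul_nonneg hr.le ha) ha hr le_rfl) ?_
  refine rk_le_of_le_smul hτ ha (smul_nonneg hr.le ha) (inv_pos.2 hr) ?_
  rw [smul_smul, inv_mul_cancel₀ hr.ne', one_smul]

/-- Uniform boundedness. If each `K` failed at some `τ_K` and `a_K`, the sum of suitably scaled
`a_n` would dominate a multiple of every one of them, and the constant already known for that single
element would be contradicted. -/
lemma exists_rk_le_nat_mul (hsimple : IsSimpleRing A) {e : A} (he : 0 ≤ e) (he0 : e ≠ 0) :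
    ∃ K : ℕ, ∀ τ : A → ℂ, IsSubadditive τ → ∀ a, 0 ≤ a → rk τ a ≤ K * rk τ e := by
  by_contra! h
  choose τ hτ a ha hlt using h
  set b : ℕ → A := fun n => ((1 / 2 : ℝ) ^ n * (‖a n‖ + 1)⁻¹) • a n with hb
  have hpos (n : ℕ) : 0 < (1 / 2 : ℝ) ^ n * (‖a n‖ + 1)⁻¹ := by positivity
  have hb0 (n : ℕ) : 0 ≤ b n := smul_nonneg (hpos n).le (ha n)
  have hsum : Summable b := by
    refine Summable.of_norm_bounded summable_geometric_two fun n => ?_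
    rw [hb, norm_smul, Real.norm_of_nonneg (hpos n).le, mul_assoc]
    refine mul_le_of_le_one_right (by positivity) ?_
    rw [inv_mul_le_one₀ (by positivity)]
    linarith
  obtain ⟨s, hs, -, hs2⟩ := exists_star_mul_self (tsum_nonneg hb0)
  obtain ⟨K, hK⟩ := exists_rk_star_mul_self_le hsimple he he0 s
  refine absurd (hK (τ K) (hτ K)) (not_le.2 ?_)
  rw [hs.star_eq, hs2]
  calc _ < rk (τ K) (a K) := hlt K
    _ = rk (τ K) (b K) := (rk_smul (hτ K).1 (ha K) (hpos K)).symm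
    _ ≤ _ := rk_mono (hτ K).1 (hb0 K) (hsum.le_tsum K fun n _ => hb0 n)

/-- Supplies elements of finite rank: every function `f_δ(f_ε(x))` is at most `f_{ε/2}(x)`. -/
lemma rk_cutoff_le {τ : A → ℂ} (hτ : IsQuasitrace τ) {a : A} (ha : 0 ≤ a) {ε : ℝ} (hε : 0 < ε) :
    rk τ (cfcₙ (cutoff ε) a) ≤ ENNReal.ofReal (τ (cfcₙ (cutoff (ε / 2)) a)).re := by
  refine iSup₂_le fun δ hδ => ENNReal.ofReal_le_ofReal ?_
  rw [← cfcₙ_comp' (cutoff δ) (cutoff ε) a (by fun_prop) (by simp) (by fun_prop) (by simp)]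
  refine hτ.mono_cfcₙ ha (by fun_prop) (by fun_prop) (δ := ε / 4) (by positivity) ?_ ?_ ?_
  · intro x hx
    rw [cutoff_eq_zero hε (by linarith), cutoff_zero]
  · exact fun x hx => cutoff_eq_zero (by positivity) (by linarith)
  · intro x hx
    rcases le_total x (ε / 2) with h | h
    · rw [cutoff_eq_zero hε h, cutoff_zero]; exact cutoff_nonneg _ _
    · rw [cutoff_eq_one (by positivity) h]; exact cutoff_le_one _ _

lemma exists_cutoff_ne_zero {a : A} (ha : 0 ≤ a) (h0 : a ≠ 0) :
    ∃ ε > 0, cfcₙ (cutoff ε) a ≠ 0 := by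
  by_contra! h
  have h1 (ε : ℝ) (hε : 0 < ε) : ‖a‖ ≤ ε := by
    have h2 : cfcₙ (ramp ε) a = 0 := by
      rw [← cfcₙ_congr (f := fun x => cutoff ε x * ramp ε x) (fun x hx => ?_),
        cfcₙ_mul _ _ a (by fun_prop) (by simp) (by fun_prop) (ramp_zero hε.le), h ε hε, zero_mul]
      rcases le_total ε x with h | h
      · simp [cutoff_eq_one hε h]
      · simp [ramp, h]
    have := norm_sub_ramp_le ha hε.le
    rwa [h2, sub_zero] at this
  exact h0 (norm_le_zero_iff.1 (le_of_forall_gt_imp_ge_of_dense fun ε hε => h1 ε hε))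

/-- On a simple C⋆-algebra, a quasitrace with subadditive rank is bounded. -/
lemma IsSubadditive.exists_bound (hsimple : IsSimpleRing A) {τ : A → ℂ} (hτ : IsSubadditive τ) :
    ∃ C : ℝ, ∀ a, 0 ≤ a → (τ a).re ≤ ‖a‖ * C := by
  obtain ⟨a, ha, ha0⟩ := exists_nonneg_ne_zero hsimple
  obtain ⟨ε, hε, he0⟩ := exists_cutoff_ne_zero ha ha0
  obtain ⟨K, hK⟩ := exists_rk_le_nat_mul hsimple (cfcₙ_cutoff_nonneg ε a) he0
  have hfin : (K : ℝ≥0∞) * rk τ (cfcₙ (cutoff ε) a) ≠ ⊤ :=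
    ENNReal.mul_ne_top (by simp) ((rk_cutoff_le hτ.1 ha hε).trans_lt ENNReal.ofReal_lt_top).ne
  refine ⟨(K * rk τ (cfcₙ (cutoff ε) a)).toReal, fun b hb => ?_⟩
  have h1 := (re_le_norm_mul_rk hτ.1 hb fun g _ => pedersenIdeal_eq_top hsimple ▸ trivial).trans
    (mul_le_mul_right (hK τ hτ b hb) (ENNReal.ofReal ‖b‖))
  rw [← ENNReal.ofReal_toReal hfin, ← ENNReal.ofReal_mul (norm_nonneg b)] at h1
  exact (ENNReal.ofReal_le_ofReal_iff (by positivity)).1 h1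

/-- Finitely many nonzero positive elements of a simple C⋆-algebra dominate a common nonzero
element in rank. -/
lemma exists_rk_le_forall (hsimple : IsSimpleRing A) {n : ℕ} (x : Fin n → A)
    (hx : ∀ i, 0 ≤ x i ∧ x i ≠ 0) :
    ∃ e : A, 0 ≤ e ∧ e ≠ 0 ∧ ∀ τ : A → ℂ, IsQuasitrace τ → ∀ i, rk τ e ≤ rk τ (x i) := by
  induction n with
  | zero =>
    obtain ⟨a, ha, ha0⟩ := exists_nonneg_ne_zero hsimple
    exact ⟨a, ha, ha0, fun τ _ i => i.elim0⟩
  | succ n ih =>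
    obtain ⟨e, he, he0, h⟩ := ih (fun i => x i.castSucc) fun i => hx _
    obtain ⟨s, hs, -, hs2⟩ := exists_star_mul_self (hx (Fin.last n)).1
    have hs0 : s ≠ 0 := by
      rintro rfl
      exact (hx (Fin.last n)).2 (by rw [← hs2, zero_mul])
    obtain ⟨t, ht, -, ht2⟩ := exists_star_mul_self he
    have ht0 : t ≠ 0 := by
      rintro rfl
      exact he0 (by rw [← ht2, zero_mul])
    -- For `z = t a s`, the element `z*z` is a conjugate of `e = t²`, while `zz*` is a conjugate of
    -- the last `x i`, equal to `s²`. Its rank is thus below both.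
    obtain ⟨a, hy⟩ := exists_mul_mul_ne_zero hsimple ht ht0 hs0
    have hy1 : star (t * a * s) * (t * a * s) = star (a * s) * e * (a * s) := by
      rw [← ht2]; simp only [star_mul, ht.star_eq, mul_assoc]
    have hy2 : (t * a * s) * star (t * a * s) = star (star a * t) * x (Fin.last n) * (star a * t) := by
      rw [← hs2]; simp only [star_mul, hs.star_eq, ht.star_eq, star_star, mul_assoc]
    refine ⟨star (t * a * s) * (t * a * s), star_mul_self_nonneg _, ?_, fun τ hτ i => ?_⟩
    · rwa [Ne, CStarRing.star_mul_self_eq_zero_iff]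
    · refine i.lastCases ?_ fun j => ?_
      · rw [rk_star_mul_self hτ, hy2]
        exact rk_conj_le hτ (hx _).1 _
      · rw [hy1]
        exact (rk_conj_le hτ he _).trans (h τ hτ j)

lemma sum_rk_le_rk_sum {τ : A → ℂ} (hτ : IsQuasitrace τ) {n : ℕ} (x : Fin n → A)
    (hx : ∀ i, 0 ≤ x i) (horth : ∀ i j, i ≠ j → x i * x j = 0) :
    ∑ i, rk τ (x i) ≤ rk τ (∑ i, x i) := by
  induction n with
  | zero => simp
  | succ n ih =>
    rw [Fin.sum_univ_castSucc, Fin.sum_univ_castSucc]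
    refine le_trans (add_le_add_left (ih (fun i => x i.castSucc) (fun i => hx _)
      fun i j hij => horth _ _ (by simpa using hij)) _) (rk_add_rk_le hτ
        (Finset.sum_nonneg fun i _ => hx _) (hx _) ?_)
    rw [Finset.sum_mul]
    exact Finset.sum_eq_zero fun i _ => horth _ _ (Fin.castSucc_lt_last i).ne

/-- A simple nonelementary C⋆-algebra has nonzero elements of uniformly small rank. -/
lemma exists_mul_rk_le (hsimple : IsSimpleRing A) (helem : ¬ IsElementary A) (n : ℕ) :
    ∃ e : A, 0 ≤ e ∧ e ≠ 0 ∧ ∀ τ : A → ℂ, IsQuasitrace τ → ∃ b, 0 ≤ b ∧ n * rk τ e ≤ rk τ b := by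
  obtain ⟨x, hx, horth⟩ := hasOrthFamily hsimple helem n
  obtain ⟨e, he, he0, h⟩ := exists_rk_le_forall hsimple x hx
  refine ⟨e, he, he0, fun τ hτ => ⟨∑ i, x i, Finset.sum_nonneg fun i _ => (hx i).1, ?_⟩⟩
  refine le_trans ?_ (sum_rk_le_rk_sum hτ x (fun i => (hx i).1) horth)
  calc (n : ℝ≥0∞) * rk τ e = ∑ _i : Fin n, rk τ e := by simp
    _ ≤ _ := Finset.sum_le_sum fun i _ => h τ hτ i

end SimpleAlgebra

/-! ### Matrix units, the first row and the corner of the stabilization -/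

section StabStructure

variable {A : Type u} [NonUnitalCStarAlgebra A] [PartialOrder A] [StarOrderedRing A]

lemma univRep_add (a b : A) : univRep (a + b) = univRep a + univRep b := by
  ext1 x
  apply lp.ext; funext f
  simp [map_add]

lemma univRep_smul (c : ℂ) (a : A) : univRep (c • a) = c • univRep a := by
  ext1 x
  apply lp.ext; funext f
  simp [map_smul]

lemma elemTensor_add (a b : A) (i j : ℕ) :
    elemTensor (a + b) i j = elemTensor a i j + elemTensor b i j := by
  rw [elemTensor, univRep_add, ContinuousLinearMap.add_comp, ContinuousLinearMap.comp_add]; rfl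

lemma elemTensor_smul (c : ℂ) (a : A) (i j : ℕ) :
    elemTensor (c • a) i j = c • elemTensor a i j := by
  ext1 x
  rw [smul_apply, elemTensor_apply, elemTensor_apply, univRep_smul]
  exact map_smul (lp.singleContinuousLinearMap ℂ (fun _ : ℕ => UnivSpace A) 2 i) c
    (univRep a (x j))

lemma elemTensor_mul_of_ne (a b : A) (i l : ℕ) {j k : ℕ} (h : j ≠ k) :
    elemTensor a i j * elemTensor b k l = 0 := by
  ext1 x
  rw [mul_apply_eq_comp, elemTensor_apply, elemTensor_apply, lp.single_apply_ne _ _ _ h, map_zero]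
  simp

/-- The element `a ⊗ e_{i,j}` of `A ⊗ 𝒦`. -/
def el (a : A) (i j : ℕ) : Stab A :=
  ⟨elemTensor a i j, NonUnitalStarSubalgebra.le_topologicalClosure _
    (NonUnitalStarAlgebra.subset_adjoin ℂ _ ⟨a, i, j, rfl⟩)⟩

lemma el_mul (a b : A) (i j k : ℕ) : el a i j * el b j k = el (a * b) i k :=
  Subtype.ext (elemTensor_mul a b i j k)

lemma el_mul_of_ne (a b : A) (i l : ℕ) {j k : ℕ} (h : j ≠ k) : el a i j * el b k l = 0 :=
  Subtype.ext (elemTensor_mul_of_ne a b i l h)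

lemma star_el (a : A) (i j : ℕ) : star (el a i j) = el (star a) j i :=
  Subtype.ext (star_elemTensor a i j)

lemma el_add (a b : A) (i j : ℕ) : el (a + b) i j = el a i j + el b i j :=
  Subtype.ext (elemTensor_add a b i j)

lemma el_smul (c : ℂ) (a : A) (i j : ℕ) : el (c • a) i j = c • el a i j :=
  Subtype.ext (elemTensor_smul c a i j)

lemma el_zero (i j : ℕ) : el (0 : A) i j = 0 := by
  have := el_smul 0 (0 : A) i j
  rwa [zero_smul, zero_smul] at this

/-- The embedding `a ↦ a ⊗ e_{i,i}` as a ⋆-homomorphism. -/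
def elHom (i : ℕ) : A →⋆ₙₐ[ℂ] Stab A where
  toFun a := el a i i
  map_smul' c a := el_smul c a i i
  map_zero' := el_zero i i
  map_add' a b := el_add a b i i
  map_mul' a b := (el_mul a b i i i).symm
  map_star' a := (star_el a i i).symm

/-- The embedding `a ↦ a ⊗ e_{0,0}` as a ⋆-homomorphism. -/
def cornerHom : A →⋆ₙₐ[ℂ] Stab A := elHom 0

lemma cornerHom_apply (a : A) : cornerHom a = corner a := rfl

lemma corner_zero : corner (0 : A) = 0 := map_zero cornerHom

lemma corner_add (a b : A) : corner (a + b) = corner a + corner b := map_add cornerHom a b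

lemma corner_nonneg {a : A} (ha : 0 ≤ a) : 0 ≤ corner a := by
  obtain ⟨s, hs, -, rfl⟩ := exists_star_mul_self ha
  have := star_mul_self_nonneg (corner s)
  rwa [← corner_star, ← corner_mul, hs.star_eq] at this

lemma corner_cfcₙ (f : ℝ → ℝ) (hf : Continuous f) (hf0 : f 0 = 0) {a : A} (ha : IsSelfAdjoint a) :
    corner (cfcₙ f a) = cfcₙ f (corner a) := by
  have h1 : Continuous (cornerHom : A →⋆ₙₐ[ℂ] Stab A) := map_continuous _
  exact NonUnitalStarAlgHom.map_cfcₙ cornerHom f a hf.continuousOn hf0 h1 ha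
    (by rw [isSelfAdjoint_iff, ← map_star, ha.star_eq])

/-- The linear span of the elementary tensors is already closed under products and adjoints, so it
is the generated ⋆-algebra. -/
lemma stab_mem_closure_span (x : Stab A) :
    x ∈ closure ((Submodule.span ℂ {T | ∃ (a : A) (i j : ℕ), T = el a i j} :
      Submodule ℂ (Stab A)) : Set (Stab A)) := by
  set S := Submodule.span ℂ {T | ∃ (a : A) (i j : ℕ), T = el a i j} with hS
  have hmem (a : A) (i j : ℕ) : el a i j ∈ S := Submodule.subset_span ⟨a, i, j, rfl⟩
  have hmul (x y : Stab A) (hx : x ∈ S) (hy : y ∈ S) : x * y ∈ S := by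
    refine Submodule.span_induction ?_ (by simp) (fun a b _ _ h h' => ?_) (fun c a _ h => ?_) hx
    · rintro _ ⟨a, i, j, rfl⟩
      refine Submodule.span_induction ?_ (by simp) (fun a b _ _ h h' => ?_) (fun c a _ h => ?_) hy
      · rintro _ ⟨b, k, l, rfl⟩
        rcases eq_or_ne j k with rfl | h
        · rw [el_mul]; exact hmem _ _ _
        · rw [el_mul_of_ne _ _ _ _ h]; exact zero_mem _
      · rw [mul_add]; exact add_mem h h'
      · rw [mul_smul_comm]; exact S.smul_mem c h
    · rw [add_mul]; exact add_mem h h'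
    · rw [smul_mul_assoc]; exact S.smul_mem c h
  have hstar (x : Stab A) (hx : x ∈ S) : star x ∈ S := by
    refine Submodule.span_induction ?_ (by simp) (fun a b _ _ h h' => ?_) (fun c a _ h => ?_) hx
    · rintro _ ⟨a, i, j, rfl⟩
      rw [star_el]; exact hmem _ _ _
    · rw [star_add]; exact add_mem h h'
    · rw [star_smul]; exact S.smul_mem _ h
  have hadj : ∀ T ∈ NonUnitalStarAlgebra.adjoin ℂ
      {T : StabSpace A →L[ℂ] StabSpace A | ∃ (a : A) (i j : ℕ), T = elemTensor a i j},
      ∃ y ∈ S, (y : Stab A).1 = T := by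
    intro T hT
    induction hT using NonUnitalStarAlgebra.adjoin_induction with
    | mem T h => obtain ⟨a, i, j, rfl⟩ := h; exact ⟨_, hmem a i j, rfl⟩
    | add x y _ _ h h' =>
      obtain ⟨x, hx, rfl⟩ := h
      obtain ⟨y, hy, rfl⟩ := h'
      exact ⟨x + y, add_mem hx hy, rfl⟩
    | zero => exact ⟨0, zero_mem _, rfl⟩
    | mul x y _ _ h h' =>
      obtain ⟨x, hx, rfl⟩ := h
      obtain ⟨y, hy, rfl⟩ := h'
      exact ⟨x * y, hmul x y hx hy, rfl⟩
    | smul r x _ h =>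
      obtain ⟨x, hx, rfl⟩ := h
      exact ⟨r • x, S.smul_mem r hx, rfl⟩
    | star x _ h =>
      obtain ⟨x, hx, rfl⟩ := h
      exact ⟨star x, hstar x hx, rfl⟩
  have hx : x.1 ∈ closure ((NonUnitalStarAlgebra.adjoin ℂ
      {T : StabSpace A →L[ℂ] StabSpace A | ∃ (a : A) (i j : ℕ), T = elemTensor a i j} :
      NonUnitalStarSubalgebra ℂ _) : Set (StabSpace A →L[ℂ] StabSpace A)) := x.2
  refine Metric.mem_closure_iff.2 fun ε hε => ?_
  obtain ⟨T, hT, hd⟩ := Metric.mem_closure_iff.1 hx ε hε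
  obtain ⟨y, hy, rfl⟩ := hadj T hT
  exact ⟨y, hy, hd⟩

/-- A closed subspace that contains the elementary tensors is everything. -/
lemma stab_induction {P : Stab A → Prop} (hcl : IsClosed {x | P x}) (h0 : P 0)
    (hadd : ∀ x y, P x → P y → P (x + y)) (hsmul : ∀ (r : ℂ) x, P x → P (r • x))
    (hel : ∀ a i j, P (el a i j)) (x : Stab A) : P x := by
  refine closure_minimal (fun y hy => ?_) hcl (stab_mem_closure_span x)
  refine Submodule.span_induction ?_ h0 (fun a b _ _ => hadd a b) (fun c a _ => hsmul c a) hy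
  rintro _ ⟨a, i, j, rfl⟩
  exact hel a i j

/-- The projection of `H ⊗ ℓ²(ℕ)` onto the first coordinate. -/
def firstProj (A : Type u) [NonUnitalCStarAlgebra A] [PartialOrder A] [StarOrderedRing A] :
    StabSpace A →L[ℂ] StabSpace A :=
  (lp.singleContinuousLinearMap ℂ (fun _ : ℕ => UnivSpace A) 2 0).comp
    (lp.evalCLM ℂ (fun _ : ℕ => UnivSpace A) 2 0)

lemma firstProj_apply (x : StabSpace A) : firstProj A x = lp.single 2 0 (x 0) := rfl

lemma firstProj_mul_elemTensor (a : A) (j : ℕ) :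
    firstProj A * elemTensor a 0 j = elemTensor a 0 j := by
  ext1 x
  rw [mul_apply_eq_comp, firstProj_apply, elemTensor_apply, lp.single_apply_self]

lemma firstProj_mul_elemTensor_of_ne (a : A) {i : ℕ} (hi : i ≠ 0) (j : ℕ) :
    firstProj A * elemTensor a i j = 0 := by
  ext1 x
  rw [mul_apply_eq_comp, firstProj_apply, elemTensor_apply, lp.single_apply_ne _ _ _ hi.symm]
  simp

lemma star_firstProj : star (firstProj A) = firstProj A := by
  rw [ContinuousLinearMap.star_eq_adjoint, eq_comm, ContinuousLinearMap.eq_adjoint_iff]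
  intro x y
  rw [firstProj_apply, firstProj_apply, lp.inner_single_left, lp.inner_single_right]

lemma elemTensor_mul_firstProj (a : A) (i : ℕ) :
    elemTensor a i 0 * firstProj A = elemTensor a i 0 := by
  have := congrArg star (firstProj_mul_elemTensor (star a) i)
  rwa [star_mul, star_elemTensor, star_star, star_firstProj] at this

lemma elemTensor_mul_firstProj_of_ne (a : A) (i : ℕ) {j : ℕ} (hj : j ≠ 0) :
    elemTensor a i j * firstProj A = 0 := by
  have := congrArg star (firstProj_mul_elemTensor_of_ne (star a) hj i)
  rwa [star_mul, star_elemTensor, star_star, star_firstProj, star_zero] at this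

/-- `y` lies in the closed right ideal `A ⊗ e_{0,0}𝒦`. -/
def IsFirstRow (y : Stab A) : Prop := firstProj A * y.1 = y.1

lemma isFirstRow_el (a : A) (j : ℕ) : IsFirstRow (el a 0 j) := firstProj_mul_elemTensor a j

lemma isFirstRow_corner (a : A) : IsFirstRow (corner a) := isFirstRow_el a 0

lemma IsFirstRow.mul {y : Stab A} (h : IsFirstRow y) (b : Stab A) : IsFirstRow (y * b) := by
  change firstProj A * (y.1 * b.1) = y.1 * b.1
  rw [← mul_assoc, h]

lemma isClosed_isFirstRow : IsClosed {y : Stab A | IsFirstRow y} :=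
  isClosed_eq (continuous_const.mul continuous_subtype_val) continuous_subtype_val

lemma IsFirstRow.of_mem_closure {y z : Stab A} (h : IsFirstRow y)
    (hz : z ∈ closure (range (y * ·))) : IsFirstRow z := by
  refine closure_minimal ?_ isClosed_isFirstRow hz
  rintro _ ⟨b, rfl⟩
  exact h.mul b

variable (hinj : Function.Injective (corner : A → Stab A))
include hinj

lemma norm_corner (a : A) : ‖corner a‖ = ‖a‖ := NonUnitalStarAlgHom.norm_map cornerHom hinj a

lemma isClosedEmbedding_corner : IsClosedEmbedding (corner : A → Stab A) :=
  (NonUnitalStarAlgHom.isometry cornerHom hinj).isClosedEmbedding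

/-- The corner of `A ⊗ 𝒦` is `A ⊗ e_{0,0}`. -/
lemma exists_corner_eq_of_firstProj (T : Stab A) :
    ∃ a : A, (corner a).1 = firstProj A * T.1 * firstProj A := by
  have hr : IsClosed (range fun a : A => (corner a).1) := by
    have h1 : IsClosedEmbedding (Subtype.val : Stab A → StabSpace A →L[ℂ] StabSpace A) :=
      (NonUnitalStarSubalgebra.isClosed_topologicalClosure _).isClosedEmbedding_subtypeVal
    exact (h1.comp (isClosedEmbedding_corner hinj)).isClosed_range
  refine stab_induction (P := fun T => ∃ a : A, (corner a).1 = firstProj A * T.1 * firstProj A)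
    ?_ ⟨0, ?_⟩ ?_ ?_ ?_ T
  · exact hr.preimage (f := fun T : Stab A => firstProj A * T.1 * firstProj A)
      ((continuous_const.mul continuous_subtype_val).mul continuous_const)
  · rw [corner_zero]
    change (0 : StabSpace A →L[ℂ] StabSpace A) = firstProj A * 0 * firstProj A
    rw [mul_zero, zero_mul]
  · rintro x y ⟨a, ha⟩ ⟨b, hb⟩
    refine ⟨a + b, ?_⟩
    rw [corner_add]
    change (corner a).1 + (corner b).1 = firstProj A * (x.1 + y.1) * firstProj A
    rw [ha, hb, mul_add, add_mul]
  · rintro c x ⟨a, ha⟩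
    refine ⟨c • a, ?_⟩
    rw [← cornerHom_apply, map_smul, cornerHom_apply]
    change c • (corner a).1 = firstProj A * (c • x.1) * firstProj A
    rw [ha, mul_smul_comm, smul_mul_assoc]
  · intro a i j
    change ∃ b : A, (corner b).1 = firstProj A * elemTensor a i j * firstProj A
    by_cases hi : i = 0
    · by_cases hj : j = 0
      · subst hi hj
        refine ⟨a, ?_⟩
        rw [firstProj_mul_elemTensor, elemTensor_mul_firstProj]; rfl
      · refine ⟨0, ?_⟩
        rw [mul_assoc, elemTensor_mul_firstProj_of_ne a i hj, mul_zero, corner_zero]; rfl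
    · refine ⟨0, ?_⟩
      rw [firstProj_mul_elemTensor_of_ne a hi, zero_mul, corner_zero]; rfl

/-- The way back from `A ⊗ 𝒦` to `A`: the product `y z*` is fixed by compression to the first
coordinate, whose image is the corner. -/
lemma IsFirstRow.exists_corner_eq_mul_star {y z : Stab A} (hy : IsFirstRow y)
    (hz : IsFirstRow z) : ∃ a : A, corner a = y * star z := by
  obtain ⟨a, ha⟩ := exists_corner_eq_of_firstProj hinj (y * star z)
  refine ⟨a, Subtype.ext (ha.trans ?_)⟩
  change firstProj A * (y.1 * star z.1) * firstProj A = y.1 * star z.1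
  have h1 : star z.1 * firstProj A = star z.1 := by
    have := congrArg star (show firstProj A * z.1 = z.1 from hz)
    rwa [star_mul, star_firstProj] at this
  have h2 : firstProj A * y.1 = y.1 := hy
  rw [mul_assoc, mul_assoc, h1, ← mul_assoc, h2]

end StabStructure

/-! ### The Pedersen ideal of the stabilization, and restriction of quasitraces to the corner -/

section PedersenStar

variable {B : Type u} [NonUnitalCStarAlgebra B]

lemma star_mem_pedersenIdeal {x : B} (hx : x ∈ pedersenIdeal B) : star x ∈ pedersenIdeal B := by
  refine (TwoSidedIdeal.mem_sInf _).2 fun J hJ => ?_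
  let J' : TwoSidedIdeal B := TwoSidedIdeal.mk' {y | star y ∈ J}
    (by rw [mem_ofPred_eq, star_zero]; exact zero_mem J)
    (fun {x y} hx hy => by rw [mem_ofPred_eq, star_add]; exact add_mem hx hy)
    (fun {x} hx => by rw [mem_ofPred_eq, star_neg]; exact neg_mem hx)
    (fun {x y} hy => by rw [mem_ofPred_eq, star_mul]; exact J.mul_mem_right _ _ hy)
    (fun {x y} hx => by rw [mem_ofPred_eq, star_mul]; exact J.mul_mem_left _ _ hx)
  have hJ' (y : B) : y ∈ J' ↔ star y ∈ J := TwoSidedIdeal.mem_mk' ..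
  have hd : Dense (J' : Set B) := by
    intro y
    refine Metric.mem_closure_iff.2 fun ε hε => ?_
    obtain ⟨j, hj, hd⟩ := Metric.mem_closure_iff.1 (hJ (star y)) ε hε
    refine ⟨star j, (hJ' _).2 (by rwa [star_star]), ?_⟩
    rw [dist_eq_norm] at hd ⊢
    rwa [← norm_star, star_sub, star_star]
  exact (hJ' x).1 ((TwoSidedIdeal.mem_sInf _).1 hx J' hd)

end PedersenStar

section StabPedersen

variable {A : Type u} [NonUnitalCStarAlgebra A] [PartialOrder A] [StarOrderedRing A]

lemma nonneg_of_corner_nonneg (hinj : Function.Injective (corner : A → Stab A)) {a : A}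
    (h : 0 ≤ corner a) : 0 ≤ a := by
  have ha : IsSelfAdjoint a := hinj (by rw [corner_star]; exact h.isSelfAdjoint)
  have h1 : corner a⁻ = (corner a)⁻ := corner_cfcₙ _ (by fun_prop) (by simp) ha
  rw [(CFC.negPart_eq_zero_iff (corner a) h.isSelfAdjoint).2 h, ← corner_zero] at h1
  rw [← CFC.posPart_sub_negPart a ha, hinj h1, sub_zero]
  exact CFC.posPart_nonneg a

/-- A dense ideal contains `j` with `e j e ≠ 0`, since `j` may approach `e` and `e³ ≠ 0`. This
product lies in the corner, so the ideal meets `A` in a nonzero ideal, hence in all of `A`. -/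
lemma corner_mem_pedersenIdeal (hsimple : IsSimpleRing A)
    (hinj : Function.Injective (corner : A → Stab A)) (a : A) :
    corner a ∈ pedersenIdeal (Stab A) := by
  refine (TwoSidedIdeal.mem_sInf _).2 fun J hJ => ?_
  let J' : TwoSidedIdeal A := TwoSidedIdeal.mk' {y | corner y ∈ J}
    (by rw [mem_ofPred_eq, corner_zero]; exact zero_mem J)
    (fun {x y} hx hy => by rw [mem_ofPred_eq, corner_add]; exact add_mem hx hy)
    (fun {x} hx => by
      rw [mem_ofPred_eq, ← cornerHom_apply, map_neg, cornerHom_apply]; exact neg_mem hx)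
    (fun {x y} hy => by rw [mem_ofPred_eq, corner_mul]; exact J.mul_mem_left _ _ hy)
    (fun {x y} hx => by rw [mem_ofPred_eq, corner_mul]; exact J.mul_mem_right _ _ hx)
  have hJ' (y : A) : y ∈ J' ↔ corner y ∈ J := TwoSidedIdeal.mem_mk' ..
  obtain ⟨e, he, he0⟩ := exists_nonneg_ne_zero hsimple
  obtain ⟨j, hj, hne⟩ : ∃ j ∈ J, corner e * j * corner e ≠ 0 := by
    by_contra! h
    have h1 : corner e ∈ {x | corner e * x * corner e = 0} :=
      closure_minimal h (isClosed_eq (by fun_prop) continuous_const) (hJ (corner e))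
    refine mul_mul_self_ne_zero he.isSelfAdjoint he0 (hinj ?_)
    rw [corner_mul, corner_mul, corner_zero]
    exact h1
  obtain ⟨b, hb⟩ := IsFirstRow.exists_corner_eq_mul_star hinj ((isFirstRow_corner e).mul j)
    (isFirstRow_corner e)
  rw [← corner_star, he.isSelfAdjoint.star_eq] at hb
  have hbJ : b ∈ J' := by
    rw [hJ', hb]
    exact J.mul_mem_right _ _ (J.mul_mem_left _ _ hj)
  have hb0 : b ≠ 0 := by
    rintro rfl
    exact hne (hb ▸ corner_zero)
  exact (hJ' a).1 (eq_top_of_mem_of_ne_zero hsimple hbJ hb0 ▸ trivial)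

/-- The ideal generated by the corner is dense: for each `i, j` the elements `a` with `a ⊗ e_{i,j}`
in it form an ideal of `A` containing `e³ ≠ 0`. -/
lemma pedersenIdeal_le_span_corner (hsimple : IsSimpleRing A) :
    pedersenIdeal (Stab A) ≤ TwoSidedIdeal.span (range (corner : A → Stab A)) := by
  set J := TwoSidedIdeal.span (range (corner : A → Stab A)) with hJ
  have hcorner (a : A) : corner a ∈ J := TwoSidedIdeal.subset_span ⟨a, rfl⟩
  have hel (a : A) (i j : ℕ) : el a i j ∈ J := by
    let J' : TwoSidedIdeal A := TwoSidedIdeal.mk' {y | el y i j ∈ J}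
      (by rw [mem_ofPred_eq, el_zero]; exact zero_mem J)
      (fun {x y} hx hy => by rw [mem_ofPred_eq, el_add]; exact add_mem hx hy)
      (fun {x} hx => by
        rw [mem_ofPred_eq, ← neg_one_smul ℂ x, el_smul, neg_one_smul]; exact neg_mem hx)
      (fun {x y} hy => by rw [mem_ofPred_eq, ← el_mul _ _ i i j]; exact J.mul_mem_left _ _ hy)
      (fun {x y} hx => by rw [mem_ofPred_eq, ← el_mul _ _ i j j]; exact J.mul_mem_right _ _ hx)
    have hJ' (y : A) : y ∈ J' ↔ el y i j ∈ J := TwoSidedIdeal.mem_mk' ..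
    obtain ⟨e, he, he0⟩ := exists_nonneg_ne_zero hsimple
    have h1 : e * e * e ∈ J' := by
      rw [hJ', ← el_mul _ _ i 0 j, ← el_mul _ _ i 0 0]
      exact J.mul_mem_right _ _ (J.mul_mem_left _ _ (hcorner e))
    exact (hJ' a).1 (eq_top_of_mem_of_ne_zero hsimple h1
      (mul_mul_self_ne_zero he.isSelfAdjoint he0) ▸ trivial)
  refine sInf_le fun x => ?_
  refine closure_mono (s := ((Submodule.span ℂ {T | ∃ (a : A) (i j : ℕ), T = el a i j} :
    Submodule ℂ (Stab A)) : Set (Stab A))) (fun y hy => ?_) (stab_mem_closure_span x)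
  induction hy using Submodule.closure_induction with
  | zero => exact zero_mem J
  | add x y _ _ hx hy => exact add_mem hx hy
  | smul_mem c x hx =>
    obtain ⟨a, i, j, rfl⟩ := hx
    rw [← el_smul]
    exact hel _ _ _

/-- Elements of the Pedersen ideal are dominated by finite sums of elements of the first row. -/
lemma exists_star_mul_self_le_sum (hsimple : IsSimpleRing A) {x : Stab A}
    (hx : x ∈ pedersenIdeal (Stab A)) : ∃ (n : ℕ) (y : Fin n → Stab A), (∀ i, IsFirstRow (y i)) ∧
      star x * x ≤ ∑ i, star (y i) * y i := by
  replace hx := pedersenIdeal_le_span_corner hsimple hx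
  have hscale {n : ℕ} (y : Fin n → Stab A) (hy : ∀ i, IsFirstRow (y i)) {r : ℝ} (hr : 0 ≤ r) :
      ∃ y' : Fin n → Stab A, (∀ i, IsFirstRow (y' i)) ∧
        ∑ i, star (y' i) * y' i = r • ∑ i, star (y i) * y i := by
    refine ⟨fun i => (√r : ℂ) • y i, fun i => ?_, ?_⟩
    · change firstProj A * ((√r : ℂ) • (y i).1) = (√r : ℂ) • (y i).1
      rw [mul_smul_comm, hy i]
    · rw [Finset.smul_sum]
      refine Finset.sum_congr rfl fun i _ => ?_
      rw [star_smul, Complex.star_def, Complex.conj_ofReal, smul_mul_smul_comm, ← Complex.ofReal_mul,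
        Real.mul_self_sqrt hr, Complex.coe_smul]
  induction hx using TwoSidedIdeal.span_induction with
  | mem x h =>
    obtain ⟨a, rfl⟩ := h
    exact ⟨1, fun _ => corner a, fun _ => isFirstRow_corner a, by simp⟩
  | zero => exact ⟨0, Fin.elim0, fun i => i.elim0, by simp⟩
  | add x y hx hy h1 h2 =>
    obtain ⟨m, u, hu, h1⟩ := h1
    obtain ⟨n, v, hv, h2⟩ := h2
    obtain ⟨w, hw, hw2⟩ := hscale (Fin.append u v) (fun i => by
      refine Fin.addCases (fun i => ?_) (fun i => ?_) i
      · rw [Fin.append_left]; exact hu i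
      · rw [Fin.append_right]; exact hv i) zero_le_two
    refine ⟨m + n, w, hw, hw2 ▸ (star_add_mul_add_le x y).trans ?_⟩
    refine smul_le_smul_of_nonneg_left ?_ zero_le_two
    rw [Fin.sum_univ_add]
    simp only [Fin.append_left, Fin.append_right]
    exact add_le_add h1 h2
  | neg x hx h => simpa using h
  | left_absorb b x hx h =>
    obtain ⟨n, y, hy, h⟩ := h
    obtain ⟨w, hw, hw2⟩ := hscale y hy (r := ‖b‖ ^ 2 + 1) (by positivity)
    exact ⟨n, w, hw, hw2 ▸ (star_mul_mul_le b x).trans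
      (smul_le_smul_of_nonneg_left h (by positivity))⟩
  | right_absorb b x hx h =>
    obtain ⟨n, y, hy, h⟩ := h
    refine ⟨n, fun i => y i * b, fun i => (hy i).mul b, ?_⟩
    have := star_left_conjugate_le_conjugate h b
    refine le_trans (le_of_eq ?_) (this.trans (le_of_eq ?_))
    · rw [star_mul]; simp only [mul_assoc]
    · rw [Finset.mul_sum, Finset.sum_mul]
      refine Finset.sum_congr rfl fun i _ => ?_
      rw [star_mul]; simp only [mul_assoc]

/-- The domination puts `h`, and with it everything generated by `h`, in the closed right ideal of
`∑ y_i* y_i`. Hence squares factor through the first row. -/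
lemma exists_sum_star_mul_self_of_mem_genAlg {h : Stab A} (hs : IsSelfAdjoint h) {n : ℕ}
    {y : Fin n → Stab A} (hy : ∀ i, IsFirstRow (y i)) (hh : h * h ≤ ∑ i, star (y i) * y i)
    {v : Stab A} (hv : v ∈ genAlg {h}) (hvs : IsSelfAdjoint v) :
    ∃ z : Fin n → Stab A, (∀ i, IsFirstRow (z i)) ∧ ∑ i, star (z i) * z i = v * v := by
  have hc : 0 ≤ ∑ i, star (y i) * y i := Finset.sum_nonneg fun i _ => star_mul_self_nonneg _
  have hR : InRightIdeal (∑ i, star (y i) * y i) v :=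
    .of_mem_genAlg hc hs (inRightIdeal_of_sq_le (by rwa [hs.star_eq])) hv
  obtain ⟨z, hz, hz2⟩ := exists_sum_star_mul_self y rfl hvs hR
  exact ⟨z, fun i => (hy i).of_mem_closure (hz i), hz2⟩

lemma sqrt_mem_genAlg {B : Type u} [NonUnitalCStarAlgebra B] [PartialOrder B] [StarOrderedRing B]
    {S : Set B} {w : B} (hw : w ∈ genAlg S) (hw0 : 0 ≤ w) :
    CFC.sqrt w ∈ genAlg S := by
  rw [CFC.sqrt_eq_real_sqrt w hw0]
  exact genAlg_le (singleton_subset_iff.2 hw) (cfcₙ_mem_genAlg _ w)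

/-- The closed subalgebra generated by a self-adjoint element dominated by the first row lies in the
Pedersen ideal. -/
lemma mem_pedersenIdeal_of_mem_genAlg (hsimple : IsSimpleRing A)
    (hinj : Function.Injective (corner : A → Stab A)) {h : Stab A} (hs : IsSelfAdjoint h) {n : ℕ}
    {y : Fin n → Stab A} (hy : ∀ i, IsFirstRow (y i)) (hh : h * h ≤ ∑ i, star (y i) * y i) :
    ∀ g ∈ genAlg {h}, g ∈ pedersenIdeal (Stab A) := by
  have hpos (c : ℂ) (w : Stab A) (hw : w ∈ genAlg {h}) (hw0 : 0 ≤ w) :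
      c • w ∈ pedersenIdeal (Stab A) := by
    -- A fourth root gives `w = v⁴ = ∑ z_i* (z_i z_j*) z_j`, and each middle factor lies in the
    -- corner. A square root alone would not pass through the corner.
    set v := CFC.sqrt (CFC.sqrt w) with hv
    obtain ⟨z, hz, hz2⟩ := exists_sum_star_mul_self_of_mem_genAlg hs hy hh
      (v := v) (sqrt_mem_genAlg (sqrt_mem_genAlg hw hw0) (CFC.sqrt_nonneg w))
      (CFC.sqrt_nonneg _).isSelfAdjoint
    have h1 : v * v * (v * v) = w := by
      rw [hv, CFC.sqrt_mul_sqrt_self _ (CFC.sqrt_nonneg w), CFC.sqrt_mul_sqrt_self w hw0]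
    rw [← h1, ← hz2, Finset.sum_mul_sum, Finset.smul_sum]
    refine sum_mem fun i _ => ?_
    rw [Finset.smul_sum]
    refine sum_mem fun j _ => ?_
    obtain ⟨a, ha⟩ := (hz i).exists_corner_eq_mul_star hinj (hz j)
    have h2 : c • (star (z i) * z i * (star (z j) * z j)) = star (z i) * corner (c • a) * z j := by
      rw [← cornerHom_apply, map_smul, cornerHom_apply, ha]
      simp only [mul_assoc, mul_smul_comm, smul_mul_assoc]
    rw [h2]
    exact TwoSidedIdeal.mul_mem_right _ _ _ (TwoSidedIdeal.mul_mem_left _ _ _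
      (corner_mem_pedersenIdeal hsimple hinj _))
  have hsa (c : ℂ) (w : Stab A) (hw : w ∈ genAlg {h}) (hw0 : IsSelfAdjoint w) :
      c • w ∈ pedersenIdeal (Stab A) := by
    rw [← CFC.posPart_sub_negPart w hw0, smul_sub]
    exact sub_mem (hpos c _ (genAlg_le (singleton_subset_iff.2 hw) (cfcₙ_mem_genAlg _ w))
        (CFC.posPart_nonneg w))
      (hpos c _ (genAlg_le (singleton_subset_iff.2 hw) (cfcₙ_mem_genAlg _ w))
        (CFC.negPart_nonneg w))
  intro g hg
  have hg' : star g ∈ genAlg {h} := star_mem hg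
  have hgg : g = (1 / 2 : ℂ) • (g + star g) + (-Complex.I / 2) • (Complex.I • (g - star g)) := by
    rw [smul_smul, show -Complex.I / 2 * Complex.I = 1 / 2 by
      linear_combination (-1 / 2 : ℂ) * Complex.I_mul_I]
    module
  rw [hgg]
  refine add_mem (hsa _ _ (add_mem hg hg') (IsSelfAdjoint.add_star_self g))
    (hsa _ _ (SMulMemClass.smul_mem _ (sub_mem hg hg')) ?_)
  rw [isSelfAdjoint_iff, star_smul, star_sub, star_star, Complex.star_def, Complex.conj_I, neg_smul,
    ← smul_neg, neg_sub]

/-- The restriction of a quasitrace to the corner. -/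
def cornerTrace (τ : Stab A → ℂ) : A → ℂ := fun a => τ (corner a)

lemma rk_cornerTrace (τ : Stab A → ℂ) {a : A} (ha : 0 ≤ a) :
    rk (cornerTrace τ) a = rk τ (corner a) := by
  unfold rk cornerTrace
  congr! with ε hε
  exact corner_cfcₙ _ (by fun_prop) (by simp) ha.isSelfAdjoint

/-- Ranks agree in `A` and in `A ⊗ 𝒦`, so subadditivity is inherited directly; no extension to
matrices over `A` has to be constructed. -/
lemma isSubadditive_cornerTrace (hsimple : IsSimpleRing A)
    (hinj : Function.Injective (corner : A → Stab A)) {τ : Stab A → ℂ} (hτ : Is2Quasitrace τ) :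
    IsSubadditive (cornerTrace τ) := by
  have hP := corner_mem_pedersenIdeal hsimple hinj
  refine ⟨⟨fun x hx => ?_, fun x => ?_, fun x => ?_, fun a _ b _ ha hb => ?_,
    fun C hC hcomm hCP => ?_⟩, fun a b ha hb => ?_⟩
  · exact (hx (pedersenIdeal_eq_top hsimple ▸ trivial)).elim
  · simpa only [cornerTrace, corner_mul, corner_star] using hτ.1.nonneg (corner x)
  · simpa only [cornerTrace, corner_mul, corner_star] using hτ.1.tracial (corner x)
  · have h1 : corner (a + Complex.I • b) = corner a + Complex.I • corner b := by
      rw [corner_add, ← cornerHom_apply (_ • b), map_smul]; rfl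
    rw [cornerTrace, h1]
    refine hτ.1.add_I_smul _ (hP a) _ (hP b) ?_ ?_
    · rw [isSelfAdjoint_iff, ← corner_star, ha.star_eq]
    · rw [isSelfAdjoint_iff, ← corner_star, hb.star_eq]
  · have hmem (x : Stab A) : x ∈ C.map cornerHom ↔ ∃ y ∈ C, corner y = x := Iff.rfl
    have h := hτ.1.linear_on_abelian (C.map cornerHom)
      ((isClosedEmbedding_corner hinj).isClosedMap _ hC) ?_ ?_
    · refine ⟨fun x hx y hy => ?_, fun c x hx => ?_⟩
      · rw [cornerTrace, corner_add]
        exact h.1 _ ⟨x, hx, rfl⟩ _ ⟨y, hy, rfl⟩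
      · rw [cornerTrace, ← cornerHom_apply (c • x), map_smul]
        exact h.2 c _ ⟨x, hx, rfl⟩
    · rintro _ ⟨x, hx, rfl⟩ _ ⟨y, hy, rfl⟩
      change corner x * corner y = corner y * corner x
      rw [← corner_mul, ← corner_mul, hcomm x hx y hy]
    · rintro _ ⟨x, hx, rfl⟩
      exact hP x
  · rw [rk_cornerTrace τ (add_nonneg ha hb), rk_cornerTrace τ ha, rk_cornerTrace τ hb, corner_add]
    exact hτ.rk_add_le (corner_nonneg ha) (corner_nonneg hb)

lemma Is2Quasitrace.rk_sum_le {B : Type u} [NonUnitalCStarAlgebra B] [PartialOrder B]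
    [StarOrderedRing B] {τ : B → ℂ} (hτ : Is2Quasitrace τ) {n : ℕ} (x : Fin n → B)
    (hx : ∀ i, 0 ≤ x i) : rk τ (∑ i, x i) ≤ ∑ i, rk τ (x i) := by
  induction n with
  | zero => simp [rk_zero hτ.1]
  | succ n ih =>
    rw [Fin.sum_univ_castSucc, Fin.sum_univ_castSucc]
    exact (hτ.rk_add_le (Finset.sum_nonneg fun i _ => hx _) (hx _)).trans
      (add_le_add_left (ih _ fun i => hx _) _)

/-- A nonzero densely defined 2-quasitrace does not vanish on the corner. -/
lemma exists_re_corner_ne_zero (hsimple : IsSimpleRing A)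
    (hinj : Function.Injective (corner : A → Stab A)) {τ : Stab A → ℂ} (hτ : Is2Quasitrace τ)
    (h0 : ∃ x, τ x ≠ 0) : ∃ a : A, 0 ≤ a ∧ (τ (corner a)).re ≠ 0 := by
  by_contra! hzero
  have hrk (a : A) (ha : 0 ≤ a) : rk τ (corner a) = 0 := by
    rw [← rk_cornerTrace τ ha, rk]
    simp [cornerTrace, hzero _ (cfcₙ_cutoff_nonneg _ a)]
  -- `τ` vanishes on self-adjoint elements dominated by the first row
  have hsa (h : Stab A) (hs : IsSelfAdjoint h) {n : ℕ} {y : Fin n → Stab A}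
      (hy : ∀ i, IsFirstRow (y i)) (hh : h * h ≤ ∑ i, star (y i) * y i) :
      τ h = 0 ∧ h ∈ pedersenIdeal (Stab A) := by
    have hP := mem_pedersenIdeal_of_mem_genAlg hsimple hinj hs hy hh
    have hpos (w : Stab A) (hw : w ∈ genAlg {h}) (hw0 : 0 ≤ w) : τ w = 0 := by
      obtain ⟨z, hz, hz2⟩ := exists_sum_star_mul_self_of_mem_genAlg hs hy hh
        (v := CFC.sqrt w) (sqrt_mem_genAlg hw hw0) (CFC.sqrt_nonneg _).isSelfAdjoint
      rw [CFC.sqrt_mul_sqrt_self w hw0] at hz2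
      have h1 : rk τ w = 0 := by
        rw [← nonpos_iff_eq_zero, ← hz2]
        refine (hτ.rk_sum_le _ fun i => star_mul_self_nonneg _).trans (le_of_eq ?_)
        refine Finset.sum_eq_zero fun i _ => ?_
        -- `z_i* z_i` has the rank of `z_i z_i*`, an element of the corner, where all ranks are
        -- zero.
        obtain ⟨a, ha⟩ := (hz i).exists_corner_eq_mul_star hinj (hz i)
        have ha0 : 0 ≤ a := nonneg_of_corner_nonneg hinj (ha ▸ mul_star_self_nonneg (z i))
        rw [rk_star_mul_self hτ.1, ← ha, hrk a ha0]
      have h2 := re_le_norm_mul_rk hτ.1 hw0 fun g hg =>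
        hP g (genAlg_le (singleton_subset_iff.2 hw) hg)
      rw [h1, mul_zero, nonpos_iff_eq_zero, ENNReal.ofReal_eq_zero] at h2
      exact Complex.ext (le_antisymm h2 (hτ.1.re_nonneg hw0)) (hτ.1.im_eq_zero hw0)
    have hmem : h ∈ genAlg {h} := subset_genAlg (mem_singleton h)
    refine ⟨?_, hP h hmem⟩
    have h1 : h⁺ ∈ genAlg {h} := cfcₙ_mem_genAlg _ h
    have h2 : h⁻ ∈ genAlg {h} := cfcₙ_mem_genAlg _ h
    have h3 := hτ.1.add_of_mem (S := {h}) (by simpa) (by simp) hP hmem h2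
    rw [← eq_add_of_sub_eq (CFC.posPart_sub_negPart h hs), hpos _ h1 (CFC.posPart_nonneg h),
      hpos _ h2 (CFC.negPart_nonneg h), add_zero] at h3
    exact h3.symm
  obtain ⟨x, hx⟩ := h0
  refine hx ?_
  have hxP : x ∈ pedersenIdeal (Stab A) := by
    by_contra h
    exact hx (hτ.1.eq_zero_of_notMem x h)
  -- Meant for the real and imaginary parts of `x`, multiples of `x ± x*` by scalars of modulus at
  -- most 1, for which the domination by the first row persists.
  have hsmul (k : Stab A) (hk : k ∈ pedersenIdeal (Stab A)) (c : ℂ) (hc : ‖c‖ ≤ 1)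
      (hs : IsSelfAdjoint (c • k)) : τ (c • k) = 0 ∧ c • k ∈ pedersenIdeal (Stab A) := by
    obtain ⟨n, y, hy, h⟩ := exists_star_mul_self_le_sum hsimple hk
    refine hsa _ hs hy (le_trans ?_ h)
    nth_rw 1 [← hs.star_eq]
    have h1 : star c * c = ((‖c‖ ^ 2 : ℝ) : ℂ) := by
      rw [Complex.star_def, mul_comm, Complex.mul_conj, Complex.normSq_eq_norm_sq]
    rw [star_smul, smul_mul_smul_comm, h1, Complex.coe_smul]
    refine (smul_le_smul_of_nonneg_right (pow_le_one₀ (norm_nonneg c) hc)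
      (star_mul_self_nonneg k)).trans (one_smul ℝ _).le
  have hx' := star_mem_pedersenIdeal hxP
  have hs1 : IsSelfAdjoint ((1 / 2 : ℂ) • (x + star x)) := by
    rw [isSelfAdjoint_iff, star_smul, star_add, star_star, add_comm]
    simp
  have hs2 : IsSelfAdjoint ((-Complex.I / 2) • (x - star x)) := by
    rw [isSelfAdjoint_iff, star_smul, star_sub, star_star, ← neg_sub, smul_neg, ← neg_smul]
    congr 1
    simp [neg_div]
  obtain ⟨h1, h1'⟩ := hsmul _ (add_mem hxP hx') (1 / 2) (by norm_num) hs1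
  obtain ⟨h2, h2'⟩ := hsmul _ (sub_mem hxP hx') (-Complex.I / 2) (by norm_num) hs2
  have h3 := hτ.1.add_I_smul _ h1' _ h2' hs1 hs2
  rw [h1, h2, mul_zero, add_zero, smul_smul, show Complex.I * (-Complex.I / 2) = 1 / 2 by
    linear_combination (-1 / 2 : ℂ) * Complex.I_mul_I] at h3
  rw [← h3]
  congr 1
  module

end StabPedersen

/-! ### Normalized quasitraces and strict comparison -/

section Normalization

lemma IsQuasitrace.const_mul {B : Type u} [NonUnitalCStarAlgebra B] {τ : B → ℂ}
    (hτ : IsQuasitrace τ) {r : ℝ} (hr : 0 ≤ r) : IsQuasitrace fun x => (r : ℂ) * τ x where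
  eq_zero_of_notMem x hx := by rw [hτ.eq_zero_of_notMem x hx, mul_zero]
  nonneg x := by
    rw [Complex.re_ofReal_mul, Complex.im_ofReal_mul, (hτ.nonneg x).2, mul_zero]
    exact ⟨mul_nonneg hr (hτ.nonneg x).1, rfl⟩
  tracial x := by rw [hτ.tracial]
  add_I_smul a ha b hb hsa hsb := by rw [hτ.add_I_smul a ha b hb hsa hsb]; ring
  linear_on_abelian C hC hcomm hCP := by
    obtain ⟨h1, h2⟩ := hτ.linear_on_abelian C hC hcomm hCP
    exact ⟨fun x hx y hy => by rw [h1 x hx y hy, mul_add],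
      fun c x hx => by rw [h2 c x hx, mul_left_comm]⟩

lemma Is2Quasitrace.const_mul {B : Type u} [NonUnitalCStarAlgebra B] [PartialOrder B]
    [StarOrderedRing B] {τ : B → ℂ} (hτ : Is2Quasitrace τ) {r : ℝ} (hr : 0 ≤ r) :
    Is2Quasitrace fun x => (r : ℂ) * τ x := by
  obtain ⟨h, τ₂, h₂, hext⟩ := hτ
  exact ⟨h.const_mul hr, _, h₂.const_mul hr, fun x hx => by rw [hext x hx]⟩

lemma rk_const_mul {B : Type u} [NonUnitalCStarAlgebra B] (τ : B → ℂ) {r : ℝ} (hr : 0 ≤ r) (a : B) :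
    rk (fun x => (r : ℂ) * τ x) a = ENNReal.ofReal r * rk τ a := by
  simp only [rk, ENNReal.mul_iSup, Complex.re_ofReal_mul, ENNReal.ofReal_mul hr]

variable {A : Type u} [NonUnitalCStarAlgebra A] [PartialOrder A] [StarOrderedRing A]

lemma dimFun_eq_rk (τ : DQT A) {a : Stab A} (ha : 0 ≤ a) : dimFun τ a = rk τ.1 a :=
  (tendsto_rk τ.2.1 ha).limUnder_eq

/-- By simplicity the kernel is zero or everything, and in the second case no quasitrace could have
norm 1 on the corner. -/
lemma corner_injective (hsimple : IsSimpleRing A) (hQT : (QT A).Nonempty) :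
    Function.Injective (corner : A → Stab A) := by
  refine (TwoSidedIdeal.ker_eq_bot (cornerHom : A →⋆ₙₐ[ℂ] Stab A)).1
    ((eq_bot_or_eq_top _).resolve_right fun h => ?_)
  obtain ⟨τ, hτ⟩ := hQT
  have h0 (a : A) : corner a = 0 := by
    have : a ∈ TwoSidedIdeal.ker (cornerHom : A →⋆ₙₐ[ℂ] Stab A) := h ▸ trivial
    exact (TwoSidedIdeal.mem_ker _).1 this
  have : (1 : ℝ) ≤ 0 := by
    refine hτ.2 ?_
    rintro _ ⟨a, -, -, rfl⟩
    rw [h0, τ.2.1.map_zero, Complex.zero_re]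
  linarith

variable (hsimple : IsSimpleRing A)

include hsimple in
lemma cornerTrace_smul {τ : A → ℂ} (hτ : IsQuasitrace τ) {a : A} (ha : 0 ≤ a) (r : ℝ) :
    (τ (r • a)).re = r * (τ a).re := by
  have := hτ.smul_of_mem (S := {a}) (by simpa using ha.isSelfAdjoint) (by simp)
    (fun g _ => pedersenIdeal_eq_top hsimple ▸ trivial) (subset_genAlg (mem_singleton a)) r
  rw [Complex.coe_smul] at this
  rw [this, Complex.re_ofReal_mul]

include hsimple in
/-- Every nonzero densely defined 2-quasitrace is a multiple of a normalized one. -/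
lemma exists_mem_QT_eq_mul (hinj : Function.Injective (corner : A → Stab A)) (τ : DQT A)
    (h0 : ∃ x, τ x ≠ 0) :
    ∃ τ' ∈ QT A, ∃ N : ℝ, 0 < N ∧ τ.1 = fun x => (N : ℂ) * τ' x := by
  have hsub := isSubadditive_cornerTrace hsimple hinj τ.2
  obtain ⟨C, hC⟩ := hsub.exists_bound hsimple
  obtain ⟨a, ha, ha0⟩ := exists_re_corner_ne_zero hsimple hinj τ.2 h0
  set S : Set ℝ := {t : ℝ | ∃ a : A, 0 ≤ a ∧ ‖a‖ ≤ 1 ∧ t = (τ (corner a)).re} with hS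
  have hbdd : BddAbove S := by
    refine ⟨|C|, ?_⟩
    rintro _ ⟨b, hb, hb1, rfl⟩
    calc (τ (corner b)).re ≤ ‖b‖ * C := hC b hb
      _ ≤ ‖b‖ * |C| := by gcongr; exact le_abs_self C
      _ ≤ |C| := mul_le_of_le_one_left (abs_nonneg C) hb1
  have hlub : IsLUB S (sSup S) := isLUB_csSup ⟨_, 0, le_rfl, by simp, rfl⟩ hbdd
  have ha1 : 0 < ‖a‖ := by
    rw [norm_pos_iff]
    rintro rfl
    exact ha0 (by rw [corner_zero, τ.2.1.map_zero, Complex.zero_re])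
  have hpos : 0 < sSup S := by
    refine lt_of_lt_of_le ?_ (hlub.1 ⟨‖a‖⁻¹ • a, smul_nonneg (by positivity) ha, ?_, rfl⟩)
    · have h1 := cornerTrace_smul hsimple hsub.1 ha ‖a‖⁻¹
      change (τ (corner (‖a‖⁻¹ • a))).re = ‖a‖⁻¹ * (τ (corner a)).re at h1
      rw [h1]
      exact mul_pos (inv_pos.2 ha1) (lt_of_le_of_ne (τ.2.1.re_nonneg (corner_nonneg ha)) ha0.symm)
    · rw [norm_smul, norm_inv, norm_norm, inv_mul_cancel₀ ha1.ne']
  refine ⟨⟨fun x => (((sSup S)⁻¹ : ℝ) : ℂ) * τ x, τ.2.const_mul (inv_nonneg.2 hpos.le)⟩, ?_,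
    sSup S, hpos, ?_⟩
  · refine ⟨?_, fun b hb => ?_⟩
    · rintro _ ⟨b, hb, hb1, rfl⟩
      rw [Complex.re_ofReal_mul, inv_mul_le_one₀ hpos]
      exact hlub.1 ⟨b, hb, hb1, rfl⟩
    · have : sSup S ≤ sSup S * b := by
        refine hlub.2 ?_
        rintro _ ⟨c, hc, hc1, rfl⟩
        rw [← inv_mul_le_iff₀ hpos]
        exact hb ⟨c, hc, hc1, by rw [Complex.re_ofReal_mul]⟩
      exact (le_mul_iff_one_le_right hpos).1 this
  · funext x
    change _ = ((sSup S : ℝ) : ℂ) * ((((sSup S)⁻¹ : ℝ) : ℂ) * τ x)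
    rw [← mul_assoc, ← Complex.ofReal_mul, mul_inv_cancel₀ hpos.ne', Complex.ofReal_one, one_mul]

include hsimple in
/-- Strict comparison, tested on normalized 2-quasitraces. -/
lemma StrictComparison.cuntzLE (hcomp : StrictComparison A)
    (hinj : Function.Injective (corner : A → Stab A)) {a b : Stab A} (ha : 0 ≤ a) (hb : 0 ≤ b)
    (h : ∀ τ ∈ QT A, rk τ.1 a < rk τ.1 b) : CuntzLE a b := by
  refine hcomp a b ha hb fun τ h0 => ?_
  obtain ⟨τ', hτ', N, hN, hτ⟩ := exists_mem_QT_eq_mul hsimple hinj τ h0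
  rw [dimFun_eq_rk τ ha, dimFun_eq_rk τ hb, hτ, rk_const_mul _ hN.le, rk_const_mul _ hN.le]
  exact ENNReal.mul_lt_mul_right (ENNReal.ofReal_pos.2 hN).ne' ENNReal.ofReal_ne_top
    (h τ' hτ')

lemma rk_corner_le_one {τ : DQT A} (hτ : τ ∈ QT A) {a : A} (ha : 0 ≤ a) :
    rk τ.1 (corner a) ≤ 1 := by
  rw [← rk_cornerTrace τ.1 ha]
  refine iSup₂_le fun ε hε => ?_
  rw [← ENNReal.ofReal_one]
  exact ENNReal.ofReal_le_ofReal (hτ.1 ⟨_, cfcₙ_cutoff_nonneg ε a, norm_cfcₙ_cutoff_le ε a, rfl⟩)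

include hsimple in
/-- Elements whose rank is small, but bounded below, uniformly on normalized 2-quasitraces. -/
lemma exists_rk_corner_mem_Icc (helem : ¬ IsElementary A)
    (hinj : Function.Injective (corner : A → Stab A)) (k : ℕ) :
    ∃ e : A, 0 ≤ e ∧ ∃ c : ℝ≥0∞, 0 < c ∧ ∀ τ ∈ QT A, c ≤ rk τ.1 (corner e) ∧
      rk τ.1 (corner e) ≤ ((k : ℝ≥0∞) + 1)⁻¹ := by
  obtain ⟨e, he, he0, hsmall⟩ := exists_mul_rk_le hsimple helem (k + 1)
  obtain ⟨K, hK⟩ := exists_rk_le_nat_mul hsimple he he0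
  -- A normalized `τ` exceeds `1/2` at some positive contraction `a`, and `τ(a)` is at most the rank
  -- of `a`, hence at most `K` times that of `e`. The upper bound comes from `k + 1` copies of the
  -- rank of `e` fitting below 1.
  refine ⟨e, he, ENNReal.ofReal (1 / 2) * (K : ℝ≥0∞)⁻¹,
    ENNReal.mul_pos (by simp) (by simp), fun τ hτ => ?_⟩
  have hsub := isSubadditive_cornerTrace hsimple hinj τ.2
  rw [← rk_cornerTrace τ.1 he]
  constructor
  · obtain ⟨_, ⟨a, ha, ha1, rfl⟩, hlt⟩ := (lt_isLUB_iff hτ).1 (show (1 / 2 : ℝ) < 1 by norm_num)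
    have h1 : ENNReal.ofReal (1 / 2) ≤ K * rk (cornerTrace τ.1) e := by
      calc _ ≤ ENNReal.ofReal (cornerTrace τ.1 a).re := ENNReal.ofReal_le_ofReal hlt.le
        _ ≤ ENNReal.ofReal ‖a‖ * rk (cornerTrace τ.1) a :=
          re_le_norm_mul_rk hsub.1 ha fun g _ => pedersenIdeal_eq_top hsimple ▸ trivial
        _ ≤ 1 * rk (cornerTrace τ.1) a := by
          gcongr
          exact ENNReal.ofReal_le_one.2 ha1
        _ ≤ _ := by rw [one_mul]; exact hK _ hsub a ha
    rw [← div_eq_mul_inv]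
    exact ENNReal.div_le_of_le_mul' h1
  · obtain ⟨b, hb, h⟩ := hsmall _ hsub.1
    rw [rk_cornerTrace τ.1 hb, Nat.cast_add, Nat.cast_one] at h
    rw [← one_div, ENNReal.le_div_iff_mul_le (by simp) (by simp), mul_comm]
    exact h.trans (rk_corner_le_one hτ hb)

end Normalization

/-! ### The null ideal in terms of ranks -/

section SequenceRanks

lemma cfcₙ_ramp_le {B : Type u} [NonUnitalCStarAlgebra B] [PartialOrder B] [StarOrderedRing B]
    {a : B} (ha : 0 ≤ a) {s : ℝ} (hs : 0 ≤ s) : cfcₙ (ramp s) a ≤ a := by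
  nth_rw 2 [← cfcₙ_id' ℝ a]
  exact cfcₙ_mono (fun x hx => max_le (by linarith) (quasispectrum_nonneg_of_nonneg a ha x hx))
    (by fun_prop) (by fun_prop) (ramp_zero hs) rfl

variable {A : Type u} [NonUnitalCStarAlgebra A] [PartialOrder A] [StarOrderedRing A]

/-- `f ≤ g + o(1)`, uniformly on the normalized 2-quasitraces. -/
def EvLE (f g : ℕ → DQT A → ℝ≥0∞) : Prop :=
  ∀ ε : ℝ≥0∞, 0 < ε → ∀ᶠ n in atTop, ∀ τ ∈ QT A, f n τ ≤ g n τ + ε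

lemma EvLE.of_le {f g : ℕ → DQT A → ℝ≥0∞} (h : ∀ n, ∀ τ ∈ QT A, f n τ ≤ g n τ) : EvLE f g :=
  fun _ _ => Eventually.of_forall fun n τ hτ => (h n τ hτ).trans le_self_add

lemma EvLE.trans {f g h : ℕ → DQT A → ℝ≥0∞} (h1 : EvLE f g) (h2 : EvLE g h) : EvLE f h := by
  intro ε hε
  filter_upwards [h1 (ε / 2) (ENNReal.half_pos hε.ne'), h2 (ε / 2) (ENNReal.half_pos hε.ne')]
    with n h1 h2 τ hτ
  calc f n τ ≤ g n τ + ε / 2 := h1 τ hτ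
    _ ≤ h n τ + ε / 2 + ε / 2 := by gcongr; exact h2 τ hτ
    _ = h n τ + ε := by rw [add_assoc, ENNReal.add_halves]

lemma EvLE.add {f g f' g' : ℕ → DQT A → ℝ≥0∞} (h1 : EvLE f g) (h2 : EvLE f' g') :
    EvLE (f + f') (g + g') := by
  intro ε hε
  filter_upwards [h1 (ε / 2) (ENNReal.half_pos hε.ne'), h2 (ε / 2) (ENNReal.half_pos hε.ne')]
    with n h1 h2 τ hτ
  calc f n τ + f' n τ ≤ (g n τ + ε / 2) + (g' n τ + ε / 2) := add_le_add (h1 τ hτ) (h2 τ hτ)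
    _ = g n τ + g' n τ + (ε / 2 + ε / 2) := by ring
    _ = g n τ + g' n τ + ε := by rw [ENNReal.add_halves]

lemma EvLE.refl (f : ℕ → DQT A → ℝ≥0∞) : EvLE f f := .of_le fun _ _ _ => le_rfl

lemma EvLE.cancel {f g h : ℕ → DQT A → ℝ≥0∞} (hf : ∀ n, ∀ τ ∈ QT A, f n τ ≤ 1)
    (h1 : EvLE (f + g) (f + h)) : EvLE g h := by
  intro ε hε
  filter_upwards [h1 ε hε] with n h1 τ hτ
  have h2 : f n τ + g n τ ≤ f n τ + (h n τ + ε) := by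
    rw [← add_assoc]; exact h1 τ hτ
  exact (ENNReal.add_le_add_iff_left ((hf n τ hτ).trans_lt ENNReal.one_lt_top).ne).1 h2

/-- The rank of `(aₙ - t)₊`. -/
def rkSeq (t : ℝ) (a : ℕ → A) (n : ℕ) (τ : DQT A) : ℝ≥0∞ :=
  rk (cornerTrace τ.1) (cfcₙ (ramp t) (a n))

/-- The sequence `a` of positive elements tends to zero in rank. -/
def Small (a : ℕ → A) : Prop := ∀ t : ℝ, 0 < t → EvLE (rkSeq t a) 0

lemma rkSeq_le_one (t : ℝ) (a : ℕ → A) (n : ℕ) {τ : DQT A} (hτ : τ ∈ QT A) :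
    rkSeq t a n τ ≤ 1 := by
  rw [rkSeq, rk_cornerTrace τ.1 (cfcₙ_ramp_nonneg t _)]
  exact rk_corner_le_one hτ (cfcₙ_ramp_nonneg t _)

variable (hsimple : IsSimpleRing A) (hinj : Function.Injective (corner : A → Stab A))
include hsimple

/-- Split `a` into `a - (a - s)₊`, of norm at most `s` and rank at most 1, and the commuting element
`(a - s)₊`. -/
lemma re_le_add_mul_rk_ramp {σ : A → ℂ} (hσ : IsQuasitrace σ) (h1 : ∀ a, 0 ≤ a → rk σ a ≤ 1)
    {a : A} (ha : 0 ≤ a) {s : ℝ} (hs : 0 ≤ s) :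
    ENNReal.ofReal (σ a).re ≤ ENNReal.ofReal s + ENNReal.ofReal ‖a‖ * rk σ (cfcₙ (ramp s) a) := by
  have hP (S : Set A) : ∀ g ∈ genAlg S, g ∈ pedersenIdeal A :=
    fun g _ => pedersenIdeal_eq_top hsimple ▸ trivial
  have hle := cfcₙ_ramp_le ha hs
  have hmem : a ∈ genAlg {a} := subset_genAlg (mem_singleton a)
  have hadd := hσ.add_of_mem (S := {a}) (by simpa using ha.isSelfAdjoint) (by simp) (hP _)
    (sub_mem hmem (cfcₙ_mem_genAlg (ramp s) a)) (cfcₙ_mem_genAlg (ramp s) a)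
  rw [sub_add_cancel] at hadd
  rw [hadd, Complex.add_re]
  refine ENNReal.ofReal_add_le.trans (add_le_add ?_ ?_)
  · refine (re_le_norm_mul_rk hσ (sub_nonneg.2 hle) (hP _)).trans ?_
    calc _ ≤ ENNReal.ofReal s * 1 := mul_le_mul' (ENNReal.ofReal_le_ofReal (norm_sub_ramp_le ha hs))
          (h1 _ (sub_nonneg.2 hle))
      _ = _ := mul_one _
  · refine (re_le_norm_mul_rk hσ (cfcₙ_ramp_nonneg s a) (hP _)).trans ?_
    gcongr
    exact CStarAlgebra.norm_le_norm_of_nonneg_of_le (cfcₙ_ramp_nonneg s a) hle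

include hinj

/-- Markov's inequality bounds ranks by traces, and splitting at a small level bounds traces by
ranks on bounded sequences. The closure adds nothing, as a bound on the values at one element is a
closed condition on `τ`. -/
lemma mem_nullSeq_iff {x : lp (fun _ : ℕ => A) ∞} :
    x ∈ nullSeq (closure (QT A)) ↔ Small fun n => star (x n) * x n := by
  have hsup (a : A) (ε : ℝ≥0∞) : (⨆ τ ∈ closure (QT A), ENNReal.ofReal (τ (corner a)).re) ≤ ε ↔
      ∀ τ ∈ QT A, ENNReal.ofReal (cornerTrace τ.1 a).re ≤ ε := by
    rw [iSup₂_le_iff]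
    refine ⟨fun h τ hτ => h τ (subset_closure hτ), fun h τ hτ => ?_⟩
    refine closure_minimal (t := {τ : DQT A | ENNReal.ofReal (τ (corner a)).re ≤ ε}) h ?_ hτ
    refine isClosed_le (ENNReal.continuous_ofReal.comp (Complex.continuous_re.comp ?_))
      continuous_const
    exact (continuous_apply (corner a)).comp continuous_induced_dom
  have hsub (τ : DQT A) := isSubadditive_cornerTrace hsimple hinj τ.2
  change Tendsto _ _ _ ↔ _
  rw [ENNReal.tendsto_nhds_zero]
  simp only [hsup]
  constructor
  · intro h t ht ε hε
    have ht' : ENNReal.ofReal t ≠ 0 := (ENNReal.ofReal_pos.2 ht).ne'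
    filter_upwards [h (ENNReal.ofReal t * ε) (ENNReal.mul_pos ht' hε.ne')] with n hn τ hτ
    rw [Pi.zero_apply, Pi.zero_apply, zero_add]
    exact (ENNReal.mul_le_mul_iff_right ht' ENNReal.ofReal_ne_top).1
      ((mul_rk_ramp_le (hsub τ).1 (star_mul_self_nonneg (x n))
        (fun g _ => pedersenIdeal_eq_top hsimple ▸ trivial) ht).trans (hn τ hτ))
  · intro h ε hε
    obtain ⟨δ, hδ, hδε⟩ := ENNReal.lt_iff_exists_nnreal_btwn.1 hε
    have hδ0 : 0 < (δ : ℝ) := by exact_mod_cast hδ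
    set M : ℝ := ‖x‖ ^ 2 + 1 with hM
    have hM0 : 0 < M := by positivity
    filter_upwards [h (δ / 2) (by positivity) (ENNReal.ofReal (δ / (2 * M)))
      (ENNReal.ofReal_pos.2 (by positivity))] with n hn τ hτ
    refine le_trans ?_ hδε.le
    have h1 := hn τ hτ
    rw [Pi.zero_apply, Pi.zero_apply, zero_add] at h1
    have hx : ‖star (x n) * x n‖ ≤ M := by
      rw [CStarRing.norm_star_mul_self, ← sq]
      have := lp.norm_apply_le_norm ENNReal.top_ne_zero x n
      have := pow_le_pow_left₀ (norm_nonneg _) this 2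
      linarith
    calc _ ≤ ENNReal.ofReal (δ / 2) + ENNReal.ofReal ‖star (x n) * x n‖ * _ :=
          re_le_add_mul_rk_ramp hsimple (hsub τ).1
            (fun a ha => by rw [rk_cornerTrace τ.1 ha]; exact rk_corner_le_one hτ ha)
            (star_mul_self_nonneg (x n)) (by positivity)
      _ ≤ ENNReal.ofReal (δ / 2) + ENNReal.ofReal M * ENNReal.ofReal (δ / (2 * M)) := by
          gcongr
          exact h1
      _ = δ := by
          rw [← ENNReal.ofReal_mul hM0.le, ← ENNReal.ofReal_add (by positivity) (by positivity)]
          rw [← ENNReal.ofReal_coe_nnreal (p := δ)]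
          congr 1
          field_simp
          norm_num

/-- Cut-downs compare at different levels, and `(Mb - t/2)₊ = M (b - t/(2M))₊` has the rank of `(b -
t/(2M))₊`. -/
lemma Small.of_le_smul {a b : ℕ → A} (ha : ∀ n, 0 ≤ a n) (hb : ∀ n, 0 ≤ b n) {M : ℝ} (hM : 0 < M)
    (h : ∀ n, a n ≤ M • b n) (hs : Small b) : Small a := by
  intro t ht
  refine EvLE.trans (.of_le fun n τ _ => ?_) (hs (t / (2 * M)) (by positivity))
  have hsub := isSubadditive_cornerTrace hsimple hinj τ.2
  have h1 := rk_ramp_le_of_le_add hsub.1 hsub.2 (ha n) (smul_nonneg hM.le (hb n)) le_rfl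
    (by rw [add_zero]; exact h n) (r := t) (s := t / 2) (t := t / 4) (by positivity) (by positivity)
    (by linarith)
  rw [cfcₙ_apply_zero, rk_zero hsub.1, add_zero] at h1
  refine h1.trans (le_of_eq ?_)
  have h2 : cfcₙ (ramp (t / 2)) (M • b n) = M • cfcₙ (ramp (t / (2 * M))) (b n) := by
    rw [← cfcₙ_comp_smul M (ramp (t / 2)) (b n) (by fun_prop) (ramp_zero (by positivity)),
      ← cfcₙ_smul M _ _ (by fun_prop) (ramp_zero (by positivity))]
    refine cfcₙ_congr fun x _ => ?_
    simp only [ramp, smul_eq_mul]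
    rw [mul_max_of_nonneg _ _ hM.le, mul_zero, mul_sub]
    congr 2
    field_simp
  rw [h2, rk_smul hsub.1 (cfcₙ_ramp_nonneg _ _) hM, rkSeq]

lemma Small.add {a b : ℕ → A} (ha : ∀ n, 0 ≤ a n) (hb : ∀ n, 0 ≤ b n) (hsa : Small a)
    (hsb : Small b) : Small fun n => a n + b n := by
  intro t ht
  have h := (hsa (t / 3) (by positivity)).add (hsb (t / 3) (by positivity))
  rw [add_zero] at h
  refine EvLE.trans (.of_le fun n τ _ => ?_) h
  have hsub := isSubadditive_cornerTrace hsimple hinj τ.2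
  exact rk_ramp_le_of_le_add hsub.1 hsub.2 (add_nonneg (ha n) (hb n)) (ha n) (hb n) le_rfl
    (by positivity) (by positivity) (by linarith)

/-- The null sequences form an ideal already. Sums and left multiples are order estimates; right
multiples follow by taking adjoints, which uses traciality. -/
lemma mem_nullIdeal_iff {x : lp (fun _ : ℕ => A) ∞} :
    x ∈ nullIdeal (closure (QT A)) ↔ Small fun n => star (x n) * x n := by
  rw [← mem_nullSeq_iff hsimple hinj]
  refine ⟨fun hx => ?_, fun hx => TwoSidedIdeal.subset_span hx⟩
  have hmul (b x : lp (fun _ : ℕ => A) ∞) (hx : x ∈ nullSeq (closure (QT A))) :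
      b * x ∈ nullSeq (closure (QT A)) := by
    rw [mem_nullSeq_iff hsimple hinj] at hx ⊢
    refine Small.of_le_smul hsimple hinj (fun n => star_mul_self_nonneg _)
      (fun n => star_mul_self_nonneg _) (M := ‖b‖ ^ 2 + 1) (by positivity) (fun n => ?_) hx
    rw [lp.infty_coeFn_mul, Pi.mul_apply]
    refine (star_mul_mul_le (b n) (x n)).trans
      (smul_le_smul_of_nonneg_right ?_ (star_mul_self_nonneg _))
    have := lp.norm_apply_le_norm ENNReal.top_ne_zero b n
    gcongr
  unfold nullIdeal at hx
  induction hx using TwoSidedIdeal.span_induction with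
  | mem x h => exact h
  | zero =>
    rw [mem_nullSeq_iff hsimple hinj]
    intro t ht
    refine .of_le fun n τ _ => ?_
    have hsub := isSubadditive_cornerTrace hsimple hinj τ.2
    simp [rkSeq, rk_zero hsub.1]
  | add x y hx hy h1 h2 =>
    rw [mem_nullSeq_iff hsimple hinj] at h1 h2 ⊢
    refine Small.of_le_smul hsimple hinj (fun n => star_mul_self_nonneg _)
      (fun n => add_nonneg (star_mul_self_nonneg _) (star_mul_self_nonneg _)) two_pos
      (fun n => ?_) (h1.add hsimple hinj (fun n => star_mul_self_nonneg _)
        (fun n => star_mul_self_nonneg _) h2)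
    exact star_add_mul_add_le (x n) (y n)
  | neg x hx h =>
    rw [mem_nullSeq_iff hsimple hinj] at h ⊢
    simpa using h
  | left_absorb b x hx h => exact hmul b x h
  | right_absorb b x hx h =>
    rw [← star_star (x * b), star_mul]
    exact star_mem_nullSeq (hmul _ _ (star_mem_nullSeq h))

lemma quotientMap_eq_iff {x y : lp (fun _ : ℕ => A) ∞} :
    quotientMap (closure (QT A)) x = quotientMap (closure (QT A)) y ↔
      Small fun n => star (x n - y n) * (x n - y n) := by
  change _ ↔ Small fun n => star ((x - y) n) * (x - y) n
  rw [← mem_nullIdeal_iff hsimple hinj, ← TwoSidedIdeal.rel_iff]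
  exact RingCon.eq _

end SequenceRanks

/-! ### Positive lifts of projections and their ranks -/

section QuotientLifts

lemma exists_lp_eq {A : Type u} [NonUnitalCStarAlgebra A] (x : ℕ → A) (C : ℝ) (h : ∀ n, ‖x n‖ ≤ C) :
    ∃ X : lp (fun _ : ℕ => A) ∞, ∀ n, X n = x n :=
  ⟨⟨x, memℓp_infty ⟨C, by rintro _ ⟨n, rfl⟩; exact h n⟩⟩, fun _ => rfl⟩

variable {A : Type u} [NonUnitalCStarAlgebra A] [PartialOrder A] [StarOrderedRing A]

/-- The quotient map onto `l^∞(A)/I` for the closure of the normalized 2-quasitraces. -/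
def mkQ (x : lp (fun _ : ℕ => A) ∞) : SeqQuotient (closure (QT A)) :=
  quotientMap (closure (QT A)) x

lemma mkQ_mul (x y : lp (fun _ : ℕ => A) ∞) : mkQ (x * y) = mkQ x * mkQ y := rfl
lemma mkQ_add (x y : lp (fun _ : ℕ => A) ∞) : mkQ (x + y) = mkQ x + mkQ y := rfl
lemma mkQ_sub (x y : lp (fun _ : ℕ => A) ∞) : mkQ (x - y) = mkQ x - mkQ y := rfl
lemma mkQ_star (x : lp (fun _ : ℕ => A) ∞) : mkQ (star x) = star (mkQ x) := rfl
lemma mkQ_zero : mkQ (0 : lp (fun _ : ℕ => A) ∞) = 0 := rfl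

lemma mkQ_surjective : Function.Surjective (mkQ (A := A)) := Quotient.mk_surjective

variable (hsimple : IsSimpleRing A) (hinj : Function.Injective (corner : A → Stab A))
include hsimple hinj

lemma mkQ_eq_iff {x y : lp (fun _ : ℕ => A) ∞} :
    mkQ x = mkQ y ↔ Small fun n => star (x n - y n) * (x n - y n) :=
  quotientMap_eq_iff hsimple hinj

/-- Functions that vanish at `0` and `1` take asymptotic projections to null sequences. -/
lemma Small.cfcₙ_mul_cfcₙ {a : ℕ → A} (ha : ∀ n, 0 ≤ a n) {M : ℝ} (hM : ∀ n, ‖a n‖ ≤ M)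
    (h : Small fun n => star (a n * a n - a n) * (a n * a n - a n)) {g : ℝ → ℝ}
    (hg : Continuous g) (hg0 : g 0 = 0) (hg1 : g 1 = 0) :
    Small fun n => star (cfcₙ g (a n)) * cfcₙ g (a n) := by
  intro t ht
  -- On the compact set where `g² ≥ t`, the points 0 and 1 are excluded, so `(x² - x)²` has a
  -- positive lower bound there.
  obtain ⟨δ', hδ', hle⟩ := ((isCompact_Icc (a := 0) (b := M)).inter_right
    (isClosed_le continuous_const (hg.mul hg) : IsClosed {x | t ≤ g x * g x})).exists_forall_le'
    (f := fun x : ℝ => (x * x - x) * (x * x - x)) (by fun_prop) (a := 0) (fun x hx => by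
      have hx0 : x * x - x ≠ 0 := by
        intro h0
        have hx2 : t ≤ g x * g x := hx.2
        rcases mul_eq_zero.1 (show x * (x - 1) = 0 by linarith) with h | h
        · rw [h, hg0] at hx2; linarith
        · rw [show x = 1 by linarith, hg1] at hx2; linarith
      exact mul_self_pos.2 hx0)
  obtain ⟨C, hC⟩ := (isCompact_Icc (a := 0) (b := M)).bddAbove_image (hg.mul hg).continuousOn
  have hC' (x : ℝ) (hx : x ∈ Icc 0 M) : g x * g x ≤ |C| + 1 :=
    (hC ⟨x, hx, rfl⟩ : g x * g x ≤ C).trans ((le_abs_self C).trans (by linarith))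
  refine EvLE.trans (.of_le fun n τ _ => ?_) (h (δ' / 2) (by positivity))
  have hsub := isSubadditive_cornerTrace hsimple hinj τ.2
  have hstar (k : ℝ → ℝ) (hk : Continuous k) (hk0 : k 0 = 0) {s : ℝ} (hs : 0 ≤ s) :
      cfcₙ (ramp s) (star (cfcₙ k (a n)) * cfcₙ k (a n))
        = cfcₙ (fun x => ramp s (k x * k x)) (a n) := by
    have h1 : star (cfcₙ k (a n)) = cfcₙ k (a n) := (cfcₙ_predicate k (a n) : IsSelfAdjoint _)
    rw [h1, ← cfcₙ_mul k k (a n) (by fun_prop) hk0 (by fun_prop) hk0]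
    exact (cfcₙ_comp' (ramp s) (fun x => k x * k x) (a n) (by fun_prop) (ramp_zero hs)
      (by fun_prop) (by simp [hk0]) (ha n).isSelfAdjoint).symm
  have hq : a n * a n - a n = cfcₙ (fun x : ℝ => x * x - x) (a n) := by
    rw [cfcₙ_sub (fun x => x * x) (fun x => x) (a n) (by fun_prop) (by simp) (by fun_prop) rfl,
      cfcₙ_mul (fun x => x) (fun x => x) (a n) (by fun_prop) rfl (by fun_prop) rfl, cfcₙ_id' ℝ (a n)]
  simp only [rkSeq, hq]
  rw [hstar g hg hg0 ht.le, hstar (fun x => x * x - x) (by fun_prop) (by simp) (by positivity)]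
  refine rk_cfcₙ_le hsub.1 (ha n) (by fun_prop) (by fun_prop) (by simp [hg0, ramp_zero ht.le])
    (by simpa using ramp_zero (by positivity)) (fun x _ => ramp_nonneg _ _)
    (fun x _ => ramp_nonneg _ _) (r := (|C| + 1) / (δ' / 2)) (by positivity) fun x hx0 hx => ?_
  have hx' : x ∈ Icc 0 M := ⟨hx0, hx.trans (hM n)⟩
  by_cases htx : t ≤ g x * g x
  · have h1 : δ' / 2 ≤ ramp (δ' / 2) ((x * x - x) * (x * x - x)) :=
      le_max_of_le_left (by linarith [hle x ⟨hx', htx⟩])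
    calc ramp t (g x * g x) ≤ |C| + 1 := max_le (by linarith [hC' x hx']) (by positivity)
      _ = (|C| + 1) / (δ' / 2) * (δ' / 2) := by field_simp
      _ ≤ _ := by gcongr
  · rw [show ramp t (g x * g x) = 0 from max_eq_right (by linarith)]
    exact mul_nonneg (by positivity) (ramp_nonneg _ _)

/-- A positive lift of an idempotent may be replaced by its image under a function that is `0` at
`0` and `1` at `1`. -/
lemma exists_lift_eq_cfcₙ {a : lp (fun _ : ℕ => A) ∞} (ha : ∀ n, 0 ≤ a n)
    (hP : mkQ a * mkQ a = mkQ a) {f : ℝ → ℝ} (hf : Continuous f) (hf0 : f 0 = 0) (hf1 : f 1 = 1)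
    (hfb : ∀ x, |f x| ≤ 1) :
    ∃ c : lp (fun _ : ℕ => A) ∞, (∀ n, c n = cfcₙ f (a n)) ∧ mkQ c = mkQ a := by
  obtain ⟨c, hc⟩ := exists_lp_eq (fun n => cfcₙ f (a n)) 1 fun n => norm_cfcₙ_le fun x _ => hfb x
  refine ⟨c, hc, ?_⟩
  rw [← mkQ_mul, mkQ_eq_iff hsimple hinj] at hP
  rw [mkQ_eq_iff hsimple hinj]
  have h := Small.cfcₙ_mul_cfcₙ hsimple hinj ha
    (fun n => lp.norm_apply_le_norm ENNReal.top_ne_zero a n) (g := fun x => f x - x)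
    (by simpa only [lp.infty_coeFn_mul, Pi.mul_apply] using hP) (by fun_prop) (by simp [hf0])
    (by simp [hf1])
  have hd (n : ℕ) : c n - a n = cfcₙ (fun x => f x - x) (a n) := by
    have := ha n
    rw [hc, cfcₙ_sub f (fun x => x) (a n) (by fun_prop) hf0 (by fun_prop) rfl, cfcₙ_id' ℝ (a n)]
  simpa only [hd] using h

/-- `d² = (d⁺)² + (d⁻)²` dominates `(d⁺)²`, and cutting `d⁺` at `t` amounts in rank to cutting its
square at `t²`. -/
lemma Small.posPart {d : ℕ → A} (hd : ∀ n, IsSelfAdjoint (d n))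
    (h : Small fun n => star (d n) * d n) : Small fun n => (d n)⁺ := by
  have hpos (n : ℕ) : 0 ≤ (d n)⁺ := CFC.posPart_nonneg _
  have h1 : Small fun n => (d n)⁺ * (d n)⁺ := by
    refine Small.of_le_smul hsimple hinj (fun n => ?_) (fun n => star_mul_self_nonneg _) one_pos
      (fun n => ?_) h
    · nth_rw 1 [← (hpos n).isSelfAdjoint.star_eq]; exact star_mul_self_nonneg _
    · have h2 := star_mul_self_nonneg (d n)⁻
      rw [(CFC.negPart_nonneg (d n)).isSelfAdjoint.star_eq] at h2
      have h3 : star (d n) * d n = (d n)⁺ * (d n)⁺ + (d n)⁻ * (d n)⁻ := by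
        rw [(hd n).star_eq]
        nth_rw 1 2 [← CFC.posPart_sub_negPart (d n) (hd n)]
        rw [sub_mul, mul_sub, mul_sub, CFC.posPart_mul_negPart, CFC.negPart_mul_posPart]
        abel
      rw [one_smul, h3]
      exact le_add_of_nonneg_right h2
  intro t ht
  refine EvLE.trans (.of_le fun n τ _ => ?_) (h1 (t * t) (by positivity))
  have hsub := isSubadditive_cornerTrace hsimple hinj τ.2
  have h2 : cfcₙ (ramp (t * t)) ((d n)⁺ * (d n)⁺) = cfcₙ (fun x => ramp (t * t) (x * x)) (d n)⁺ := by
    have := hpos n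
    nth_rw 1 2 [← cfcₙ_id' ℝ (d n)⁺]
    rw [← cfcₙ_mul (fun x => x) (fun x => x) _ (by fun_prop) rfl (by fun_prop) rfl]
    exact (cfcₙ_comp' (ramp (t * t)) (fun x => x * x) _ (by fun_prop) (ramp_zero (by positivity))
      (by fun_prop) (by simp)).symm
  rw [rkSeq, rkSeq, h2]
  refine rk_cfcₙ_le hsub.1 (hpos n) (by fun_prop) (by fun_prop) (ramp_zero ht.le)
    (by simpa using ramp_zero (by positivity)) (fun x _ => ramp_nonneg _ _)
    (fun x _ => ramp_nonneg _ _) (r := 1 / t) (by positivity) fun x hx0 _ => ?_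
  rcases le_total x t with hx | hx
  · rw [show ramp t x = 0 from max_eq_right (by linarith)]
    exact mul_nonneg (by positivity) (ramp_nonneg _ _)
  · rw [show ramp t x = x - t from max_eq_left (by linarith), one_div, ← div_eq_inv_mul,
      le_div_iff₀ ht]
    exact le_max_of_le_left (by nlinarith)

/-- The ranks of two positive lifts of the same idempotent agree asymptotically. -/
lemma evLE_rkSeq_of_mkQ_eq {a b : lp (fun _ : ℕ => A) ∞} (ha : ∀ n, 0 ≤ a n) (hb : ∀ n, 0 ≤ b n)
    (hP : mkQ a * mkQ a = mkQ a) (hab : mkQ a = mkQ b) {s t : ℝ} (hs : 0 ≤ s) (hs1 : s < 1)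
    (ht : 0 < t) (ht1 : t < 1) : EvLE (rkSeq t a) (rkSeq s b) := by
  obtain ⟨c, hc, hca⟩ := exists_lift_eq_cfcₙ hsimple hinj ha hP (f := cutoff t) (by fun_prop)
    (by simp) (cutoff_eq_one ht ht1.le)
    (fun x => by rw [abs_of_nonneg (cutoff_nonneg t x)]; exact cutoff_le_one t x)
  have hcsa (n : ℕ) : 0 ≤ c n := hc n ▸ cfcₙ_cutoff_nonneg t _
  have hd (n : ℕ) : IsSelfAdjoint (c n - b n) := (hcsa n).isSelfAdjoint.sub (hb n).isSelfAdjoint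
  have hsmall := Small.posPart hsimple hinj hd ((mkQ_eq_iff hsimple hinj).1 (hca.trans hab))
  have h1 := (EvLE.refl (rkSeq s b)).add (hsmall ((1 - s) / 4) (by linarith))
  rw [add_zero] at h1
  refine EvLE.trans (.of_le fun n τ _ => ?_) h1
  have hsub := isSubadditive_cornerTrace hsimple hinj τ.2
  have hr : 0 < (1 - s) / 2 := by linarith
  -- From `c ≤ b + (c - b)₊`: the level `(1 + s)/2` exceeds `s + (1 - s)/4`, and it is still below
  -- 1, the value of `f_t(a)` wherever `a ≥ t`.
  have h2 := rk_ramp_le_of_le_add hsub.1 hsub.2 (hcsa n) (hb n) (CFC.posPart_nonneg (c n - b n))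
    (by
      have h3 := CFC.negPart_nonneg (c n - b n)
      have h4 := CFC.posPart_sub_negPart (c n - b n) (hd n)
      have h5 : b n + (c n - b n)⁺ = c n + (c n - b n)⁻ := by
        rw [sub_eq_iff_eq_add.1 h4]; abel
      rw [h5]
      exact le_add_of_nonneg_right h3) (r := 1 - (1 - s) / 2) hs
    (show (0 : ℝ) ≤ (1 - s) / 4 by linarith) (by linarith)
  refine le_trans ?_ h2
  have h3 : cfcₙ (ramp (1 - (1 - s) / 2)) (c n)
      = cfcₙ (fun x => ramp (1 - (1 - s) / 2) (cutoff t x)) (a n) := by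
    rw [hc]
    exact (cfcₙ_comp' (ramp (1 - (1 - s) / 2)) (cutoff t) (a n) (by fun_prop)
      (ramp_zero (by linarith)) (by fun_prop) (by simp) (ha n).isSelfAdjoint).symm
  rw [h3, rkSeq]
  refine rk_cfcₙ_le hsub.1 (ha n) (by fun_prop) (by fun_prop) (ramp_zero ht.le)
    (by simpa using ramp_zero (by linarith)) (fun x _ => ramp_nonneg _ _)
    (fun x _ => ramp_nonneg _ _) (r := (‖a n‖ + 1) / ((1 - s) / 2)) (by positivity)
    fun x hx0 hx => ?_
  rcases le_total x t with hx' | hx'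
  · rw [show ramp t x = 0 from max_eq_right (by linarith)]
    exact mul_nonneg (by positivity) (ramp_nonneg _ _)
  · rw [cutoff_eq_one ht hx', show ramp (1 - (1 - s) / 2) 1 = (1 - s) / 2 by
      rw [ramp, max_eq_left] <;> linarith, div_mul_cancel₀ _ hr.ne']
    exact max_le (by linarith) (by positivity)

end QuotientLifts

/-! ### Asymptotic rank of projections: additivity, invariance, faithfulness -/

section ProjectionRank

variable {A : Type u} [NonUnitalCStarAlgebra A] [PartialOrder A] [StarOrderedRing A]

lemma lp_star_mul_self_nonneg (x : lp (fun _ : ℕ => A) ∞) (n : ℕ) : 0 ≤ (star x * x) n := by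
  rw [lp.infty_coeFn_mul, Pi.mul_apply, lp.star_apply]
  exact star_mul_self_nonneg _

/-- The asymptotic rank of a projection of `l^∞(A)/I`. -/
def qrank (P : SeqQuotient (closure (QT A))) : ℕ → DQT A → ℝ≥0∞ :=
  rkSeq (1 / 2) (star (Function.surjInv mkQ_surjective P) * Function.surjInv mkQ_surjective P)

lemma qrank_le_one (P : SeqQuotient (closure (QT A))) (n : ℕ) {τ : DQT A} (hτ : τ ∈ QT A) :
    qrank P n τ ≤ 1 :=
  rkSeq_le_one _ _ n hτ

variable {P R : SeqQuotient (closure (QT A))}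

lemma mkQ_star_mul_self_surjInv (hP : IsStarProjection P) :
    mkQ (star (Function.surjInv mkQ_surjective P) * Function.surjInv mkQ_surjective P) = P := by
  rw [mkQ_mul, mkQ_star, Function.surjInv_eq mkQ_surjective, hP.isSelfAdjoint.star_eq, hP.isIdempotentElem.eq]

variable (hsimple : IsSimpleRing A) (hinj : Function.Injective (corner : A → Stab A))
include hsimple hinj

/-- With the reverse estimate `qrank_evLE`, any positive lift and any level strictly between 0 and 1
may be used to compute the rank, which leaves room for inequalities that shift levels. -/
lemma evLE_qrank (hP : IsStarProjection P) {a : lp (fun _ : ℕ => A) ∞} (ha : ∀ n, 0 ≤ a n)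
    (haP : mkQ a = P) {s : ℝ} (hs : 0 < s) (hs1 : s < 1) : EvLE (rkSeq s a) (qrank P) :=
  evLE_rkSeq_of_mkQ_eq hsimple hinj ha (lp_star_mul_self_nonneg _)
    (by rw [haP, hP.isIdempotentElem.eq]) (by rw [mkQ_star_mul_self_surjInv hP, haP])
    (by norm_num) (by norm_num) hs hs1

lemma qrank_evLE (hP : IsStarProjection P) {a : lp (fun _ : ℕ => A) ∞} (ha : ∀ n, 0 ≤ a n)
    (haP : mkQ a = P) {s : ℝ} (hs : 0 ≤ s) (hs1 : s < 1) : EvLE (qrank P) (rkSeq s a) :=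
  evLE_rkSeq_of_mkQ_eq hsimple hinj (lp_star_mul_self_nonneg _) ha
    (by rw [mkQ_star_mul_self_surjInv hP, hP.isIdempotentElem.eq])
    (by rw [mkQ_star_mul_self_surjInv hP, haP]) hs hs1 (by norm_num) (by norm_num)

/-- A projection has positive lifts given by cutoffs of positive lifts. -/
lemma exists_cutoff_lift (hP : IsStarProjection P) {ε : ℝ} (hε : 0 < ε) (hε1 : ε ≤ 1) :
    ∃ a c : lp (fun _ : ℕ => A) ∞, (∀ n, 0 ≤ a n) ∧ mkQ a = P ∧
      (∀ n, c n = cfcₙ (cutoff ε) (a n)) ∧ mkQ c = P := by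
  have ha := lp_star_mul_self_nonneg (Function.surjInv mkQ_surjective P)
  have haP := mkQ_star_mul_self_surjInv hP
  obtain ⟨c, hc, hca⟩ := exists_lift_eq_cfcₙ hsimple hinj ha
    (by rw [haP, hP.isIdempotentElem.eq]) (f := cutoff ε) (by fun_prop) (by simp)
    (cutoff_eq_one hε hε1)
    (fun x => by rw [abs_of_nonneg (cutoff_nonneg ε x)]; exact cutoff_le_one ε x)
  exact ⟨_, c, ha, haP, hc, hca.trans haP⟩

/-- Orthogonal projections lift to orthogonal positive elements. -/
lemma exists_orthogonal_lifts (hP : IsStarProjection P) (hR : IsStarProjection R) (hPR : R * P = 0) :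
    ∃ a b : lp (fun _ : ℕ => A) ∞, (∀ n, 0 ≤ a n) ∧ (∀ n, 0 ≤ b n) ∧ mkQ a = P ∧ mkQ b = R ∧
      ∀ n, a n * b n = 0 := by
  obtain ⟨x, a, hx, hxP, ha, haP⟩ := exists_cutoff_lift hsimple hinj hP one_pos le_rfl
  obtain ⟨k, hk, hkx⟩ := exists_lift_eq_cfcₙ hsimple hinj hx
    (by rw [hxP, hP.isIdempotentElem.eq]) (f := cutoff (1 / 2)) (by fun_prop) (by simp)
    (cutoff_eq_one (by norm_num) (by norm_num))
    (fun x => by rw [abs_of_nonneg (cutoff_nonneg _ x)]; exact cutoff_le_one _ x)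
  obtain ⟨r, rfl⟩ := mkQ_surjective R
  -- Formally `w = r(1 - k)`, with `k` a unit for `a`: then `w a = 0` exactly, and `w` still lifts
  -- `R` because `RP = 0`.
  set w := r - r * k with hw
  have hwR : mkQ w = mkQ r := by
    rw [hw, mkQ_sub, mkQ_mul, hkx, hxP, hPR, sub_zero]
  have ha0 (n : ℕ) : 0 ≤ a n := ha n ▸ cfcₙ_cutoff_nonneg 1 _
  refine ⟨a, star w * w, ha0, lp_star_mul_self_nonneg w, haP, ?_, fun n => ?_⟩
  · rw [mkQ_mul, mkQ_star, hwR, hR.isSelfAdjoint.star_eq, hR.isIdempotentElem.eq]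
  · have h1 : w n * a n = 0 := by
      have : w n = r n - r n * k n := by
        rw [hw, lp.coeFn_sub, Pi.sub_apply, lp.infty_coeFn_mul, Pi.mul_apply]
      rw [this, sub_mul, mul_assoc, hk, ha, cutoff_half_mul_cutoff _ one_pos, sub_self]
    have h2 := congrArg star h1
    rw [star_mul, (ha0 n).isSelfAdjoint.star_eq, star_zero] at h2
    rw [lp.infty_coeFn_mul, Pi.mul_apply, lp.star_apply, ← mul_assoc, h2, zero_mul]

lemma qrank_add_evLE (hP : IsStarProjection P) (hR : IsStarProjection R) (hPR : R * P = 0) :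
    EvLE (qrank P + qrank R) (qrank (P + R)) := by
  obtain ⟨a, b, ha, hb, haP, hbR, hab⟩ := exists_orthogonal_lifts hsimple hinj hP hR hPR
  have h1 := (qrank_evLE hsimple hinj hP ha haP (s := 3 / 4) (by norm_num) (by norm_num)).add
    (qrank_evLE hsimple hinj hR hb hbR (s := 3 / 4) (by norm_num) (by norm_num))
  have h2 := evLE_qrank hsimple hinj (add_comm R P ▸ hR.add hP hPR) (a := a + b)
    (fun n => add_nonneg (ha n) (hb n)) (by rw [mkQ_add, haP, hbR]) (s := 1 / 2) (by norm_num)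
    (by norm_num)
  refine h1.trans (EvLE.trans (.of_le fun n τ _ => ?_) h2)
  have hsub := isSubadditive_cornerTrace hsimple hinj τ.2
  exact rk_ramp_add_rk_ramp_le hsub.1 (ha n) (hb n) (hab n) (by norm_num) (by norm_num)

lemma qrank_add_le (hP : IsStarProjection P) (hR : IsStarProjection R) (hPR : R * P = 0) :
    EvLE (qrank (P + R)) (qrank P + qrank R) := by
  obtain ⟨a, b, ha, hb, haP, hbR, hab⟩ := exists_orthogonal_lifts hsimple hinj hP hR hPR
  have h1 := (evLE_qrank hsimple hinj hP ha haP (s := 1 / 4) (by norm_num) (by norm_num)).add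
    (evLE_qrank hsimple hinj hR hb hbR (s := 1 / 4) (by norm_num) (by norm_num))
  have h2 := qrank_evLE hsimple hinj (add_comm R P ▸ hR.add hP hPR) (a := a + b)
    (fun n => add_nonneg (ha n) (hb n)) (by rw [mkQ_add, haP, hbR]) (s := 3 / 4) (by norm_num)
    (by norm_num)
  refine h2.trans (EvLE.trans (.of_le fun n τ _ => ?_) h1)
  have hsub := isSubadditive_cornerTrace hsimple hinj τ.2
  exact rk_ramp_le_of_le_add hsub.1 hsub.2 (add_nonneg (ha n) (hb n)) (ha n) (hb n) le_rfl
    (by norm_num) (by norm_num) (by norm_num)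

/-- For a lift `z` of `v` and `c = f_1(zz*)`, the sequence `z* c z` lifts `P` and has rank at most
that of `c`. Using `c`, not `zz*`, keeps small spectral values from contributing to the rank. -/
lemma qrank_evLE_of_star_mul_self {v : SeqQuotient (closure (QT A))} (hP : IsStarProjection P)
    (hR : IsStarProjection R) (hv : star v * v = P) (hv' : v * star v = R) :
    EvLE (qrank P) (qrank R) := by
  obtain ⟨z, rfl⟩ := mkQ_surjective v
  have hb (n : ℕ) : 0 ≤ (z * star z) n := by
    have := lp_star_mul_self_nonneg (star z) n
    rwa [star_star] at this
  have hbR : mkQ (z * star z) = R := hv'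
  obtain ⟨c, hc, hcb⟩ := exists_lift_eq_cfcₙ hsimple hinj hb
    (by rw [hbR, hR.isIdempotentElem.eq]) (f := cutoff 1) (by fun_prop) (by simp)
    (cutoff_eq_one one_pos le_rfl)
    (fun x => by rw [abs_of_nonneg (cutoff_nonneg _ x)]; exact cutoff_le_one _ x)
  have hc0 (n : ℕ) : 0 ≤ c n := hc n ▸ cfcₙ_cutoff_nonneg 1 _
  have hy (n : ℕ) : (star z * c * z) n = star (z n) * c n * z n := by
    rw [lp.infty_coeFn_mul, Pi.mul_apply, lp.infty_coeFn_mul, Pi.mul_apply, lp.star_apply]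
  have hy0 (n : ℕ) : 0 ≤ (star z * c * z) n := hy n ▸ star_left_conjugate_nonneg (hc0 n) _
  have hyP : mkQ (star z * c * z) = P := by
    rw [mkQ_mul, mkQ_mul, hcb, mkQ_mul, mkQ_star, ← mul_assoc, hv, mul_assoc, hv,
      hP.isIdempotentElem.eq]
  refine (qrank_evLE hsimple hinj hP hy0 hyP (s := 1 / 2) (by norm_num) (by norm_num)).trans
    (EvLE.trans (.of_le fun n τ _ => ?_)
      (evLE_qrank hsimple hinj hR hb hbR (s := 1 / 4) (by norm_num) (by norm_num)))
  have hsub := isSubadditive_cornerTrace hsimple hinj τ.2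
  calc _ ≤ rk (cornerTrace τ.1) ((star z * c * z) n) :=
        rk_mono hsub.1 (cfcₙ_ramp_nonneg _ _) (cfcₙ_ramp_le (hy0 n) (by norm_num))
    _ ≤ rk (cornerTrace τ.1) (c n) := by rw [hy]; exact rk_conj_le hsub.1 (hc0 n) _
    _ ≤ _ := by
      rw [hc]
      refine rk_cfcₙ_le hsub.1 (hb n) (by fun_prop) (by fun_prop) (by simp)
        (ramp_zero (by norm_num)) (fun x _ => cutoff_nonneg _ _) (fun x _ => ramp_nonneg _ _)
        (r := 4) (by norm_num) fun x hx0 hx => ?_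
      rcases le_total x (1 / 2) with h | h
      · rw [cutoff_eq_zero one_pos h]
        exact mul_nonneg (by norm_num) (ramp_nonneg _ _)
      · refine (cutoff_le_one 1 x).trans ?_
        have : 1 / 4 ≤ ramp (1 / 4) x := le_max_of_le_left (by linarith)
        linarith

/-- Rank zero at levels below 1 makes a positive lift small at all levels, and `a² ≤ ‖a‖ a` passes
this to `a*a`. -/
lemma eq_zero_of_qrank_evLE (hP : IsStarProjection P) (h : EvLE (qrank P) 0) : P = 0 := by
  obtain ⟨a, ha, haP⟩ : ∃ a : lp (fun _ : ℕ => A) ∞, (∀ n, 0 ≤ a n) ∧ mkQ a = P :=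
    ⟨_, lp_star_mul_self_nonneg _, mkQ_star_mul_self_surjInv hP⟩
  have hsmall : Small a := by
    intro t ht
    refine EvLE.trans (.of_le fun n τ _ => ?_) ((evLE_qrank hsimple hinj hP ha haP
      (s := min t (1 / 2)) (by positivity) (by rw [min_lt_iff]; norm_num)).trans h)
    have hsub := isSubadditive_cornerTrace hsimple hinj τ.2
    refine rk_cfcₙ_le hsub.1 (ha n) (by fun_prop) (by fun_prop) (ramp_zero ht.le)
      (ramp_zero (by positivity)) (fun x _ => ramp_nonneg _ _) (fun x _ => ramp_nonneg _ _)
      (r := 1) one_pos fun x _ _ => ?_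
    rw [one_mul]
    exact max_le_max (by linarith [min_le_left t (1 / 2)]) le_rfl
  rw [← haP, ← mkQ_zero, mkQ_eq_iff hsimple hinj]
  refine Small.of_le_smul hsimple hinj (fun n => star_mul_self_nonneg _) ha (M := ‖a‖ + 1)
    (by positivity) (fun n => ?_) hsmall
  obtain ⟨s, hs, -, hs2⟩ := exists_star_mul_self (ha n)
  have h1 := CStarAlgebra.star_left_conjugate_le_norm_smul (a := s) (b := a n) (ha n).isSelfAdjoint
  have h2 : star (a n - (0 : lp (fun _ : ℕ => A) ∞) n) * (a n - (0 : lp (fun _ : ℕ => A) ∞) n)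
      = star s * a n * s := by
    rw [lp.coeFn_zero, Pi.zero_apply, sub_zero, (ha n).isSelfAdjoint.star_eq, hs.star_eq, ← hs2]
    simp only [mul_assoc]
  rw [h2]
  refine h1.trans ?_
  rw [hs.star_eq, hs2]
  refine smul_le_smul_of_nonneg_right ?_ (ha n)
  linarith [lp.norm_apply_le_norm ENNReal.top_ne_zero a n]

end ProjectionRank

/-! ### Comparison of projections by rank, and cancellation -/

section Cancellation

variable {A : Type u} [NonUnitalCStarAlgebra A] [PartialOrder A] [StarOrderedRing A]

lemma cfcₙ_ramp_eq_zero {B : Type u} [NonUnitalCStarAlgebra B] [PartialOrder B] [StarOrderedRing B]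
    {a : B} (ha : IsSelfAdjoint a) {t : ℝ} (h : ‖a‖ ≤ t) : cfcₙ (ramp t) a = 0 := by
  rw [cfcₙ_congr (g := fun _ => (0 : ℝ)) fun x hx => ?_, cfcₙ_const_zero]
  have hx' := (Real.le_norm_self x).trans 
    (NonUnitalIsometricContinuousFunctionalCalculus.norm_quasispectrum_le (𝕜 := ℝ) a hx ha)
  exact max_eq_right (by linarith)

variable (hsimple : IsSimpleRing A) (hinj : Function.Injective (corner : A → Stab A))
include hsimple hinj

lemma mkQ_eq_of_tendsto {x y : lp (fun _ : ℕ => A) ∞}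
    (h : Tendsto (fun n => ‖x n - y n‖) atTop (𝓝 0)) : mkQ x = mkQ y := by
  rw [mkQ_eq_iff hsimple hinj]
  intro t ht ε hε
  have h2 : Tendsto (fun n => ‖x n - y n‖ * ‖x n - y n‖) atTop (𝓝 0) := by
    simpa using h.mul h
  filter_upwards [h2.eventually_le_const ht] with n hn τ hτ
  have hsub := isSubadditive_cornerTrace hsimple hinj τ.2
  rw [rkSeq, cfcₙ_ramp_eq_zero (.star_mul_self _) (by rwa [CStarRing.norm_star_mul_self]), rk_zero hsub.1]
  exact zero_le

/-- Comparison of `u` with `β² ⊕ e` gives an approximate factorization of `u³`, with one part coming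
from `β` and the other one dominated by `e` in rank. -/
lemma exists_approx_star_mul_self (hcomp : StrictComparison A) {u β e : A} (hu : 0 ≤ u)
    (hu1 : ‖u‖ ≤ 1) (hβ : IsSelfAdjoint β) (he : 0 ≤ e)
    (h : ∀ τ ∈ QT A, rk (cornerTrace τ.1) u
      < rk (cornerTrace τ.1) (β * β) + rk (cornerTrace τ.1) e) {η : ℝ} (hη : 0 < η) :
    ∃ y z : A, (∀ k, k * β = β → k * y = y) ∧
      ‖u * u * u - (star y * y + star z * z)‖ ≤ η ∧
      ∀ τ ∈ QT A, rk (cornerTrace τ.1) (star z * z) ≤ rk (cornerTrace τ.1) e := by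
  obtain ⟨s, hs, -, hs2⟩ := exists_star_mul_self he
  have hββ : 0 ≤ β * β := by
    nth_rw 1 [← hβ.star_eq]; exact star_mul_self_nonneg β
  -- `w*w` is a copy of `e` in the second diagonal place, orthogonal to the corner, with `ww*` in
  -- the corner.
  set w : Stab A := el s 0 1 with hw
  have hww : w * star w = corner e := by
    rw [hw, star_el, el_mul, hs.star_eq, hs2]; rfl
  have hw0 : 0 ≤ star w * w := star_mul_self_nonneg w
  have hrkw (τ : DQT A) : rk τ.1 (star w * w) = rk (cornerTrace τ.1) e := by
    rw [rk_star_mul_self τ.2.1, hww, rk_cornerTrace τ.1 he]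
  have horth : corner (β * β) * (star w * w) = 0 := by
    have : corner (β * β) * star w = 0 := by
      rw [hw, star_el]; exact el_mul_of_ne _ _ _ _ (by norm_num)
    rw [← mul_assoc, this, zero_mul]
  have hD : CuntzLE (corner u) (corner (β * β) + star w * w) := by
    refine hcomp.cuntzLE hsimple hinj (corner_nonneg hu) (add_nonneg (corner_nonneg hββ) hw0)
      fun τ hτ => ?_
    have h1 := h τ hτ
    rw [rk_cornerTrace τ.1 hu, rk_cornerTrace τ.1 hββ, ← hrkw τ] at h1
    exact h1.trans_le (rk_add_rk_le τ.2.1 (corner_nonneg hββ) hw0 horth)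
  obtain ⟨x, hx⟩ := cuntzLE_iff.1 hD η hη
  have hus : star (corner u) = corner u := by rw [← corner_star, hu.isSelfAdjoint.star_eq]
  -- `x` lives in `A ⊗ 𝒦`, but `β x u` and `(s ⊗ e_{0,1}) x u` are in the corner. The extra factor
  -- `u` on each side is the reason for approximating `u³` and not `u`.
  obtain ⟨y, hy⟩ := ((isFirstRow_corner β).mul x).exists_corner_eq_mul_star hinj
    (isFirstRow_corner u)
  obtain ⟨z, hz⟩ := ((isFirstRow_el s 1).mul x).exists_corner_eq_mul_star hinj
    (isFirstRow_corner u)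
  rw [hus] at hy hz
  have hzz : corner (star z * z) = star (x * corner u) * (star w * w) * (x * corner u) := by
    rw [corner_mul, corner_star, hz, star_mul, star_mul, star_mul]
    simp only [mul_assoc, hw]
  refine ⟨y, z, fun k hk => hinj ?_, ?_, fun τ hτ => ?_⟩
  · rw [corner_mul, hy, ← mul_assoc, ← mul_assoc, ← corner_mul, hk]
  · have hyy : corner (star y * y) = star (x * corner u) * corner (β * β) * (x * corner u) := by
      rw [corner_mul, corner_star, hy, star_mul, star_mul, star_mul, ← corner_star β, hβ.star_eq,
        corner_mul]
      simp only [mul_assoc]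
    have h1 : corner (u * u * u - (star y * y + star z * z)) =
        corner u * (corner u - star x * (corner (β * β) + star w * w) * x) * corner u := by
      rw [← cornerHom_apply, map_sub, map_add, cornerHom_apply, cornerHom_apply, cornerHom_apply,
        hyy, hzz, corner_mul, corner_mul, star_mul, hus]
      noncomm_ring
    rw [← norm_corner hinj, h1]
    refine (norm_mul_le _ _).trans (le_trans (mul_le_mul (norm_mul_le _ _) le_rfl (norm_nonneg _)
      (by positivity)) ?_)
    rw [norm_corner hinj]
    calc ‖u‖ * _ * ‖u‖ ≤ 1 * η * 1 := by gcongr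
      _ = η := by ring
  · rw [rk_cornerTrace τ.1 (star_mul_self_nonneg z), hzz, ← hrkw τ]
    exact rk_conj_le τ.2.1 hw0 _

/-- Comparison of projections by rank in `l^∞(A)/I`. -/
lemma exists_star_mul_self_eq_of_qrank_evLE (helem : ¬ IsElementary A) (hcomp : StrictComparison A)
    {P R : SeqQuotient (closure (QT A))} (hP : IsStarProjection P) (hR : IsStarProjection R)
    (h : EvLE (qrank P) (qrank R)) :
    ∃ Y : SeqQuotient (closure (QT A)), star Y * Y = P ∧ R * Y = Y := by
  have hsub (τ : DQT A) := isSubadditive_cornerTrace hsimple hinj τ.2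
  obtain ⟨a, u, ha, haP, hu, huP⟩ := exists_cutoff_lift hsimple hinj hP (ε := 1 / 2) (by norm_num)
    (by norm_num)
  obtain ⟨b, β, hb, hbR, hβ, hβR⟩ := exists_cutoff_lift hsimple hinj hR one_pos le_rfl
  obtain ⟨k, hk, hkb⟩ := exists_lift_eq_cfcₙ hsimple hinj hb
    (by rw [hbR, hR.isIdempotentElem.eq]) (f := cutoff (1 / 2)) (by fun_prop) (by simp)
    (cutoff_eq_one (by norm_num) (by norm_num))
    (fun x => by rw [abs_of_nonneg (cutoff_nonneg _ x)]; exact cutoff_le_one _ x)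
  have hu0 (n : ℕ) : 0 ≤ u n := hu n ▸ cfcₙ_cutoff_nonneg _ _
  have hu1 (n : ℕ) : ‖u n‖ ≤ 1 := hu n ▸ norm_cfcₙ_cutoff_le _ _
  have hβ0 (n : ℕ) : 0 ≤ β n := hβ n ▸ cfcₙ_cutoff_nonneg _ _
  have hkβ (n : ℕ) : k n * β n = β n := by rw [hk, hβ, cutoff_half_mul_cutoff _ one_pos]
  -- `u = f_{1/2}(a)` vanishes where `a ≤ 1/4`, and `β = f_1(b)` is at least `1/2` where `b ≥ 3/4`;
  -- both ranks thus compare with cut-downs of the lifts.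
  have hle : EvLE (fun n τ => rk (cornerTrace τ.1) (u n))
      (fun n τ => rk (cornerTrace τ.1) (β n * β n)) := by
    refine EvLE.trans (.of_le fun n τ _ => ?_)
      ((evLE_qrank hsimple hinj hP ha haP (s := 1 / 8) (by norm_num) (by norm_num)).trans
      (h.trans ((qrank_evLE hsimple hinj hR hb hbR (s := 3 / 4) (by norm_num) (by norm_num)).trans
        (.of_le fun n τ _ => ?_))))
    · rw [hu]
      refine rk_cfcₙ_le (hsub τ).1 (ha n) (by fun_prop) (by fun_prop) (by simp)
        (ramp_zero (by norm_num)) (fun x _ => cutoff_nonneg _ _) (fun x _ => ramp_nonneg _ _)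
        (r := 8) (by norm_num) fun x hx0 hx => ?_
      rcases le_total x (1 / 4) with h | h
      · rw [cutoff_eq_zero (by norm_num) (by linarith)]
        exact mul_nonneg (by norm_num) (ramp_nonneg _ _)
      · refine (cutoff_le_one _ x).trans ?_
        have : 1 / 8 ≤ ramp (1 / 8) x := le_max_of_le_left (by linarith)
        linarith
    · have h1 : β n * β n = cfcₙ (fun x => cutoff 1 x * cutoff 1 x) (b n) := by
        rw [hβ, cfcₙ_mul _ _ _ (by fun_prop) (by simp) (by fun_prop) (by simp)]
      rw [h1]
      refine rk_cfcₙ_le (hsub τ).1 (hb n) (by fun_prop) (by fun_prop) (ramp_zero (by norm_num))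
        (by simp) (fun x _ => ramp_nonneg _ _) (fun x _ => mul_self_nonneg _)
        (r := 4 * (‖b n‖ + 1)) (by positivity) fun x hx0 hx => ?_
      rcases le_total x (3 / 4) with h | h
      · rw [ramp, max_eq_right (by linarith)]
        exact mul_nonneg (by positivity) (mul_self_nonneg _)
      · have h2 : 1 / 2 ≤ cutoff 1 x :=
          le_max_of_le_right (le_min (by norm_num) (by linarith))
        have h3 : 1 / 4 ≤ cutoff 1 x * cutoff 1 x := by nlinarith
        calc ramp (3 / 4) x ≤ ‖b n‖ + 1 := max_le (by linarith) (by positivity)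
          _ = 4 * (‖b n‖ + 1) * (1 / 4) := by ring
          _ ≤ _ := by gcongr
  set C : ℕ → ℕ → A → A → Prop := fun m n y z => k n * y = y ∧
    ‖u n * u n * u n - (star y * y + star z * z)‖ ≤ 1 / ((m : ℝ) + 1) ∧
    ∀ τ ∈ QT A, rk (cornerTrace τ.1) (star z * z) ≤ ((m : ℝ≥0∞) + 1)⁻¹ with hC
  have hev (m : ℕ) : ∀ᶠ n in atTop, ∃ y z, C m n y z := by
    obtain ⟨e, he, c, hc, hec⟩ := exists_rk_corner_mem_Icc hsimple helem hinj m
    -- An error `c/2`, against a rank of `e` that is at least `c`, leaves the strict inequality that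
    -- strict comparison needs.
    filter_upwards [hle (c / 2) (ENNReal.half_pos hc.ne')] with n hn
    obtain ⟨y, z, hy, hyz, hz⟩ := exists_approx_star_mul_self hsimple hinj hcomp (hu0 n) (hu1 n)
      (hβ0 n).isSelfAdjoint he (η := 1 / ((m : ℝ) + 1)) (fun τ hτ => by
        have h1 := (hec τ hτ).1
        rw [← rk_cornerTrace τ.1 he] at h1
        have hβ2 : 0 ≤ β n * β n := by
          nth_rw 1 [← (hβ0 n).isSelfAdjoint.star_eq]; exact star_mul_self_nonneg _
        have hfin : rk (cornerTrace τ.1) (β n * β n) ≠ ⊤ := by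
          rw [rk_cornerTrace τ.1 hβ2]
          exact ((rk_corner_le_one hτ hβ2).trans_lt ENNReal.one_lt_top).ne
        have hcfin : c ≠ ⊤ :=
          (((hec τ hτ).1.trans (rk_corner_le_one hτ he)).trans_lt ENNReal.one_lt_top).ne
        exact (hn τ hτ).trans_lt (ENNReal.add_lt_add_left hfin
          ((ENNReal.half_lt_self hc.ne' hcfin).trans_le h1))) (by positivity)
    refine ⟨y, z, hy _ (hkβ n), hyz, fun τ hτ => (hz τ hτ).trans ?_⟩
    rw [rk_cornerTrace τ.1 he]
    exact (hec τ hτ).2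
  classical
  -- Diagonal choice: at index `n` the best precision `m ≤ n` attained there. It tends to infinity,
  -- since each precision is attained from some index on.
  set K : ℕ → ℕ := fun n => Nat.findGreatest (fun m => ∃ y z, C m n y z) n with hK
  have hKC : ∀ᶠ n in atTop, ∃ y z, C (K n) n y z := by
    filter_upwards [hev 0] with n hn
    exact Nat.findGreatest_spec (P := fun m => ∃ y z, C m n y z) (Nat.zero_le n) hn
  have hKtop : Tendsto K atTop atTop := by
    refine tendsto_atTop.2 fun m => ?_
    filter_upwards [hev m, eventually_ge_atTop m] with n hn hmn
    exact Nat.le_findGreatest hmn hn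
  have hbound {m n : ℕ} {y z : A} (h : C m n y z) : ‖y‖ ≤ 2 ∧ ‖z‖ ≤ 2 := by
    have h1 : ‖u n * u n * u n‖ ≤ 1 :=
      (norm_mul_le _ _).trans (mul_le_one₀ ((norm_mul_le _ _).trans
        (mul_le_one₀ (hu1 n) (norm_nonneg _) (hu1 n))) (norm_nonneg _) (hu1 n))
    have h2 : ‖star y * y + star z * z‖ ≤ 2 := by
      have h3 := norm_sub_norm_le (star y * y + star z * z) (u n * u n * u n)
      rw [norm_sub_rev] at h3
      have h4 : 1 / ((m : ℝ) + 1) ≤ 1 := by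
        rw [div_le_one (by positivity)]; linarith [(Nat.cast_nonneg m : (0 : ℝ) ≤ m)]
      linarith [h.2.1]
    have h3 (v : A) (hv : star v * v ≤ star y * y + star z * z) : ‖v‖ ≤ 2 := by
      have := CStarAlgebra.norm_le_norm_of_nonneg_of_le (star_mul_self_nonneg v) hv
      rw [CStarRing.norm_star_mul_self] at this
      nlinarith [norm_nonneg v]
    exact ⟨h3 y (le_add_of_nonneg_right (star_mul_self_nonneg z)),
      h3 z (le_add_of_nonneg_left (star_mul_self_nonneg y))⟩
  -- The uniform bound makes the choices elements of `l^∞(A)`; zero serves at the finitely many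
  -- indices without a choice.
  have hyz (n : ℕ) : ∃ y z : A, ‖y‖ ≤ 2 ∧ ‖z‖ ≤ 2 ∧ ((∃ y z, C (K n) n y z) → C (K n) n y z) := by
    by_cases hn : ∃ y z, C (K n) n y z
    · obtain ⟨y, z, hn⟩ := hn
      exact ⟨y, z, (hbound hn).1, (hbound hn).2, fun _ => hn⟩
    · exact ⟨0, 0, by simp, by simp, fun h => (hn h).elim⟩
  choose y z hy2 hz2 hyz using hyz
  obtain ⟨Y, hY⟩ := exists_lp_eq y 2 hy2
  obtain ⟨Z, hZ⟩ := exists_lp_eq z 2 hz2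
  have hZ0 : mkQ Z = 0 := by
    rw [← mkQ_zero, mkQ_eq_iff hsimple hinj]
    intro t ht ε hε
    have hlim : Tendsto (fun n => ((K n : ℝ≥0∞) + 1)⁻¹) atTop (𝓝 0) := by
      have h1 : Tendsto (fun n : ℕ => (n : ℝ≥0∞)⁻¹) atTop (𝓝 0) := ENNReal.tendsto_inv_nat_nhds_zero
      have h2 := h1.comp (tendsto_add_atTop_nat 1 |>.comp hKtop)
      refine h2.congr fun n => ?_
      simp
    filter_upwards [hKC, ENNReal.tendsto_nhds_zero.1 hlim ε hε] with n hn hnε τ hτ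
    rw [Pi.zero_apply, Pi.zero_apply, zero_add, rkSeq, lp.coeFn_zero, Pi.zero_apply, sub_zero, hZ]
    exact (rk_mono (hsub τ).1 (cfcₙ_ramp_nonneg _ _)
      (cfcₙ_ramp_le (star_mul_self_nonneg _) ht.le)).trans (((hyz n hn).2.2 τ hτ).trans hnε)
  have hYP : mkQ (u * u * u) = mkQ (star Y * Y + star Z * Z) := by
    refine mkQ_eq_of_tendsto hsimple hinj (squeeze_zero' (Eventually.of_forall fun _ => norm_nonneg _)
      ?_ (tendsto_one_div_add_atTop_nhds_zero_nat.comp hKtop))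
    filter_upwards [hKC] with n hn
    simpa only [lp.coeFn_add, Pi.add_apply, lp.infty_coeFn_mul, Pi.mul_apply, lp.star_apply, hY, hZ,
      Function.comp_apply] using (hyz n hn).2.1
  have hkY : mkQ (k * Y) = mkQ Y := by
    refine mkQ_eq_of_tendsto hsimple hinj (tendsto_const_nhds.congr' ?_)
    filter_upwards [hKC] with n hn
    rw [lp.infty_coeFn_mul, Pi.mul_apply, hY, (hyz n hn).1, sub_self, norm_zero]
  refine ⟨mkQ Y, ?_, ?_⟩
  · rw [mkQ_add, mkQ_mul (star Z), hZ0, mul_zero, add_zero, mkQ_mul, mkQ_mul, mkQ_mul, mkQ_star, huP,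
      hP.isIdempotentElem.eq, hP.isIdempotentElem.eq] at hYP
    exact hYP.symm
  · rwa [mkQ_mul, hkb, hbR] at hkY

/-- Asymptotically `rank p + rank (r - p) ≤ rank r ≤ rank q + rank (r - q)` and `rank q ≤ rank p`;
subtract the finite `rank p`. -/
lemma qrank_sub_evLE {p q r v : SeqQuotient (closure (QT A))} (hp : IsStarProjection p)
    (hq : IsStarProjection q) (hr : IsStarProjection r) (hpr : p * r = p) (hqr : q * r = q)
    (hv : star v * v = p) (hv' : v * star v = q) : EvLE (qrank (r - p)) (qrank (r - q)) := by
  have key (s : SeqQuotient (closure (QT A))) (hs : IsStarProjection s) (hsr : s * r = s) :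
      (r - s) * s = 0 := by
    have := congrArg star hsr
    rw [star_mul, hs.isSelfAdjoint.star_eq, hr.isSelfAdjoint.star_eq] at this
    rw [sub_mul, this, hs.isIdempotentElem.eq, sub_self]
  have h1 := qrank_add_evLE hsimple hinj hp (hp.sub_of_mul_eq_left hr hpr) (key p hp hpr)
  have h2 := qrank_add_le hsimple hinj hq (hq.sub_of_mul_eq_left hr hqr) (key q hq hqr)
  rw [add_sub_cancel] at h1 h2
  have h3 := qrank_evLE_of_star_mul_self hsimple hinj (v := star v) hq hp (by rwa [star_star])
    (by rwa [star_star])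
  exact ((h1.trans h2).trans (h3.add (.refl _))).cancel fun n τ hτ => qrank_le_one p n hτ

/-- One comparison gives `P ∼ E` with `E` below `R`. Additivity and the other rank inequality make
the rank of `R - E` zero, so `E = R`. -/
lemma mvNEquiv_of_qrank_evLE (helem : ¬ IsElementary A) (hcomp : StrictComparison A)
    {P R : SeqQuotient (closure (QT A))} (hP : IsStarProjection P) (hR : IsStarProjection R)
    (h : EvLE (qrank P) (qrank R)) (h' : EvLE (qrank R) (qrank P)) : MvNEquiv P R := by
  obtain ⟨X, hX, hRX⟩ := exists_star_mul_self_eq_of_qrank_evLE hsimple hinj helem hcomp hP hR h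
  -- This makes `YP = Y` hold by algebra alone, without a C⋆-norm on the quotient.
  set Y := X * P with hY
  have hYY : star Y * Y = P := by
    rw [hY, star_mul, hP.isSelfAdjoint.star_eq, mul_assoc, ← mul_assoc (star X), hX,
      hP.isIdempotentElem.eq, hP.isIdempotentElem.eq]
  have hYP : Y * P = Y := by rw [hY, mul_assoc, hP.isIdempotentElem.eq]
  have hRY : R * Y = Y := by rw [hY, ← mul_assoc, hRX]
  set E := Y * star Y with hE
  have hEproj : IsStarProjection E := by
    refine ⟨?_, IsSelfAdjoint.mul_star_self Y⟩
    rw [IsIdempotentElem, hE, mul_assoc, ← mul_assoc (star Y), hYY, ← mul_assoc, hYP]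
  have hRE : R * E = E := by rw [hE, ← mul_assoc, hRY]
  have hER : E * R = E := by
    have := congrArg star hRE
    rwa [star_mul, hEproj.isSelfAdjoint.star_eq, hR.isSelfAdjoint.star_eq] at this
  have hd := hEproj.sub_of_mul_eq_left hR hER
  have h1 := qrank_add_evLE hsimple hinj hEproj hd
    (by rw [sub_mul, hRE, hEproj.isIdempotentElem.eq, sub_self])
  rw [add_sub_cancel] at h1
  have h2 := (h1.trans h').trans (qrank_evLE_of_star_mul_self hsimple hinj hP hEproj hYY rfl)
  have h3 : R - E = 0 := eq_zero_of_qrank_evLE hsimple hinj hd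
    (EvLE.cancel (fun n τ hτ => qrank_le_one E n hτ) (h2.trans (.of_le fun n τ _ => le_self_add)))
  exact ⟨Y, hYY, (sub_eq_zero.1 h3).symm⟩

end Cancellation

end QTrace

theorem mainTheorem9 {A : Type*} [NonUnitalCStarAlgebra A] [PartialOrder A] [StarOrderedRing A]
    (hsimple : IsSimpleRing A) (helem : ¬ QTrace.IsElementary A)
    (hQT : (QTrace.QT A).Nonempty) (hcomp : QTrace.StrictComparison A) :
    QTrace.HasProjectionCancellation (QTrace.SeqQuotient (closure (QTrace.QT A))) := by
  have hinj := QTrace.corner_injective hsimple hQT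
  rintro p q r hp hq hr hpr hqr ⟨v, hv, hv'⟩
  exact QTrace.mvNEquiv_of_qrank_evLE hsimple hinj helem hcomp (hp.sub_of_mul_eq_left hr hpr)
    (hq.sub_of_mul_eq_left hr hqr)
    (QTrace.qrank_sub_evLE hsimple hinj hp hq hr hpr hqr hv hv')
    (QTrace.qrank_sub_evLE hsimple hinj (v := star v) hq hp hr hqr hpr (by rwa [star_star])
      (by rwa [star_star]))
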